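/- Let $D=-i\partial_x$ on $\mathbb R$, let $K=\sqrt{\tanh D/D}$ be the Fourier multiplier with symbol $\sqrt{\tanh\xi/\xi}$ (equal to $1$ at $\xi=0$), and consider the system $$\partial_t\eta+\partial_x v=-K^2\partial_x(\eta v),\qquad \partial_t v+K^2\partial_x\eta=-K^2\partial_x(v^2/2)$$ for real-valued $\eta,v$. For $s\ge 0$ let $X^s=H^s(\mathbb R)\times H^{s+1/2}(\mathbb R)$ with the norm $\|(f,g)\|_{X^s}^2=\|f\|_{H^s}^2+\|K^{-1}g\|_{H^s}^2$, where $\|f\|_{H^s}=\|(1+D^2)^{s/2}f\|_{L^2}$; let also $\|(f,g)\|_{L^2\times H^{1/2}}^2=\|f\|_{L^2}^2+\|g\|_{H^{1/2}}^2$. A solution in $X^s$ on a time interval $I\ni 0$ is a function $u=(\eta,v)\in C(I;X^s)$ that satisfies the system on $I$ in the sense of distributions in $x$; write $u_0=u(0)$. (1) Persistence of regularity. For every $s>0$ there is a constant $C_s>0$ depending only on $s$ such that for every solution $u=(\eta,v)$ in $X^s$ on an interval $I\ni0$ and all $t\in I$, $t\ge 0$: if $s<1/2$ then $$\|u(t)\|_{X^s}\le\|u_0\|_{X^s}+C_s\int_0^t\big(\|v\|_{H^{1/2}}+\|v\|_{L^\infty}\big)\|u\|_{X^s}\,dt',$$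 and if $s\ge 1/2$ then $$\|u(t)\|_{X^s}\le\|u_0\|_{X^s}+C_s\int_0^t\|v\|_{H^{s+1/4}}\|u\|_{X^s}\,dt'.$$ Moreover, there is a constant $\epsilon_0>0$ such that the following two statements hold. (2) Global bound. For every $\epsilon\in(0,\epsilon_0]$ and every solution $u$ in $X^0$ on an interval $I\ni 0$: if $\|u_0\|_{L^2\times H^{1/2}}\le\epsilon/2$, then $\|u(t)\|_{L^2\times H^{1/2}}\le\epsilon$ for all $t\in I$; the same holds with the $X^0$-norm in place of the $L^2\times H^{1/2}$-norm. (3) A priori estimates. Let $s>0$ and let $u=(\eta,v)$ be a solution in $X^s$ on an interval $I\ni 0$ with $\|u_0\|_{X^0}\le\epsilon_0/2$. Then, with a constant $C>0$ depending only on $s$, $\|u_0\|_{X^0}$ and $\|u_0\|_{X^s}$, for all $t\in I$, $t\ge0$: if $s<1/2$ then $$\|u(t)\|_{X^s}\le\exp\big(Ce^{Ct}\big),$$ and if $s\ge1/2$ then $$\|u(t)\|_{X^s}\le\|u_0\|_{X^s}\exp\Big(C\int_0^t\|v\|_{H^{s+1/4}}\,dt'\Big).$$ -/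

import Mathlib

open MeasureTheory Filter Topology
open scoped FourierTransform SchwartzMap ENNReal

noncomputable section

namespace WhithamBoussinesq

/-- Real valued square integrable functions on the line. -/
abbrev L2 : Type := Lp ℝ 2 (volume : Measure ℝ)

/-- The symbol `κ ↦ √(tanh κ / κ)` of the Whitham operator `K`, with its limit value `1` at `0`. -/
def symK (κ : ℝ) : ℝ := if κ = 0 then 1 else Real.sqrt (Real.tanh κ / κ)

/-- The symbol `⟨κ⟩ ^ s = (1 + κ ^ 2) ^ (s / 2)` of the operator `J ^ s`. -/
def symJ (s κ : ℝ) : ℝ := (1 + κ ^ 2) ^ (s / 2)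

/-- The Fourier transform (kernel `exp (-2 π i x ξ)`) of a real valued square integrable function.
With this normalization `D = -i ∂ₓ` acts as multiplication by `2 π ξ`. -/
def hat (f : L2) : Lp ℂ 2 (volume : Measure ℝ) := 𝓕 (Complex.ofRealCLM.compLp f)

/-- The function `ξ ↦ m(2 π ξ) * (hat f)(ξ)`, i.e. the Fourier transform of `m(D) f`. -/
def multHat (m : ℝ → ℝ) (f : L2) (ξ : ℝ) : ℂ := (m (2 * Real.pi * ξ) : ℂ) * hat f ξ

/-- The norm `‖m(D) f‖` in `L²` (by Plancherel), meaningful if `multHat m f` is in `L²`. -/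
def multNorm (m : ℝ → ℝ) (f : L2) : ℝ := (eLpNorm (multHat m f) 2 volume).toReal

/-- Membership in the Sobolev space `H^s(ℝ)`, for `s ≥ 0`. -/
def MemH (s : ℝ) (f : L2) : Prop := MemLp (multHat (symJ s) f) 2 volume

/-- The norm `‖f‖_{H^s} = ‖J^s f‖_{L²}`. -/
def normH (s : ℝ) (f : L2) : ℝ := multNorm (symJ s) f

/-- The norm of `L^∞(ℝ)`. -/
def normLinfty (f : L2) : ℝ := (eLpNorm f ∞ volume).toReal

/-- The norm of `X^s = H^s × H^{s+1/2}`: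
`‖(f, g)‖_{X^s}² = ‖f‖_{H^s}² + ‖K⁻¹ g‖_{H^s}²`. -/
def normX (s : ℝ) (f g : L2) : ℝ :=
  Real.sqrt (normH s f ^ 2 + multNorm (fun κ => symJ s κ * (symK κ)⁻¹) g ^ 2)

/-- The standard norm of `L² × H^{1/2}`. -/
def normL2H (f g : L2) : ℝ := Real.sqrt (normH 0 f ^ 2 + normH (1 / 2) g ^ 2)

/-- The operator `K² ∂ₓ` applied to a Schwartz function. -/
def opK2dx (φ : 𝓢(ℝ, ℂ)) : ℝ → ℂ :=
  𝓕⁻ (fun ξ : ℝ => ((symK (2 * Real.pi * ξ) : ℂ) ^ 2 * (Complex.I * (2 * Real.pi * ξ : ℝ))) *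
    𝓕 (φ : ℝ → ℂ) ξ)

/-- The pair `(η, v)` is, on the time interval `I`, a solution of class `C(I; X^s)` of the system
`∂ₜ η + ∂ₓ v = -K² ∂ₓ (η v)`, `∂ₜ v + K² ∂ₓ η = -K² ∂ₓ (v² / 2)`.
The equations hold in the sense of distributions in `x` for each time in `I`
(the operators `∂ₓ` and `K² ∂ₓ` are antisymmetric). -/
structure IsSolution (s : ℝ) (I : Set ℝ) (η v : ℝ → L2) : Prop where
  mem_eta : ∀ t ∈ I, MemH s (η t)
  mem_v : ∀ t ∈ I, MemH (s + 1 / 2) (v t)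
  continuous : ∀ t₀ ∈ I,
    Tendsto (fun t => normX s (η t - η t₀) (v t - v t₀)) (𝓝[I] t₀) (𝓝 0)
  eq_eta : ∀ φ : 𝓢(ℝ, ℂ), ∀ t ∈ I,
    HasDerivWithinAt (fun τ => ∫ x, (η τ x : ℂ) * φ x)
      ((∫ x, (v t x : ℂ) * deriv φ x) + ∫ x, ((η t x * v t x : ℝ) : ℂ) * opK2dx φ x) I t
  eq_v : ∀ φ : 𝓢(ℝ, ℂ), ∀ t ∈ I,
    HasDerivWithinAt (fun τ => ∫ x, (v τ x : ℂ) * φ x)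
      ((∫ x, (η t x : ℂ) * opK2dx φ x) + ∫ x, ((v t x ^ 2 / 2 : ℝ) : ℂ) * opK2dx φ x) I t

end WhithamBoussinesq

end

noncomputable section

namespace WhithamBoussinesq

/-! Write `κ = 2πξ`. The operator `K²∂ₓ` has the bounded symbol `i tanh κ`, and `K⁻² tanh κ = κ`. In
the energy `‖J^s η‖² + ‖J^s K⁻¹ v‖²` the linear terms therefore cancel exactly (`linear_cancel`).
The nonlinearity of the first equation costs no derivative. That of the second, paired with `K⁻² v`,
costs one derivative, which is shared as one half for each factor, just what `v ∈ H^{s+1/2}`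
provides. The energy thus grows at most like `flux`, an expression in moduli of Fourier transforms,
and persistence of regularity reduces to product estimates. For `s ≥ 1/2` these are Cauchy-Schwarz
in the convolution (`exists_flux_le_of_half_le`). For `s < 1/2` they are estimates of Gagliardo
seminorms of `ηv` and `v²` (`exists_flux_le_of_lt_half`).

Solutions are only distributional, so every identity is derived for sharp truncations to `|ξ| ≤ N`.
There the system is an ordinary differential equation in `L²` (`IsSolution.hasDeriv`), and `N → ∞`
is taken after integration in time (`IsSolution.normX_le`).

The global bound comes from the Hamiltonian `‖η‖² + ‖K⁻¹v‖² + ∫ η v²`, for which the system reads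
`∂ₜη = -½K²∂ₓ δH/δv`, `∂ₜv = -½K²∂ₓ δH/δη`. In `X⁰` it cannot be differentiated directly. The
derivative of the truncated Hamiltonian is `defect` (`dHam_eq_defect`), each term of which contains
a factor at frequencies above `N`. `v ∈ H^{1/2}` misses integrability of its Fourier transform by a
logarithm. This is recovered either from a commutator with `tanh` or from the fact that one
frequency below `N` and one above, at difference `θ`, are confined to a set of measure `O(|θ|)`.
Hence `defect` is bounded by the tail of the `X⁰` norm (`exists_defect_le`) and tends to zero
(`IsSolution.tendsto_ham_sub`). Since the cubic part is `O(‖u‖³)`, a continuity argument keeps small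
solutions small (`exists_global_bound`).

The a priori estimates follow by Gronwall. For `s < 1/2` the `L^∞` norm is controlled by the
`H^{1/2}` norm, bounded by the previous step, times a logarithm of the `X^s` norm
(`exists_normLinfty_le_log`). An inequality of the type `X' ≤ c (1 + log X) X` then gives the double
exponential. -/

/-- Complex valued square integrable functions on the line. -/
abbrev LC : Type := Lp ℂ 2 (volume : Measure ℝ)

/-! ### The Fourier transform of real square integrable functions and of their products -/

/-- The complexification of a real valued square integrable function. -/
def toC (f : L2) : LC := Complex.ofRealCLM.compLp f

lemma toC_ae (f : L2) : toC f =ᵐ[volume] fun x => (f x : ℂ) :=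
  Complex.ofRealCLM.coeFn_compLp f

lemma hat_def (f : L2) : hat f = 𝓕 (toC f) := rfl

lemma toC_sub (f g : L2) : toC (f - g) = toC f - toC g :=
  (Complex.ofRealCLM.compLpL 2 (volume : Measure ℝ)).map_sub f g

lemma norm_toC (f : L2) : ‖toC f‖ = ‖f‖ := by
  rw [Lp.norm_def, Lp.norm_def]
  congr 1
  refine eLpNorm_congr_norm_ae ?_
  filter_upwards [toC_ae f] with x hx
  rw [hx]; simp

lemma hat_sub (f g : L2) : hat (f - g) = hat f - hat g := by
  rw [hat_def, toC_sub]; exact (Lp.fourierTransformₗᵢ ℝ ℂ).map_sub _ _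

lemma norm_hat (f : L2) : ‖hat f‖ = ‖f‖ := by
  rw [hat_def, Lp.norm_fourier_eq, norm_toC]

/-- The Fourier transform on `L²` agrees with that of tempered distributions, where this
multiplication formula is the definition. -/
lemma integral_fourier_Lp_mul (F : LC) (ψ : 𝓢(ℝ, ℂ)) :
    ∫ x, (𝓕 F : LC) x * ψ x = ∫ x, F x * 𝓕 (ψ : ℝ → ℂ) x := by
  have h := congrArg (fun u : 𝓢'(ℝ, ℂ) => u ψ) (Lp.fourier_toTemperedDistribution_eq F)
  simp only [TemperedDistribution.fourier_apply, Lp.toTemperedDistribution_apply,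
    smul_eq_mul] at h
  rw [SchwartzMap.fourier_coe] at h
  simp only [mul_comm] at h ⊢
  exact h.symm

lemma integral_hat_mul (f : L2) (ψ : 𝓢(ℝ, ℂ)) :
    ∫ x, hat f x * ψ x = ∫ x, (f x : ℂ) * 𝓕 (ψ : ℝ → ℂ) x := by
  rw [hat_def, integral_fourier_Lp_mul]
  refine integral_congr_ae ?_
  filter_upwards [toC_ae f] with x hx
  rw [hx]

/-- The tool for identifying an `L²` Fourier transform: compactly supported smooth tests suffice, so
`G` need only be locally integrable. -/
lemma fourier_Lp_ae_eq (F : LC) (G : ℝ → ℂ) (hG : LocallyIntegrable G)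
    (h : ∀ ψ : 𝓢(ℝ, ℂ), HasCompactSupport ψ →
      ∫ x, F x * 𝓕 (ψ : ℝ → ℂ) x = ∫ x, G x * ψ x) :
    (𝓕 F : LC) =ᵐ[volume] G := by
  refine ae_eq_of_integral_contDiff_smul_eq
    ((Lp.memLp _).locallyIntegrable (by norm_num)) hG fun g hg hc => ?_
  have hc' : HasCompactSupport (fun x => (g x : ℂ)) := hc.comp_left (g := fun x : ℝ => (x : ℂ)) rfl
  have hg' : ContDiff ℝ ((⊤ : ℕ∞) : WithTop ℕ∞) (fun x => (g x : ℂ)) :=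
    Complex.ofRealCLM.contDiff.comp hg
  have h1 := integral_fourier_Lp_mul F (hc'.toSchwartzMap hg')
  have h2 := h (hc'.toSchwartzMap hg') hc'
  rw [← h1] at h2
  simpa [Complex.real_smul, mul_comm] using h2

lemma locallyIntegrable_Lp (F : LC) : LocallyIntegrable F :=
  (Lp.memLp F).locallyIntegrable (by norm_num)

/-- The Fourier transform of a product as a function. -/
def prodHat (f g : L2) (ξ : ℝ) : ℂ := 𝓕 (fun x => ((f x * g x : ℝ) : ℂ)) ξ

lemma integrable_mul_L2 (f g : L2) : Integrable (fun x => f x * g x) :=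
  (Lp.memLp f).integrable_mul (Lp.memLp g)

lemma integral_prodHat_mul (f g : L2) {ψ : ℝ → ℂ} (hψ : Integrable ψ) :
    ∫ x, prodHat f g x * ψ x = ∫ x, ((f x * g x : ℝ) : ℂ) * 𝓕 ψ x := by
  have := VectorFourier.integral_fourierIntegral_smul_eq_flip (L := innerₗ ℝ) (μ := volume)
    (ν := volume) (f := fun x => ((f x * g x : ℝ) : ℂ)) (g := ψ)
    Real.continuous_fourierChar continuous_inner (integrable_mul_L2 f g).ofReal hψ
  have h2 : (innerₗ ℝ).flip = innerₗ ℝ := by ext; simp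
  rw [h2] at this
  exact this

lemma continuous_prodHat (f g : L2) : Continuous (prodHat f g) :=
  VectorFourier.fourierIntegral_continuous Real.continuous_fourierChar (by exact continuous_inner)
    (integrable_mul_L2 f g).ofReal

/-- A product that happens to lie in `L²` has two Fourier transforms, the `L¹` integral `prodHat`
and the `L²` one. Both satisfy the multiplication formula, so they coincide. -/
lemma hat_eq_prodHat {f g p : L2} (hp : p =ᵐ[volume] fun x => f x * g x) :
    hat p =ᵐ[volume] prodHat f g := by
  refine fourier_Lp_ae_eq _ _ (continuous_prodHat f g).locallyIntegrable fun ψ hψ => ?_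
  rw [integral_prodHat_mul f g ψ.integrable]
  refine integral_congr_ae ?_
  filter_upwards [toC_ae p, hp] with x h1 h2
  rw [show (Complex.ofRealCLM.compLp p : LC) = toC p from rfl, h1, h2]

/-! ### Modulations, translations and the convolution theorem -/

/-- Translate of a compactly supported Schwartz function. -/
lemma exists_translate {ψ : 𝓢(ℝ, ℂ)} (hψ : HasCompactSupport ψ) (a : ℝ) :
    ∃ φ : 𝓢(ℝ, ℂ), HasCompactSupport φ ∧ ∀ x, φ x = ψ (x - a) := by
  have hc : HasCompactSupport (fun x => ψ (x - a)) := by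
    have := hψ.comp_homeomorph (Homeomorph.addRight (-a))
    simpa [Function.comp_def, sub_eq_add_neg] using this
  have hd : ContDiff ℝ ((⊤ : ℕ∞) : WithTop ℕ∞) (fun x => ψ (x - a)) :=
    (ψ.smooth _).comp (contDiff_id.sub contDiff_const)
  exact ⟨hc.toSchwartzMap hd, hc, fun x => rfl⟩

/-- A compactly supported Schwartz function times a smooth function. -/
lemma exists_smooth_mul {ψ : 𝓢(ℝ, ℂ)} (hψ : HasCompactSupport ψ) {m : ℝ → ℂ}
    (hm : ContDiff ℝ ((⊤ : ℕ∞) : WithTop ℕ∞) m) :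
    ∃ φ : 𝓢(ℝ, ℂ), HasCompactSupport φ ∧ ∀ x, φ x = m x * ψ x := by
  have hc : HasCompactSupport (fun x => m x * ψ x) := hψ.mul_left
  exact ⟨hc.toSchwartzMap (hm.mul (ψ.smooth _)), hc, fun x => rfl⟩

lemma fourier_shift (ψ : ℝ → ℂ) (a x : ℝ) :
    𝓕 (fun y => ψ (y - a)) x = 𝐞 (-(a * x)) • 𝓕 ψ x := by
  rw [Real.fourier_real_eq, Real.fourier_real_eq, ← integral_sub_right_eq_self _ (-a)]
  simp only [Circle.smul_def, smul_eq_mul]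
  rw [← integral_const_mul]
  congr 1; ext v
  rw [← mul_assoc, ← Circle.coe_mul, ← AddChar.map_add_eq_mul]
  congr 2
  · congr 2; ring
  · ring

lemma fourier_modulate (ψ : ℝ → ℂ) (a x : ℝ) :
    𝓕 (fun y => (𝐞 (a * y) : ℂ) * ψ y) x = 𝓕 ψ (x - a) := by
  rw [Real.fourier_real_eq, Real.fourier_real_eq]
  congr 1; ext v
  simp only [Circle.smul_def, smul_eq_mul]
  rw [← mul_assoc, ← Circle.coe_mul, ← AddChar.map_add_eq_mul]
  congr 3; ring

lemma contDiff_char (a : ℝ) :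
    ContDiff ℝ ((⊤ : ℕ∞) : WithTop ℕ∞) (fun y : ℝ => (𝐞 (a * y) : ℂ)) := by
  simp only [Real.fourierChar_apply]
  refine Complex.contDiff_exp.comp ?_
  refine ContDiff.mul ?_ contDiff_const
  exact Complex.ofRealCLM.contDiff.comp (contDiff_const.mul (contDiff_const.mul contDiff_id))

lemma continuous_char (a : ℝ) : Continuous (fun y : ℝ => (𝐞 (a * y) : ℂ)) :=
  (contDiff_char a).continuous

lemma memLp_char_mul (F : LC) (a : ℝ) : MemLp (fun x => (𝐞 (a * x) : ℂ) * F x) 2 volume :=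
  (Lp.memLp F).of_le ((continuous_char a).aestronglyMeasurable.mul (Lp.memLp F).1)
    (Eventually.of_forall fun x => by rw [norm_mul, Circle.norm_coe, one_mul])

/-- Modulation of a square integrable function. -/
def modulate (a : ℝ) (F : LC) : LC := (memLp_char_mul F a).toLp

lemma modulate_ae (a : ℝ) (F : LC) :
    modulate a F =ᵐ[volume] fun x => (𝐞 (a * x) : ℂ) * F x := (memLp_char_mul F a).coeFn_toLp

lemma fourier_modulate_Lp (a : ℝ) (F : LC) :
    (𝓕 (modulate a F) : LC) =ᵐ[volume] fun x => (𝓕 F : LC) (x - a) := by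
  have hq := measurePreserving_sub_right (volume : Measure ℝ) a
  refine fourier_Lp_ae_eq _ _
    (((Lp.memLp _).comp_measurePreserving hq).locallyIntegrable (by norm_num)) fun ψ hψ => ?_
  obtain ⟨φ, -, hφ⟩ := exists_translate hψ (-a)
  have h1 : ∫ x, (𝓕 F : LC) (x - a) * ψ x = ∫ x, (𝓕 F : LC) x * φ x := by
    rw [← integral_sub_right_eq_self (fun x => (𝓕 F : LC) x * φ x) a]
    simp [hφ]
  rw [h1, integral_fourier_Lp_mul]
  refine integral_congr_ae ?_
  filter_upwards [modulate_ae a F] with x hx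
  rw [hx, show (φ : ℝ → ℂ) = fun y => ψ (y - (-a)) from funext hφ, fourier_shift, Circle.smul_def,
    smul_eq_mul]
  rw [show -(-a * x) = a * x by ring]; ring

lemma hat_neg (f : L2) : ∀ᵐ ξ, hat f (-ξ) = (starRingEnd ℂ) (hat f ξ) := by
  have hn : MeasurePreserving (fun x : ℝ => -x) volume volume := Measure.measurePreserving_neg _
  have key : (𝓕 (toC f) : LC) =ᵐ[volume] fun ξ => (starRingEnd ℂ) (hat f (-ξ)) := by
    have hm : MemLp (fun ξ => (starRingEnd ℂ) (hat f (-ξ))) 2 volume := by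
      have := ((Lp.memLp (hat f)).comp_measurePreserving hn)
      exact this.star
    refine fourier_Lp_ae_eq _ _ (hm.locallyIntegrable (by norm_num)) fun ψ hψ => ?_
    have hc : HasCompactSupport (fun x => (starRingEnd ℂ) (ψ (-x))) := by
      have := (hψ.comp_homeomorph (Homeomorph.neg ℝ)).comp_left (g := starRingEnd ℂ) (map_zero _)
      simpa [Function.comp_def] using this
    have hd : ContDiff ℝ ((⊤ : ℕ∞) : WithTop ℕ∞) (fun x => (starRingEnd ℂ) (ψ (-x))) :=
      (Complex.conjCLE.contDiff).comp ((ψ.smooth _).comp contDiff_neg)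
    have hv : ∀ x, (hc.toSchwartzMap hd) x = (starRingEnd ℂ) (ψ (-x)) := fun x => rfl
    have h1 := integral_hat_mul f (hc.toSchwartzMap hd)
    have h2 : ∫ x, (starRingEnd ℂ) (hat f (-x)) * ψ x =
        (starRingEnd ℂ) (∫ x, hat f x * (hc.toSchwartzMap hd) x) := by
      rw [← integral_conj, ← integral_neg_eq_self]
      congr 1; ext x
      simp [hv]
    rw [h2, h1, ← integral_conj]
    refine integral_congr_ae ?_
    filter_upwards [toC_ae f] with x hx
    rw [hx, map_mul, Complex.conj_ofReal, Real.fourier_real_eq, Real.fourier_real_eq,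
      ← integral_conj, ← integral_neg_eq_self]
    congr 2; ext y
    simp only [hv, Circle.smul_def, Real.fourierChar_apply, smul_eq_mul, map_mul,
      ← Complex.exp_conj, Complex.conj_ofReal, Complex.conj_I, Complex.conj_conj]
    congr 2; push_cast; ring
  filter_upwards [key] with ξ h
  rw [show hat f ξ = _ from h, Complex.conj_conj]

/-- The convolution theorem. -/
lemma prodHat_eq (f g : L2) (ξ : ℝ) : prodHat f g ξ = ∫ ζ, hat f ζ * hat g (ξ - ζ) := by
  -- Since `f` is real, the Fourier integral of the product is an inner product of `f` with a
  -- modulation of `g`. Plancherel and `hat_neg` then turn it into a convolution.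
  have h1 : prodHat f g ξ = inner ℂ (toC f) (modulate (-ξ) (toC g)) := by
    rw [L2.inner_def, prodHat, Real.fourier_real_eq]
    refine integral_congr_ae ?_
    filter_upwards [toC_ae f, modulate_ae (-ξ) (toC g), toC_ae g] with x h1 h2 h3
    rw [h1, h2, h3, RCLike.inner_apply, Complex.conj_ofReal, Circle.smul_def]
    rw [show -(x * ξ) = -ξ * x by ring]; simp; ring
  rw [h1, ← Lp.inner_fourier_eq, L2.inner_def, ← integral_neg_eq_self]
  refine integral_congr_ae ?_
  have hn : Measure.QuasiMeasurePreserving (fun x : ℝ => -x) volume volume :=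
    (Measure.measurePreserving_neg _).quasiMeasurePreserving
  filter_upwards [hn.ae (fourier_modulate_Lp (-ξ) (toC g)), hat_neg f] with x h2 h3
  rw [h2, RCLike.inner_apply]
  have h4 : (starRingEnd ℂ) ((𝓕 (toC f) : LC) (-x)) = hat f x := by
    rw [← hat_def, h3, Complex.conj_conj]
  rw [h4, ← hat_def, mul_comm]
  congr 2; ring

lemma memLp_translate (f : L2) (h : ℝ) : MemLp (fun x => f (x + h)) 2 volume :=
  (Lp.memLp f).comp_measurePreserving (measurePreserving_add_right volume h)

/-- Translation of a square integrable function. -/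
def translate (h : ℝ) (f : L2) : L2 := (memLp_translate f h).toLp

lemma translate_ae (h : ℝ) (f : L2) : translate h f =ᵐ[volume] fun x => f (x + h) :=
  (memLp_translate f h).coeFn_toLp

lemma hat_translate (h : ℝ) (f : L2) :
    hat (translate h f) =ᵐ[volume] fun ξ => (𝐞 (h * ξ) : ℂ) * hat f ξ := by
  refine fourier_Lp_ae_eq _ _ ((memLp_char_mul (hat f) h).locallyIntegrable (by norm_num))
    fun ψ hψ => ?_
  obtain ⟨φ, -, hφ⟩ := exists_smooth_mul hψ (contDiff_char h)
  have h1 : ∫ x, (𝐞 (h * x) : ℂ) * hat f x * ψ x = ∫ x, hat f x * φ x := by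
    congr 1; ext x; rw [hφ]; ring
  rw [h1, integral_hat_mul, show (φ : ℝ → ℂ) = fun y => (𝐞 (h * y) : ℂ) * ψ y from funext hφ,
    ← integral_sub_right_eq_self (fun x => (f x : ℂ) * _) (-h)]
  simp only [fourier_modulate, sub_neg_eq_add, add_sub_cancel_right]
  refine integral_congr_ae ?_
  filter_upwards [toC_ae (translate h f), translate_ae h f] with x h1 h2
  rw [show (Complex.ofRealCLM.compLp (translate h f) : LC) = toC (translate h f) from rfl, h1, h2]

/-! ### Trilinear convolution forms with a kernel -/

/-- The `L²` norm of a nonnegative function. -/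
def N2 (f : ℝ → ℝ≥0∞) : ℝ≥0∞ := (∫⁻ x, f x ^ 2) ^ (1 / 2 : ℝ)

lemma N2_sq (f : ℝ → ℝ≥0∞) : N2 f ^ 2 = ∫⁻ x, f x ^ 2 := by
  rw [N2, ← ENNReal.rpow_natCast, ← ENNReal.rpow_mul]; norm_num

lemma ENNReal.sq_rpow_half (x : ℝ≥0∞) : (x ^ 2) ^ (1 / 2 : ℝ) = x := by
  rw [← ENNReal.rpow_natCast, ← ENNReal.rpow_mul]; norm_num

lemma ENNReal.rpow_half_sq (x : ℝ≥0∞) : (x ^ (1 / 2 : ℝ)) ^ 2 = x := by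
  rw [← ENNReal.rpow_natCast, ← ENNReal.rpow_mul]; norm_num

lemma N2_mono {f g : ℝ → ℝ≥0∞} (h : ∀ x, f x ≤ g x) : N2 f ≤ N2 g := by
  unfold N2; gcongr; exact h _

lemma N2_const_mul (c : ℝ≥0∞) {f : ℝ → ℝ≥0∞} (hf : Measurable f) :
    N2 (fun x => c * f x) = c * N2 f := by
  unfold N2
  simp_rw [mul_pow]
  rw [lintegral_const_mul _ (hf.pow_const 2), ENNReal.mul_rpow_of_nonneg _ _ (by norm_num),
    ENNReal.sq_rpow_half]

lemma eLpNorm_two (F : ℝ → ℂ) : eLpNorm F 2 volume = N2 (fun ξ => ‖F ξ‖ₑ) := by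
  rw [eLpNorm_eq_lintegral_rpow_enorm_toReal (by norm_num) (by norm_num), N2]
  simp

lemma lintegral_mul_le {α : Type*} [MeasurableSpace α] (μ : Measure α) {f g : α → ℝ≥0∞}
    (hf : AEMeasurable f μ) (hg : AEMeasurable g μ) :
    ∫⁻ a, f a * g a ∂μ ≤ (∫⁻ a, f a ^ 2 ∂μ) ^ (1 / 2 : ℝ) * (∫⁻ a, g a ^ 2 ∂μ) ^ (1 / 2 : ℝ) := by
  have := ENNReal.lintegral_mul_le_Lp_mul_Lq μ Real.HolderConjugate.two_two hf hg
  simpa using this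

lemma lintegral_mul_le_N2 {f g : ℝ → ℝ≥0∞} (hf : Measurable f) (hg : Measurable g) :
    ∫⁻ x, f x * g x ≤ N2 f * N2 g :=
  lintegral_mul_le volume hf.aemeasurable hg.aemeasurable

/-- The trilinear form with kernel `K`. -/
def tri (K : ℝ → ℝ → ℝ≥0∞) (f g h : ℝ → ℝ≥0∞) : ℝ≥0∞ :=
  ∫⁻ ξ, ∫⁻ ζ, K ξ ζ * (f ξ * g ζ * h (ξ - ζ))

lemma tri_mono {K K' : ℝ → ℝ → ℝ≥0∞} {f f' g g' h h' : ℝ → ℝ≥0∞}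
    (H : ∀ ξ ζ, K ξ ζ * (f ξ * g ζ * h (ξ - ζ)) ≤ K' ξ ζ * (f' ξ * g' ζ * h' (ξ - ζ))) :
    tri K f g h ≤ tri K' f' g' h' :=
  lintegral_mono fun ξ => lintegral_mono fun ζ => H ξ ζ

/-- Cauchy-Schwarz in `y` for fixed `x`, then in `x`: of the kernel only the `L²` size of its rows
enters. -/
lemma schur_core {K Φ : ℝ → ℝ → ℝ≥0∞} {f : ℝ → ℝ≥0∞}
    (hK : Measurable fun p : ℝ × ℝ => K p.1 p.2) (hf : Measurable f)
    (hΦ : Measurable fun p : ℝ × ℝ => Φ p.1 p.2) {M : ℝ≥0∞} (hM : ∀ x, ∫⁻ y, K x y ^ 2 ≤ M) :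
    ∫⁻ x, ∫⁻ y, K x y * (f x * Φ x y) ≤
      M ^ (1 / 2 : ℝ) * N2 f * (∫⁻ x, ∫⁻ y, Φ x y ^ 2) ^ (1 / 2 : ℝ) := by
  have hΦx : ∀ x, Measurable (Φ x) := fun x => hΦ.comp measurable_prodMk_left
  have hKx : ∀ x, Measurable (K x) := fun x => hK.comp measurable_prodMk_left
  have hS : Measurable fun x => ∫⁻ y, Φ x y ^ 2 := (hΦ.pow_const 2).lintegral_prod_right'
  calc ∫⁻ x, ∫⁻ y, K x y * (f x * Φ x y)
      ≤ ∫⁻ x, M ^ (1 / 2 : ℝ) * (f x * (∫⁻ y, Φ x y ^ 2) ^ (1 / 2 : ℝ)) := by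
        refine lintegral_mono fun x => ?_
        calc ∫⁻ y, K x y * (f x * Φ x y) = f x * ∫⁻ y, K x y * Φ x y := by
              rw [← lintegral_const_mul (f x) (f := fun y => K x y * Φ x y) ((hKx x).mul (hΦx x))]
              congr 1; ext y; ring
          _ ≤ f x * (M ^ (1 / 2 : ℝ) * (∫⁻ y, Φ x y ^ 2) ^ (1 / 2 : ℝ)) := by
              gcongr
              refine (lintegral_mul_le volume (hKx x).aemeasurable (hΦx x).aemeasurable).trans ?_
              gcongr
              exact hM x
          _ = _ := by ring
    _ = M ^ (1 / 2 : ℝ) * ∫⁻ x, f x * (∫⁻ y, Φ x y ^ 2) ^ (1 / 2 : ℝ) :=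
        lintegral_const_mul _ (hf.mul (hS.pow_const _))
    _ ≤ M ^ (1 / 2 : ℝ) * (N2 f * N2 (fun x => (∫⁻ y, Φ x y ^ 2) ^ (1 / 2 : ℝ))) := by
        gcongr
        exact lintegral_mul_le_N2 hf (hS.pow_const _)
    _ = _ := by
        rw [mul_assoc]; congr 2
        unfold N2
        simp_rw [ENNReal.rpow_half_sq]

lemma lintegral_sq_mul_sub {g h : ℝ → ℝ≥0∞} (hg : Measurable g) (hh : Measurable h) :
    (∫⁻ x, ∫⁻ y, (g y * h (x - y)) ^ 2) ^ (1 / 2 : ℝ) = N2 g * N2 h := by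
  have : ∫⁻ x, ∫⁻ y, (g y * h (x - y)) ^ 2 = (∫⁻ y, g y ^ 2) * ∫⁻ x, h x ^ 2 := by
    rw [lintegral_lintegral_swap (by fun_prop)]
    simp_rw [mul_pow]
    rw [← lintegral_mul_const _ (hg.pow_const 2)]
    congr 1; ext y
    rw [lintegral_const_mul _ (by fun_prop), lintegral_sub_right_eq_self (fun x => h x ^ 2) y]
  rw [this, ENNReal.mul_rpow_of_nonneg _ _ (by norm_num)]; rfl

/-- Here the outer variable of Cauchy-Schwarz is `ξ`. In `tri_le_snd` it is `ζ` and in `tri_le_diff`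
it is `ξ - ζ`. Each time the two remaining functions form a product whose square integral
factorizes, so the choice depends only on the direction in which the kernel is square integrable. -/
lemma tri_le_fst {K : ℝ → ℝ → ℝ≥0∞} {f g h : ℝ → ℝ≥0∞}
    (hK : Measurable fun p : ℝ × ℝ => K p.1 p.2) (hf : Measurable f) (hg : Measurable g)
    (hh : Measurable h) {M : ℝ≥0∞} (hM : ∀ ξ, ∫⁻ ζ, K ξ ζ ^ 2 ≤ M) :
    tri K f g h ≤ M ^ (1 / 2 : ℝ) * (N2 f * N2 g * N2 h) := by
  have := schur_core (Φ := fun x y => g y * h (x - y)) hK hf (by fun_prop) hM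
  rw [lintegral_sq_mul_sub hg hh] at this
  unfold tri
  simp only [mul_assoc] at this ⊢
  exact this

lemma tri_le_snd {K : ℝ → ℝ → ℝ≥0∞} {f g h : ℝ → ℝ≥0∞}
    (hK : Measurable fun p : ℝ × ℝ => K p.1 p.2) (hf : Measurable f) (hg : Measurable g)
    (hh : Measurable h) {M : ℝ≥0∞} (hM : ∀ ζ, ∫⁻ ξ, K ξ ζ ^ 2 ≤ M) :
    tri K f g h ≤ M ^ (1 / 2 : ℝ) * (N2 f * N2 g * N2 h) := by
  have h1 := schur_core (K := fun ζ ξ => K ξ ζ) (Φ := fun ζ ξ => f ξ * h (ξ - ζ))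
    (hK.comp measurable_swap) hg (by fun_prop) hM
  have h2 : (∫⁻ x, ∫⁻ y, (f y * h (y - x)) ^ 2) ^ (1 / 2 : ℝ) = N2 f * N2 h := by
    have := lintegral_sq_mul_sub (h := fun x => h (-x)) hf (by fun_prop)
    have h3 : N2 (fun x => h (-x)) = N2 h := by
      unfold N2
      rw [lintegral_neg_eq_self (μ := volume) (fun x => h x ^ 2)]
    simpa [h3] using this
  rw [h2] at h1
  unfold tri
  rw [lintegral_lintegral_swap (by fun_prop)]
  refine le_of_eq_of_le ?_ (h1.trans_eq ?_)
  · congr 1; ext x; congr 1; ext y; ring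
  · ring

lemma tri_le_diff {K : ℝ → ℝ → ℝ≥0∞} {f g h : ℝ → ℝ≥0∞}
    (hK : Measurable fun p : ℝ × ℝ => K p.1 p.2) (hf : Measurable f) (hg : Measurable g)
    (hh : Measurable h) {M : ℝ≥0∞} (hM : ∀ θ, ∫⁻ ζ, K (ζ + θ) ζ ^ 2 ≤ M) :
    tri K f g h ≤ M ^ (1 / 2 : ℝ) * (N2 f * N2 g * N2 h) := by
  have h1 := schur_core (K := fun θ ζ => K (ζ + θ) ζ) (Φ := fun θ ζ => f (ζ + θ) * g ζ)
    (hK.comp (f := fun p : ℝ × ℝ => (p.2 + p.1, p.2)) (by fun_prop)) hh (by fun_prop) hM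
  have h2 : (∫⁻ x, ∫⁻ y, (f (y + x) * g y) ^ 2) ^ (1 / 2 : ℝ) = N2 f * N2 g := by
    have : ∫⁻ x, ∫⁻ y, (f (y + x) * g y) ^ 2 = (∫⁻ y, f y ^ 2) * ∫⁻ x, g x ^ 2 := by
      rw [lintegral_lintegral_swap (by fun_prop)]
      simp_rw [mul_pow]
      rw [← lintegral_const_mul _ (hg.pow_const 2)]
      congr 1; ext y
      rw [lintegral_mul_const _ (by fun_prop), lintegral_add_left_eq_self (fun x => f x ^ 2) y]
    rw [this, ENNReal.mul_rpow_of_nonneg _ _ (by norm_num)]; rfl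
  rw [h2] at h1
  unfold tri
  rw [lintegral_lintegral_swap (by fun_prop)]
  have h3 : ∀ y, ∫⁻ x, K x y * (f x * g y * h (x - y)) =
      ∫⁻ x, K (y + x) y * (f (y + x) * g y * h x) := fun y => by
    rw [← lintegral_add_left_eq_self _ y]
    simp
  simp_rw [h3]
  rw [lintegral_lintegral_swap]
  swap
  · exact ((hK.comp (f := fun p : ℝ × ℝ => (p.1 + p.2, p.1)) (by fun_prop)).mul
      (by fun_prop)).aemeasurable
  refine le_of_eq_of_le ?_ (h1.trans_eq ?_)
  · congr 1; ext x; congr 1; ext y; ring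
  · ring

/-- The convolution of nonnegative functions. -/
def convE (f g : ℝ → ℝ≥0∞) (ξ : ℝ) : ℝ≥0∞ := ∫⁻ ζ, f ζ * g (ξ - ζ)

lemma measurable_convE {f g : ℝ → ℝ≥0∞} (hf : Measurable f) (hg : Measurable g) :
    Measurable (convE f g) := by
  unfold convE
  exact Measurable.lintegral_prod_right' (f := fun p : ℝ × ℝ => f p.2 * g (p.1 - p.2)) (by fun_prop)

lemma convE_comm (f g : ℝ → ℝ≥0∞) (ξ : ℝ) : convE f g ξ = convE g f ξ := by
  unfold convE
  rw [← lintegral_sub_left_eq_self _ ξ]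
  simp [mul_comm]

/-- An `L²` bound of weighted convolutions. -/
lemma N2_conv_le {K : ℝ → ℝ → ℝ≥0∞} {g h : ℝ → ℝ≥0∞}
    (hK : Measurable fun p : ℝ × ℝ => K p.1 p.2) (hg : Measurable g)
    (hh : Measurable h) {M : ℝ≥0∞} (hM : ∀ ξ, ∫⁻ ζ, K ξ ζ ^ 2 ≤ M) :
    N2 (fun ξ => ∫⁻ ζ, K ξ ζ * (g ζ * h (ξ - ζ))) ≤ M ^ (1 / 2 : ℝ) * (N2 g * N2 h) := by
  have hKx : ∀ x, Measurable (K x) := fun x => hK.comp measurable_prodMk_left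
  rw [← lintegral_sq_mul_sub hg hh, N2, ← ENNReal.mul_rpow_of_nonneg _ _ (by norm_num)]
  gcongr
  rw [← lintegral_const_mul _
    (Measurable.lintegral_prod_right' (f := fun p : ℝ × ℝ => (g p.2 * h (p.1 - p.2)) ^ 2)
      (by fun_prop))]
  refine lintegral_mono fun ξ => ?_
  calc (∫⁻ ζ, K ξ ζ * (g ζ * h (ξ - ζ))) ^ 2
      ≤ ((∫⁻ ζ, K ξ ζ ^ 2) ^ (1 / 2 : ℝ) * (∫⁻ ζ, (g ζ * h (ξ - ζ)) ^ 2) ^ (1 / 2 : ℝ)) ^ 2 := by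
        gcongr
        exact lintegral_mul_le volume (hKx ξ).aemeasurable (by fun_prop)
    _ = (∫⁻ ζ, K ξ ζ ^ 2) * ∫⁻ ζ, (g ζ * h (ξ - ζ)) ^ 2 := by
        rw [mul_pow, ENNReal.rpow_half_sq, ENNReal.rpow_half_sq]
    _ ≤ _ := by gcongr; exact hM ξ

/-! ### Japanese brackets -/

lemma symJ_pos (s κ : ℝ) : 0 < symJ s κ := Real.rpow_pos_of_pos (by positivity) _

lemma symJ_add (r s κ : ℝ) : symJ r κ * symJ s κ = symJ (r + s) κ := by
  unfold symJ
  rw [← Real.rpow_add (by positivity)]; congr 1; ring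

lemma symJ_zero (κ : ℝ) : symJ 0 κ = 1 := by simp [symJ]

lemma symJ_mono {r s : ℝ} (h : r ≤ s) (κ : ℝ) : symJ r κ ≤ symJ s κ :=
  Real.rpow_le_rpow_of_exponent_le (by nlinarith [sq_nonneg κ]) (by linarith)

lemma continuous_symJ (s : ℝ) : Continuous (symJ s) := by
  unfold symJ
  exact Continuous.rpow_const (by fun_prop) fun x => Or.inl (by positivity)

lemma abs_le_symJ_one (κ : ℝ) : |κ| ≤ symJ 1 κ := by
  unfold symJ
  rw [← Real.sqrt_eq_rpow]
  exact Real.abs_le_sqrt (by linarith)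

lemma symJ_mono_abs {s : ℝ} (hs : 0 ≤ s) {x y : ℝ} (h : |x| ≤ |y|) : symJ s x ≤ symJ s y := by
  unfold symJ
  have := sq_le_sq.2 h
  exact Real.rpow_le_rpow (by positivity) (by linarith) (by linarith)

lemma symJ_two_mul {s : ℝ} (hs : 0 ≤ s) (x : ℝ) : symJ s (2 * x) ≤ 2 ^ s * symJ s x := by
  unfold symJ
  have : (2 : ℝ) ^ s = (4 : ℝ) ^ (s / 2) := by
    rw [show (4 : ℝ) = 2 ^ (2 : ℝ) by norm_num, ← Real.rpow_mul (by norm_num)]; congr 1; ring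
  rw [this, ← Real.mul_rpow (by norm_num) (by positivity)]
  exact Real.rpow_le_rpow (by positivity) (by nlinarith) (by linarith)

lemma symJ_add_le {s : ℝ} (hs : 0 ≤ s) (x y : ℝ) :
    symJ s (x + y) ≤ 2 ^ s * (symJ s x + symJ s y) := by
  have h2 : (0 : ℝ) < 2 ^ s := by positivity
  rcases le_total |x| |y| with h | h
  · have h1 : |x + y| ≤ |2 * y| := by
      rw [abs_mul, abs_two]; linarith [abs_add_le x y]
    nlinarith [symJ_mono_abs hs h1, symJ_two_mul hs y, symJ_pos s x]
  · have h1 : |x + y| ≤ |2 * x| := by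
      rw [abs_mul, abs_two]; linarith [abs_add_le x y]
    nlinarith [symJ_mono_abs hs h1, symJ_two_mul hs x, symJ_pos s y]

/-- The weight `⟨2πξ⟩ ^ s` with values in `[0, ∞]`. -/
def jE (s ξ : ℝ) : ℝ≥0∞ := ENNReal.ofReal (symJ s (2 * Real.pi * ξ))

lemma measurable_jE (s : ℝ) : Measurable (jE s) := by
  unfold jE
  exact (ENNReal.continuous_ofReal.comp ((continuous_symJ s).comp (by fun_prop))).measurable

lemma jE_add (r s ξ : ℝ) : jE r ξ * jE s ξ = jE (r + s) ξ := by
  unfold jE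
  rw [← ENNReal.ofReal_mul (symJ_pos _ _).le, symJ_add]

lemma jE_zero (ξ : ℝ) : jE 0 ξ = 1 := by simp [jE, symJ_zero]

lemma jE_mono {r s : ℝ} (h : r ≤ s) (ξ : ℝ) : jE r ξ ≤ jE s ξ :=
  ENNReal.ofReal_le_ofReal (symJ_mono h _)

lemma one_le_jE {s : ℝ} (h : 0 ≤ s) (ξ : ℝ) : 1 ≤ jE s ξ := by
  rw [← jE_zero ξ]; exact jE_mono h ξ

lemma jE_neg_mul (s ξ : ℝ) : jE (-s) ξ * jE s ξ = 1 := by rw [jE_add]; simp [jE_zero]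

lemma jE_pow_two (s ξ : ℝ) : jE s ξ ^ 2 = jE (2 * s) ξ := by
  rw [sq, jE_add]; congr 1; ring

lemma jE_neg_arg (s ξ : ℝ) : jE s (-ξ) = jE s ξ := by simp [jE, symJ]

lemma jE_le_add {s : ℝ} (hs : 0 ≤ s) (ξ ζ : ℝ) :
    jE s ξ ≤ ENNReal.ofReal (2 ^ s) * (jE s ζ + jE s (ξ - ζ)) := by
  unfold jE
  rw [← ENNReal.ofReal_add (symJ_pos _ _).le (symJ_pos _ _).le, ← ENNReal.ofReal_mul (by positivity)]
  refine ENNReal.ofReal_le_ofReal ?_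
  have := symJ_add_le hs (2 * Real.pi * ζ) (2 * Real.pi * (ξ - ζ))
  rwa [← mul_add, add_sub_cancel] at this

/-- The constant `∫ ⟨2πξ⟩^{-3/2} dξ`. -/
def c32 : ℝ≥0∞ := ∫⁻ ξ, jE (-(3 / 2)) ξ

lemma lintegral_jE_lt_top {r : ℝ} (hr : 1 < r) : ∫⁻ ξ, jE (-r) ξ < ∞ := by
  have h := integrable_rpow_neg_one_add_norm_sq (E := ℝ) (μ := volume) (r := r) (by simpa using hr)
  have h2 := h.comp_mul_left' (R := 2 * Real.pi) (by positivity)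
  have := h2.lintegral_lt_top
  convert this using 3 with ξ
  simp only [jE, symJ, Real.norm_eq_abs, sq_abs]

lemma c32_lt_top : c32 < ∞ := lintegral_jE_lt_top (by norm_num)

lemma mul_sq_le_cube_add (x y : ℝ≥0∞) : x * y ^ 2 ≤ x ^ 3 + y ^ 3 := by
  rcases le_total x y with h | h
  · calc x * y ^ 2 ≤ y * y ^ 2 := by gcongr
      _ = y ^ 3 := by ring
      _ ≤ _ := le_add_self
  · calc x * y ^ 2 ≤ x * x ^ 2 := by gcongr
      _ = x ^ 3 := by ring
      _ ≤ _ := le_self_add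

/-- The inequality `x y² ≤ x³ + y³` with `x, y` brackets to the power `-1/2` separates the two
points and leaves the integrable power `-3/2`. -/
lemma jE_mul_le (x y : ℝ) :
    jE (-(1 / 2)) x * jE (-1) y ≤ jE (-(3 / 2)) x + jE (-(3 / 2)) y := by
  have h1 : ∀ z, jE (-(1 / 2)) z ^ 3 = jE (-(3 / 2)) z := fun z => by
    rw [pow_succ, jE_pow_two, jE_add]; norm_num
  have h2 : jE (-(1 / 2)) y ^ 2 = jE (-1) y := by rw [jE_pow_two]; norm_num
  have := mul_sq_le_cube_add (jE (-(1 / 2)) x) (jE (-(1 / 2)) y)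
  rwa [h1, h1, h2] at this

lemma lintegral_jE_sub (r ξ : ℝ) : ∫⁻ ζ, jE r (ξ - ζ) = ∫⁻ ζ, jE r ζ :=
  lintegral_sub_left_eq_self (fun ζ => jE r ζ) ξ

lemma lintegral_jE_mul_le (ξ : ℝ) :
    ∫⁻ ζ, jE (-(1 / 2)) ζ * jE (-1) (ξ - ζ) ≤ 2 * c32 := by
  refine (lintegral_mono fun ζ => jE_mul_le _ _).trans ?_
  rw [lintegral_add_left (measurable_jE _), lintegral_jE_sub, two_mul]; rfl

lemma lintegral_jE_mul_le' (ξ : ℝ) :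
    ∫⁻ ζ, jE (-1) ζ * jE (-(1 / 2)) (ξ - ζ) ≤ 2 * c32 := by
  rw [← lintegral_sub_left_eq_self _ ξ]
  simpa [mul_comm] using lintegral_jE_mul_le ξ

/-! ### The symbol of `K` -/

lemma abs_le_abs_sinh (x : ℝ) : |x| ≤ |Real.sinh x| := by
  rcases le_total 0 x with h | h
  · rw [abs_of_nonneg h, abs_of_nonneg (Real.sinh_nonneg_iff.2 h)]
    exact Real.self_le_sinh_iff.2 h
  · rw [abs_of_nonpos h, abs_of_nonpos (Real.sinh_nonpos_iff.2 h)]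
    exact neg_le_neg (Real.sinh_le_self_iff.2 h)

lemma abs_tanh_le_one (x : ℝ) : |Real.tanh x| ≤ 1 := by
  rw [Real.tanh_eq_sinh_div_cosh, abs_div, abs_of_pos (Real.cosh_pos x),
    div_le_one (Real.cosh_pos x)]
  exact abs_le_of_sq_le_sq (by nlinarith [Real.cosh_sq x]) (Real.cosh_pos x).le

lemma tanh_div_pos {κ : ℝ} (h : κ ≠ 0) : 0 < Real.tanh κ / κ := by
  rw [Real.tanh_eq_sinh_div_cosh, div_right_comm]
  refine div_pos ?_ (Real.cosh_pos κ)
  rcases lt_or_gt_of_ne h with h | h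
  · exact div_pos_of_neg_of_neg (Real.sinh_neg_iff.2 h) h
  · exact div_pos (Real.sinh_pos_iff.2 h) h

lemma symK_pos (κ : ℝ) : 0 < symK κ := by
  unfold symK
  split_ifs with h
  · exact one_pos
  · exact Real.sqrt_pos.2 (tanh_div_pos h)

lemma symK_sq_mul (κ : ℝ) : symK κ ^ 2 * κ = Real.tanh κ := by
  unfold symK
  split_ifs with h
  · simp [h]
  · rw [Real.sq_sqrt (tanh_div_pos h).le, div_mul_cancel₀ _ h]

lemma symK_inv_sq_mul (κ : ℝ) : (symK κ)⁻¹ ^ 2 * Real.tanh κ = κ := by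
  rw [← symK_sq_mul]
  have := (symK_pos κ).ne'
  field_simp

/-- After multiplication by `cosh²` this is `κ² ≤ sinh² κ`. It carries the upper half of the
comparison of `K⁻¹` with `⟨κ⟩^{1/2}`. -/
lemma tanh_sq_le (κ : ℝ) : κ ^ 2 ≤ (1 + κ ^ 2) * Real.tanh κ ^ 2 := by
  rw [Real.tanh_eq_sinh_div_cosh, div_pow, ← mul_div_assoc, le_div_iff₀ (by positivity),
    Real.cosh_sq]
  nlinarith [sq_le_sq.2 (abs_le_abs_sinh κ)]

lemma symK_inv_pos (κ : ℝ) : 0 < (symK κ)⁻¹ := inv_pos.2 (symK_pos κ)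

lemma symJ_one_sq (κ : ℝ) : symJ 1 κ ^ 2 = 1 + κ ^ 2 := by
  rw [sq, symJ_add]; norm_num [symJ]

lemma symK_inv_sq_le (κ : ℝ) : (symK κ)⁻¹ ^ 2 ≤ symJ 1 κ := by
  rcases eq_or_ne κ 0 with rfl | h
  · simp [symK, symJ]
  have ht : 0 < Real.tanh κ ^ 2 := by
    have := tanh_div_pos h
    have h0 : Real.tanh κ ≠ 0 := by
      rintro h0; simp [h0] at this
    positivity
  have h1 := symK_inv_sq_mul κ
  refine abs_le_of_sq_le_sq' ?_ (symJ_pos 1 κ).le |>.2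
  rw [symJ_one_sq]
  have h2 : ((symK κ)⁻¹ ^ 2) ^ 2 * Real.tanh κ ^ 2 ≤ (1 + κ ^ 2) * Real.tanh κ ^ 2 := by
    rw [← mul_pow, h1]; exact tanh_sq_le κ
  exact le_of_mul_le_mul_right h2 ht

lemma abs_le_symK_inv_sq (κ : ℝ) : |κ| ≤ (symK κ)⁻¹ ^ 2 := by
  have h1 := symK_inv_sq_mul κ
  calc |κ| = (symK κ)⁻¹ ^ 2 * |Real.tanh κ| := by
        nth_rewrite 1 [← h1]; rw [abs_mul, abs_of_nonneg (by positivity)]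
    _ ≤ (symK κ)⁻¹ ^ 2 * 1 := by gcongr; exact abs_tanh_le_one κ
    _ = _ := mul_one _

lemma abs_tanh_le (κ : ℝ) : |Real.tanh κ| ≤ |κ| := by
  have hd : ∀ x : ℝ, 0 ≤ x → Real.sinh x ≤ x * Real.cosh x := by
    have hmono : MonotoneOn (fun x => x * Real.cosh x - Real.sinh x) (Set.Ici 0) := by
      refine monotoneOn_of_deriv_nonneg (convex_Ici 0) (by fun_prop) (by fun_prop) ?_
      intro x hx
      rw [interior_Ici] at hx
      have : HasDerivAt (fun x => x * Real.cosh x - Real.sinh x)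
          (1 * Real.cosh x + x * Real.sinh x - Real.cosh x) x :=
        ((hasDerivAt_id x).mul (Real.hasDerivAt_cosh x)).sub (Real.hasDerivAt_sinh x)
      rw [this.deriv]
      have := mul_nonneg (le_of_lt hx) (Real.sinh_nonneg_iff.2 (le_of_lt hx))
      linarith
    intro x hx
    have := hmono (Set.self_mem_Ici) hx hx
    simpa using this
  rw [Real.tanh_eq_sinh_div_cosh, abs_div, abs_of_pos (Real.cosh_pos κ), div_le_iff₀ (Real.cosh_pos κ)]
  rcases le_total 0 κ with h | h
  · rw [abs_of_nonneg h, abs_of_nonneg (Real.sinh_nonneg_iff.2 h)]; exact hd κ h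
  · have := hd (-κ) (by linarith)
    rw [Real.sinh_neg, Real.cosh_neg] at this
    rw [abs_of_nonpos h, abs_of_nonpos (Real.sinh_nonpos_iff.2 h)]; linarith

lemma one_le_symK_inv (κ : ℝ) : 1 ≤ (symK κ)⁻¹ := by
  rw [one_le_inv₀ (symK_pos κ)]
  rcases eq_or_ne κ 0 with rfl | h
  · simp [symK]
  · have h1 := symK_sq_mul κ
    have h2 := abs_tanh_le κ
    rw [← h1, abs_mul, abs_of_nonneg (by positivity)] at h2
    have h3 : symK κ ^ 2 ≤ 1 := by
      by_contra! hc
      nlinarith [abs_pos.2 h]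
    nlinarith [symK_pos κ]

/-- The bounds `1 ≤ K⁻²` and `|κ| ≤ K⁻²` are added in squares, hence `√2`. The value is kept because
`normL2H_sq_le` needs a constant this good. -/
lemma symJ_one_le (κ : ℝ) : symJ 1 κ ≤ Real.sqrt 2 * (symK κ)⁻¹ ^ 2 := by
  have h1 := abs_le_symK_inv_sq κ
  have h2 : 1 ≤ (symK κ)⁻¹ ^ 2 := one_le_pow₀ (one_le_symK_inv κ)
  refine abs_le_of_sq_le_sq' ?_ (by positivity) |>.2
  rw [symJ_one_sq, mul_pow, Real.sq_sqrt (by norm_num)]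
  have h3 : κ ^ 2 ≤ ((symK κ)⁻¹ ^ 2) ^ 2 := by
    rw [← sq_abs κ]; gcongr
  nlinarith

lemma symJ_half_sq (κ : ℝ) : symJ (1 / 2) κ ^ 2 = symJ 1 κ := by
  rw [sq, symJ_add]; norm_num

lemma symK_inv_le (κ : ℝ) : (symK κ)⁻¹ ≤ symJ (1 / 2) κ := by
  refine abs_le_of_sq_le_sq' ?_ (symJ_pos _ κ).le |>.2
  rw [symJ_half_sq]; exact symK_inv_sq_le κ

lemma symJ_half_le (κ : ℝ) : symJ (1 / 2) κ ≤ 2 * (symK κ)⁻¹ := by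
  have := symK_inv_pos κ
  refine abs_le_of_sq_le_sq' ?_ (by positivity) |>.2
  rw [symJ_half_sq, mul_pow]
  refine (symJ_one_le κ).trans ?_
  gcongr
  rw [Real.sqrt_le_left (by norm_num)]; norm_num

lemma measurable_symK : Measurable symK := by
  unfold symK
  refine Measurable.ite (measurableSet_singleton 0) measurable_const ?_
  refine Real.continuous_sqrt.measurable.comp ?_
  have : Measurable Real.tanh := by
    simp_rw [funext Real.tanh_eq_sinh_div_cosh]
    exact Real.measurable_sinh.div Real.measurable_cosh
  exact this.div measurable_id

/-- The symbol of `J ^ s * K⁻¹`. -/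
def symX (s κ : ℝ) : ℝ := symJ s κ * (symK κ)⁻¹

lemma symX_pos (s κ : ℝ) : 0 < symX s κ := mul_pos (symJ_pos _ _) (symK_inv_pos _)

lemma symX_le (s κ : ℝ) : symX s κ ≤ symJ (s + 1 / 2) κ := by
  rw [← symJ_add]; exact mul_le_mul_of_nonneg_left (symK_inv_le κ) (symJ_pos _ _).le

lemma symJ_le_symX (s κ : ℝ) : symJ (s + 1 / 2) κ ≤ 2 * symX s κ := by
  rw [← symJ_add, symX, mul_left_comm]
  exact mul_le_mul_of_nonneg_left (symJ_half_le κ) (symJ_pos _ _).le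

lemma measurable_symX (s : ℝ) : Measurable (symX s) :=
  (continuous_symJ s).measurable.mul measurable_symK.inv

lemma normX_def (s : ℝ) (f g : L2) :
    normX s f g = Real.sqrt (multNorm (symJ s) f ^ 2 + multNorm (symX s) g ^ 2) := rfl

/-! ### Multiplier norms -/

lemma aestronglyMeasurable_multHat {m : ℝ → ℝ} (hm : Measurable m) (f : L2) :
    AEStronglyMeasurable (multHat m f) volume := by
  unfold multHat
  refine AEStronglyMeasurable.mul ?_ (Lp.aestronglyMeasurable _)
  exact (Complex.measurable_ofReal.comp (hm.comp (by fun_prop))).aestronglyMeasurable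

lemma enorm_multHat {m : ℝ → ℝ} (hm : ∀ κ, 0 ≤ m κ) (f : L2) (ξ : ℝ) :
    ‖multHat m f ξ‖ₑ = ENNReal.ofReal (m (2 * Real.pi * ξ)) * ‖hat f ξ‖ₑ := by
  rw [multHat, enorm_mul]
  congr 1
  rw [← ofReal_norm, Complex.norm_real, Real.norm_of_nonneg (hm _)]

lemma MemLp.ofReal_multNorm {m : ℝ → ℝ} {f : L2} (h : MemLp (multHat m f) 2 volume) :
    ENNReal.ofReal (multNorm m f) = eLpNorm (multHat m f) 2 volume :=
  ENNReal.ofReal_toReal h.eLpNorm_ne_top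

lemma multNorm_nonneg (m : ℝ → ℝ) (f : L2) : 0 ≤ multNorm m f := ENNReal.toReal_nonneg

lemma multHat_sub_ae (m : ℝ → ℝ) (f g : L2) :
    multHat m (f - g) =ᵐ[volume] multHat m f - multHat m g := by
  filter_upwards [Lp.coeFn_sub (hat f) (hat g)] with ξ h
  simp only [multHat, Pi.sub_apply]
  rw [hat_sub, h, Pi.sub_apply]; ring

lemma abs_multNorm_sub_le {m : ℝ → ℝ} {f g : L2} (hf : MemLp (multHat m f) 2 volume)
    (hg : MemLp (multHat m g) 2 volume) :
    |multNorm m f - multNorm m g| ≤ multNorm m (f - g) := by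
  have h : multNorm m (f - g) = ‖hf.toLp - hg.toLp‖ := by
    rw [← MemLp.toLp_sub, Lp.norm_toLp, multNorm, eLpNorm_congr_ae (multHat_sub_ae m f g)]
  rw [h]
  have h1 : multNorm m f = ‖hf.toLp‖ := by rw [Lp.norm_toLp, multNorm]
  have h2 : multNorm m g = ‖hg.toLp‖ := by rw [Lp.norm_toLp, multNorm]
  rw [h1, h2]
  exact abs_norm_sub_norm_le _ _

lemma memLp_multHat_sub {m : ℝ → ℝ} {f g : L2} (hf : MemLp (multHat m f) 2 volume)
    (hg : MemLp (multHat m g) 2 volume) : MemLp (multHat m (f - g)) 2 volume :=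
  (memLp_congr_ae (multHat_sub_ae m f g)).2 (hf.sub hg)

lemma memLp_multHat_of_le {m m' : ℝ → ℝ} (hm' : Measurable m') {C : ℝ}
    (h : ∀ κ, |m' κ| ≤ C * |m κ|) {f : L2} (hf : MemLp (multHat m f) 2 volume) :
    MemLp (multHat m' f) 2 volume := by
  refine hf.of_le_mul (c := C) (aestronglyMeasurable_multHat hm' f)
    (Eventually.of_forall fun ξ => ?_)
  simp only [multHat, norm_mul, Complex.norm_real, Real.norm_eq_abs]
  rw [← mul_assoc]
  exact mul_le_mul_of_nonneg_right (h _) (norm_nonneg _)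

lemma multNorm_le_of_le {m m' : ℝ → ℝ} {C : ℝ} (hC : 0 ≤ C)
    (h : ∀ κ, |m' κ| ≤ C * |m κ|) {f : L2} (hf : MemLp (multHat m f) 2 volume) :
    multNorm m' f ≤ C * multNorm m f := by
  have h1 : eLpNorm (multHat m' f) 2 volume ≤ ENNReal.ofReal C * eLpNorm (multHat m f) 2 volume := by
    refine eLpNorm_le_mul_eLpNorm_of_ae_le_mul (Eventually.of_forall fun ξ => ?_) 2
    simp only [multHat, norm_mul, Complex.norm_real, Real.norm_eq_abs]
    rw [← mul_assoc]
    exact mul_le_mul_of_nonneg_right (h _) (norm_nonneg _)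
  have h2 := ENNReal.toReal_mono (ENNReal.mul_ne_top ENNReal.ofReal_ne_top hf.eLpNorm_ne_top) h1
  rwa [ENNReal.toReal_mul, ENNReal.toReal_ofReal hC] at h2

lemma abs_symJ (s κ : ℝ) : |symJ s κ| = symJ s κ := abs_of_pos (symJ_pos _ _)

lemma abs_symX (s κ : ℝ) : |symX s κ| = symX s κ := abs_of_pos (symX_pos _ _)

lemma MemH.mono {r s : ℝ} (h : r ≤ s) {f : L2} (hf : MemH s f) : MemH r f :=
  memLp_multHat_of_le (C := 1) (continuous_symJ r).measurable
    (fun κ => by rw [abs_symJ, abs_symJ, one_mul]; exact symJ_mono h κ) hf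

lemma normH_mono {r s : ℝ} (h : r ≤ s) {f : L2} (hf : MemH s f) : normH r f ≤ normH s f := by
  have := multNorm_le_of_le (m := symJ s) (m' := symJ r) zero_le_one
    (fun κ => by rw [abs_symJ, abs_symJ, one_mul]; exact symJ_mono h κ) hf
  rwa [one_mul] at this

lemma multHat_symJ_zero (f : L2) : multHat (symJ 0) f = hat f := by
  ext ξ; simp [multHat, symJ_zero]

lemma memH_zero (f : L2) : MemH 0 f := by
  rw [MemH, multHat_symJ_zero]; exact Lp.memLp _

lemma normH_zero (f : L2) : normH 0 f = ‖f‖ := by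
  rw [normH, multNorm, multHat_symJ_zero, ← norm_hat, Lp.norm_def]

lemma MemH.symX {s : ℝ} {f : L2} (hf : MemH (s + 1 / 2) f) :
    MemLp (multHat (symX s) f) 2 volume :=
  memLp_multHat_of_le (C := 1) (measurable_symX s)
    (fun κ => by rw [abs_symJ, abs_symX, one_mul]; exact symX_le s κ) hf

lemma MemH.sub {s : ℝ} {f g : L2} (hf : MemH s f) (hg : MemH s g) : MemH s (f - g) :=
  memLp_multHat_sub hf hg

lemma normH_nonneg (s : ℝ) (f : L2) : 0 ≤ normH s f := multNorm_nonneg _ _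

lemma normX_nonneg (s : ℝ) (f g : L2) : 0 ≤ normX s f g := Real.sqrt_nonneg _

lemma normX_sq (s : ℝ) (f g : L2) :
    normX s f g ^ 2 = multNorm (symJ s) f ^ 2 + multNorm (symX s) g ^ 2 :=
  Real.sq_sqrt (by positivity)

lemma normH_le_normX (s : ℝ) (f g : L2) : normH s f ≤ normX s f g := by
  rw [normX_def]
  exact Real.le_sqrt_of_sq_le (by rw [normH]; nlinarith [sq_nonneg (multNorm (symX s) g)])

lemma multNorm_symX_le_normX (s : ℝ) (f g : L2) : multNorm (symX s) g ≤ normX s f g := by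
  rw [normX_def]
  exact Real.le_sqrt_of_sq_le (by nlinarith [sq_nonneg (multNorm (symJ s) f)])

lemma normH_half_le_normX {s : ℝ} {g : L2} (hg : MemH (s + 1 / 2) g) (f : L2) :
    normH (s + 1 / 2) g ≤ 2 * normX s f g := by
  have h1 := multNorm_le_of_le (m := symX s) (m' := symJ (s + 1 / 2)) zero_le_two
    (fun κ => by rw [abs_symJ, abs_symX]; exact symJ_le_symX s κ) hg.symX
  have h2 := multNorm_symX_le_normX s f g
  unfold normH
  linarith

lemma sqrt_add_sq_le (a b c d : ℝ) :
    Real.sqrt ((a + b) ^ 2 + (c + d) ^ 2) ≤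
      Real.sqrt (a ^ 2 + c ^ 2) + Real.sqrt (b ^ 2 + d ^ 2) := by
  have h := norm_add_le (⟨a, c⟩ : ℂ) ⟨b, d⟩
  have hn : ∀ x y : ℝ, ‖(⟨x, y⟩ : ℂ)‖ = Real.sqrt (x ^ 2 + y ^ 2) := fun x y => by
    rw [Complex.norm_eq_sqrt_sq_add_sq]
  have ha : (⟨a, c⟩ + ⟨b, d⟩ : ℂ) = ⟨a + b, c + d⟩ := rfl
  rwa [ha, hn, hn, hn] at h

lemma normX_le_add {s : ℝ} {f g f' g' : L2} (hf : MemH s f) (hg : MemH (s + 1 / 2) g)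
    (hf' : MemH s f') (hg' : MemH (s + 1 / 2) g') :
    normX s f g ≤ normX s f' g' + normX s (f - f') (g - g') := by
  have h1 := (abs_le.1 (abs_multNorm_sub_le hf hf')).2
  have h2 := (abs_le.1 (abs_multNorm_sub_le hg.symX hg'.symX)).2
  rw [normX_def, normX_def, normX_def]
  refine le_trans (Real.sqrt_le_sqrt ?_) (sqrt_add_sq_le _ _ _ _)
  have := multNorm_nonneg (symJ s) f
  have := multNorm_nonneg (symX s) g
  gcongr <;> linarith

lemma multNorm_sub_comm (m : ℝ → ℝ) (f g : L2) : multNorm m (f - g) = multNorm m (g - f) := by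
  unfold multNorm
  rw [eLpNorm_congr_ae (multHat_sub_ae m f g), eLpNorm_congr_ae (multHat_sub_ae m g f),
    eLpNorm_sub_comm]

lemma normX_sub_comm (s : ℝ) (f g f' g' : L2) :
    normX s (f - f') (g - g') = normX s (f' - f) (g' - g) := by
  rw [normX_def, normX_def, multNorm_sub_comm, multNorm_sub_comm (symX s)]

/-! ### Continuity in time of the norms of a solution -/

variable {s : ℝ} {I : Set ℝ} {η v : ℝ → L2}

lemma continuousOn_of_abs_sub_le {F : ℝ → ℝ} {C : ℝ} (hu : IsSolution s I η v)
    (h : ∀ t ∈ I, ∀ r ∈ I, |F t - F r| ≤ C * normX s (η t - η r) (v t - v r)) :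
    ContinuousOn F I := by
  intro r hr
  rw [ContinuousWithinAt, tendsto_iff_dist_tendsto_zero]
  have h0 := (hu.continuous r hr).const_mul C
  rw [mul_zero] at h0
  refine squeeze_zero' (Eventually.of_forall fun _ => dist_nonneg) ?_ h0
  filter_upwards [self_mem_nhdsWithin] with t ht
  rw [Real.dist_eq]; exact h t ht r hr

lemma IsSolution.continuousOn_normX (hu : IsSolution s I η v) :
    ContinuousOn (fun t => normX s (η t) (v t)) I := by
  refine continuousOn_of_abs_sub_le (C := 1) hu fun t ht r hr => ?_
  rw [one_mul, abs_le]
  have h1 := normX_le_add (hu.mem_eta t ht) (hu.mem_v t ht) (hu.mem_eta r hr) (hu.mem_v r hr)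
  have h2 := normX_le_add (hu.mem_eta r hr) (hu.mem_v r hr) (hu.mem_eta t ht) (hu.mem_v t ht)
  rw [normX_sub_comm] at h2
  constructor <;> linarith

lemma IsSolution.continuousOn_normH_v (hu : IsSolution s I η v) {r : ℝ} (hr : r ≤ s + 1 / 2) :
    ContinuousOn (fun t => normH r (v t)) I := by
  refine continuousOn_of_abs_sub_le (C := 2) hu fun t ht τ hτ => ?_
  refine (abs_multNorm_sub_le ((hu.mem_v t ht).mono hr) ((hu.mem_v τ hτ).mono hr)).trans ?_
  have h := (hu.mem_v t ht).sub (hu.mem_v τ hτ)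
  exact (normH_mono hr h).trans (normH_half_le_normX h _)

lemma continuousOn_of_norm_sub_le {E : Type*} [NormedAddCommGroup E] {F : ℝ → E} {C : ℝ}
    (hu : IsSolution s I η v)
    (h : ∀ t ∈ I, ∀ r ∈ I, ‖F t - F r‖ ≤ C * normX s (η t - η r) (v t - v r)) :
    ContinuousOn F I := by
  intro r hr
  rw [ContinuousWithinAt, tendsto_iff_dist_tendsto_zero]
  have h0 := (hu.continuous r hr).const_mul C
  rw [mul_zero] at h0
  refine squeeze_zero' (Eventually.of_forall fun _ => dist_nonneg) ?_ h0
  filter_upwards [self_mem_nhdsWithin] with t ht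
  rw [dist_eq_norm]; exact h t ht r hr

lemma IsSolution.continuousOn_eta (hs : 0 ≤ s) (hu : IsSolution s I η v) : ContinuousOn η I := by
  refine continuousOn_of_norm_sub_le (C := 1) hu fun t ht r hr => ?_
  rw [← normH_zero, one_mul]
  exact (normH_mono hs ((hu.mem_eta t ht).sub (hu.mem_eta r hr))).trans (normH_le_normX _ _ _)

lemma IsSolution.continuousOn_v (hs : 0 ≤ s) (hu : IsSolution s I η v) : ContinuousOn v I := by
  refine continuousOn_of_norm_sub_le (C := 2) hu fun t ht r hr => ?_
  rw [← normH_zero]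
  have h := (hu.mem_v t ht).sub (hu.mem_v r hr)
  exact (normH_mono (by linarith) h).trans (normH_half_le_normX h _)

/-- A solution of class `X ^ s` is a solution of class `X ^ r` for `r ≤ s`. -/
lemma IsSolution.mono {r : ℝ} (hr : r ≤ s) (hu : IsSolution s I η v) : IsSolution r I η v where
  mem_eta t ht := (hu.mem_eta t ht).mono hr
  mem_v t ht := (hu.mem_v t ht).mono (by linarith)
  continuous t ht := by
    refine squeeze_zero' (Eventually.of_forall fun _ => normX_nonneg _ _ _) ?_ (hu.continuous t ht)
    filter_upwards [self_mem_nhdsWithin] with τ hτ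
    have h1 := normH_mono hr ((hu.mem_eta τ hτ).sub (hu.mem_eta t ht))
    have h2 := multNorm_le_of_le (m := symX s) (m' := symX r) zero_le_one
      (fun κ => by
        rw [abs_symX, abs_symX, one_mul]
        exact mul_le_mul_of_nonneg_right (symJ_mono hr κ) (symK_inv_pos κ).le)
      ((hu.mem_v τ hτ).sub (hu.mem_v t ht)).symX
    rw [one_mul] at h2
    rw [normX_def, normX_def]
    have := multNorm_nonneg (symX r) (v τ - v t)
    have := normH_nonneg r (η τ - η t)
    unfold normH at *
    gcongr
  eq_eta := hu.eq_eta
  eq_v := hu.eq_v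

/-! ### Bounded multipliers of compact support -/

/-- Bounded measurable symbols that vanish outside of a bounded set. -/
structure Adm (m : ℝ → ℂ) : Prop where
  meas : Measurable m
  bdd : ∃ C : ℝ, ∀ ξ, ‖m ξ‖ ≤ C
  supp : ∃ N : ℝ, ∀ ξ, N < |ξ| → m ξ = 0

/-- Compact support turns any continuous factor into a bounded one, in particular the unbounded
symbol of `∂ₓ`. -/
lemma Adm.mul_continuous {m p : ℝ → ℂ} (hm : Adm m) (hp : Continuous p) :
    Adm fun ξ => m ξ * p ξ := by
  obtain ⟨C, hC⟩ := hm.bdd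
  obtain ⟨N, hN⟩ := hm.supp
  obtain ⟨B, hB⟩ := (isCompact_Icc (a := -N) (b := N)).exists_bound_of_continuousOn hp.continuousOn
  refine ⟨hm.meas.mul hp.measurable, ⟨C * |B|, fun ξ => ?_⟩, N, fun ξ h => by rw [hN ξ h, zero_mul]⟩
  have hC0 : 0 ≤ C := (norm_nonneg _).trans (hC 0)
  rcases lt_or_ge N |ξ| with h | h
  · rw [hN ξ h]; simp; positivity
  · rw [norm_mul]
    exact mul_le_mul (hC ξ) ((hB ξ (abs_le.1 h)).trans (le_abs_self B)) (norm_nonneg _) hC0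

lemma Adm.memLp {m : ℝ → ℂ} (hm : Adm m) : MemLp m 2 volume := by
  obtain ⟨C, hC⟩ := hm.bdd
  obtain ⟨N, hN⟩ := hm.supp
  have h1 : MemLp ((Set.Icc (-N) N).indicator fun _ => C) 2 volume :=
    memLp_indicator_const 2 measurableSet_Icc C (Or.inr (by simp))
  refine h1.of_le hm.meas.aestronglyMeasurable (Eventually.of_forall fun ξ => ?_)
  rcases lt_or_ge N |ξ| with h | h
  · rw [hN ξ h]; simp
  · rw [Set.indicator_of_mem (show ξ ∈ Set.Icc (-N) N from abs_le.1 h)]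
    exact (hC ξ).trans (le_abs_self C)

lemma Adm.memLp_mul {m : ℝ → ℂ} (hm : Adm m) {F : ℝ → ℂ} (hF : MemLp F 2 volume) :
    MemLp (fun ξ => m ξ * F ξ) 2 volume := by
  obtain ⟨C, hC⟩ := hm.bdd
  refine hF.of_le_mul (c := C) (hm.meas.aestronglyMeasurable.mul hF.1)
    (Eventually.of_forall fun ξ => ?_)
  rw [norm_mul]; exact mul_le_mul_of_nonneg_right (hC ξ) (norm_nonneg _)

open Classical in
/-- Multiplication by an admissible symbol. -/
def mulOp (m : ℝ → ℂ) : LC →L[ℝ] LC :=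
  if hm : Adm m then
    LinearMap.mkContinuous
      { toFun := fun F => (hm.memLp_mul (Lp.memLp F)).toLp
        map_add' := fun F G => by
          rw [← MemLp.toLp_add, MemLp.toLp_eq_toLp_iff]
          filter_upwards [Lp.coeFn_add F G] with x hx
          rw [hx]; simp [mul_add]
        map_smul' := fun c F => by
          rw [RingHom.id_apply, ← MemLp.toLp_const_smul, MemLp.toLp_eq_toLp_iff]
          filter_upwards [Lp.coeFn_smul c F] with x hx
          rw [hx]; simp; ring }
      hm.bdd.choose (fun F => by
        refine Lp.norm_le_mul_norm_of_ae_le_mul ?_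
        filter_upwards [(hm.memLp_mul (Lp.memLp F)).coeFn_toLp] with x hx
        rw [LinearMap.coe_mk, AddHom.coe_mk, hx, norm_mul]
        exact mul_le_mul_of_nonneg_right (hm.bdd.choose_spec x) (norm_nonneg _))
  else 0

lemma mulOp_ae {m : ℝ → ℂ} (hm : Adm m) (F : LC) : mulOp m F =ᵐ[volume] fun ξ => m ξ * F ξ := by
  rw [mulOp, dif_pos hm]
  exact (hm.memLp_mul (Lp.memLp F)).coeFn_toLp

/-- Convolution of functions on the line. -/
def conv (F G : ℝ → ℂ) (ξ : ℝ) : ℂ := ∫ ζ, F ζ * G (ξ - ζ)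

lemma conv_congr {F F' G G' : ℝ → ℂ} (hF : F =ᵐ[volume] F') (hG : G =ᵐ[volume] G') (ξ : ℝ) :
    conv F G ξ = conv F' G' ξ := by
  refine integral_congr_ae ?_
  have : Measure.QuasiMeasurePreserving (fun ζ : ℝ => ξ - ζ) volume volume :=
    (Measure.measurePreserving_sub_left volume ξ).quasiMeasurePreserving
  filter_upwards [hF, this.ae hG] with x h1 h2
  rw [h1, h2]

lemma integrable_conv' {F G : ℝ → ℂ} (hF : MemLp F 2 volume) (hG : MemLp G 2 volume) (ξ : ℝ) :
    Integrable (fun ζ => F ζ * G (ξ - ζ)) :=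
  hF.integrable_mul (hG.comp_measurePreserving (Measure.measurePreserving_sub_left volume ξ))

lemma conv_add_left {F F' G : ℝ → ℂ} (hF : MemLp F 2 volume) (hF' : MemLp F' 2 volume)
    (hG : MemLp G 2 volume) (ξ : ℝ) :
    conv (fun ζ => F ζ + F' ζ) G ξ = conv F G ξ + conv F' G ξ := by
  unfold conv
  rw [← integral_add (integrable_conv' hF hG ξ) (integrable_conv' hF' hG ξ)]
  simp [add_mul]

lemma conv_comm (F G : ℝ → ℂ) (ξ : ℝ) : conv F G ξ = conv G F ξ := by
  unfold conv
  rw [← integral_sub_left_eq_self _ volume ξ]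
  simp [mul_comm]

lemma conv_add_right {F G G' : ℝ → ℂ} (hF : MemLp F 2 volume) (hG : MemLp G 2 volume)
    (hG' : MemLp G' 2 volume) (ξ : ℝ) :
    conv F (fun ζ => G ζ + G' ζ) ξ = conv F G ξ + conv F G' ξ := by
  rw [conv_comm, conv_add_left hG hG' hF, conv_comm G, conv_comm G']

lemma enorm_conv_le (F G : ℝ → ℂ) (ξ : ℝ) :
    ‖conv F G ξ‖ₑ ≤ convE (fun ζ => ‖F ζ‖ₑ) (fun ζ => ‖G ζ‖ₑ) ξ := by
  refine (enorm_integral_le_lintegral_enorm _).trans_eq ?_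
  simp [convE, enorm_mul]

lemma norm_conv_le (F G : LC) (ξ : ℝ) : ‖conv F G ξ‖ ≤ ‖F‖ * ‖G‖ := by
  have h1 := enorm_conv_le F G ξ
  have hF : Measurable fun ζ => ‖F ζ‖ₑ := (Lp.stronglyMeasurable F).measurable.enorm
  have hG : Measurable fun ζ => ‖G ζ‖ₑ := (Lp.stronglyMeasurable G).measurable.enorm
  have h2 := lintegral_mul_le_N2 (g := fun ζ => ‖G (ξ - ζ)‖ₑ) hF (hG.comp (by fun_prop))
  have h3 : N2 (fun ζ => ‖G (ξ - ζ)‖ₑ) = N2 (fun ζ => ‖G ζ‖ₑ) := by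
    unfold N2; rw [lintegral_sub_left_eq_self (fun ζ => ‖G ζ‖ₑ ^ 2) ξ]
  rw [h3, ← eLpNorm_two, ← eLpNorm_two, ← Lp.enorm_def, ← Lp.enorm_def] at h2
  have h4 := h1.trans h2
  rw [← enorm_norm F, ← enorm_norm G, ← enorm_mul] at h4
  simpa using (enorm_le_iff_norm_le.1 h4)

lemma stronglyMeasurable_conv {F G : ℝ → ℂ} (hF : StronglyMeasurable F)
    (hG : StronglyMeasurable G) : StronglyMeasurable (conv F G) := by
  unfold conv
  refine StronglyMeasurable.integral_prod_right' (f := fun p : ℝ × ℝ => F p.2 * G (p.1 - p.2)) ?_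
  exact (hF.comp_measurable measurable_snd).mul
    (hG.comp_measurable (measurable_fst.sub measurable_snd))

lemma Adm.memLp_conv {m : ℝ → ℂ} (hm : Adm m) (F G : LC) :
    MemLp (fun ξ => m ξ * conv F G ξ) 2 volume := by
  refine hm.memLp.of_le_mul (c := ‖F‖ * ‖G‖) (hm.meas.aestronglyMeasurable.mul
    (stronglyMeasurable_conv (Lp.stronglyMeasurable F) (Lp.stronglyMeasurable G)).aestronglyMeasurable)
    (Eventually.of_forall fun ξ => ?_)
  rw [norm_mul, mul_comm]; exact mul_le_mul_of_nonneg_right (norm_conv_le F G ξ) (norm_nonneg _)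

open Classical in
/-- The bilinear operator `(F, G) ↦ m * (F ⋆ G)`. -/
def convOp (m : ℝ → ℂ) : LC →L[ℝ] LC →L[ℝ] LC :=
  if hm : Adm m then
    LinearMap.mkContinuous₂
      (LinearMap.mk₂ ℝ (fun F G => (hm.memLp_conv F G).toLp)
        (fun F F' G => by
          rw [← MemLp.toLp_add, MemLp.toLp_eq_toLp_iff]
          refine Eventually.of_forall fun ξ => ?_
          simp only [Pi.add_apply]
          rw [conv_congr (Lp.coeFn_add F F') (ae_eq_refl _), ← mul_add]
          congr 1
          exact conv_add_left (Lp.memLp _) (Lp.memLp _) (Lp.memLp _) ξ)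
        (fun c F G => by
          rw [← MemLp.toLp_const_smul, MemLp.toLp_eq_toLp_iff]
          refine Eventually.of_forall fun ξ => ?_
          simp only [Pi.smul_apply]
          rw [conv_congr (Lp.coeFn_smul c F) (ae_eq_refl _)]
          simp only [conv, Pi.smul_apply, smul_mul_assoc, integral_smul, mul_smul_comm])
        (fun F G G' => by
          rw [← MemLp.toLp_add, MemLp.toLp_eq_toLp_iff]
          refine Eventually.of_forall fun ξ => ?_
          simp only [Pi.add_apply]
          rw [conv_congr (ae_eq_refl _) (Lp.coeFn_add G G'), ← mul_add]
          congr 1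
          exact conv_add_right (Lp.memLp _) (Lp.memLp _) (Lp.memLp _) ξ)
        (fun c F G => by
          rw [← MemLp.toLp_const_smul, MemLp.toLp_eq_toLp_iff]
          refine Eventually.of_forall fun ξ => ?_
          simp only [Pi.smul_apply]
          rw [conv_congr (ae_eq_refl _) (Lp.coeFn_smul c G)]
          simp only [conv, Pi.smul_apply, integral_smul, mul_smul_comm]))
      ‖hm.memLp.toLp‖ (fun F G => by
        rw [mul_assoc, mul_comm]
        refine Lp.norm_le_mul_norm_of_ae_le_mul ?_
        filter_upwards [(hm.memLp_conv F G).coeFn_toLp, hm.memLp.coeFn_toLp] with x hx hx'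
        rw [LinearMap.mk₂_apply, hx, hx', norm_mul, mul_comm]
        exact mul_le_mul_of_nonneg_right (norm_conv_le F G x) (norm_nonneg _))
  else 0

lemma convOp_ae {m : ℝ → ℂ} (hm : Adm m) (F G : LC) :
    convOp m F G =ᵐ[volume] fun ξ => m ξ * conv F G ξ := by
  rw [convOp, dif_pos hm]
  exact (hm.memLp_conv F G).coeFn_toLp

lemma prodHat_eq_conv (f g : L2) (ξ : ℝ) : prodHat f g ξ = conv (hat f) (hat g) ξ := prodHat_eq f g ξ

lemma mulOp_mulOp {m p q : ℝ → ℂ} (hm : Adm m) (hp : Adm p) (hq : Adm q)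
    (h : ∀ ξ, m ξ * p ξ = q ξ) (F : LC) : mulOp m (mulOp p F) = mulOp q F := by
  refine Lp.ext ?_
  filter_upwards [mulOp_ae hm (mulOp p F), mulOp_ae hp F, mulOp_ae hq F] with ξ h1 h2 h3
  rw [h1, h2, h3, ← h ξ]; ring

lemma mulOp_convOp {m p q : ℝ → ℂ} (hm : Adm m) (hp : Adm p) (hq : Adm q)
    (h : ∀ ξ, m ξ * p ξ = q ξ) (F G : LC) : mulOp m (convOp p F G) = convOp q F G := by
  refine Lp.ext ?_
  filter_upwards [mulOp_ae hm (convOp p F G), convOp_ae hp F G, convOp_ae hq F G] with ξ h1 h2 h3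
  rw [h1, h2, h3, ← h ξ]; ring

/-! ### From weak to strong derivatives -/

/-- The candidate derivative `G` is norm continuous, so the mean value inequality bounds each scalar
remainder by `‖g‖ ε |x - t|` with `ε` independent of `g`. This extends from the dense set to all
`g`, and the remainder itself may then be taken as test vector. -/
lemma hasDerivWithinAt_of_dense {E : Type*} [NormedAddCommGroup E] [InnerProductSpace ℂ E]
    {D : Set E} (hD : Dense D) {I : Set ℝ} (hI : I.OrdConnected) {f G : ℝ → E}
    (hG : ContinuousOn G I)
    (h : ∀ g ∈ D, ∀ t ∈ I, HasDerivWithinAt (fun τ => inner ℂ g (f τ)) (inner ℂ g (G t)) I t)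
    {t : ℝ} (ht : t ∈ I) : HasDerivWithinAt f (G t) I t := by
  rw [hasDerivWithinAt_iff_isLittleO, Asymptotics.isLittleO_iff]
  intro ε hε
  have h1 := Metric.continuousWithinAt_iff.1 (hG t ht) ε hε
  obtain ⟨δ, hδ, h1⟩ := h1
  have hB : Metric.ball t δ ∈ 𝓝[I] t := mem_nhdsWithin_of_mem_nhds (Metric.ball_mem_nhds t hδ)
  filter_upwards [hB, self_mem_nhdsWithin] with x hx hxI
  set J := I ∩ Metric.ball t δ
  have hJ : Convex ℝ J := hI.convex.inter (convex_ball t δ)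
  set r := f x - f t - (x - t) • G t with hr
  have key : ∀ g ∈ D, ‖inner ℂ g r‖ ≤ ‖g‖ * (ε * ‖x - t‖) := by
    intro g hg
    have hd : ∀ τ ∈ J, HasDerivWithinAt (fun τ => inner ℂ g (f τ) - (τ : ℂ) * inner ℂ g (G t))
        (inner ℂ g (G τ) - inner ℂ g (G t)) J τ := by
      intro τ hτ
      have e1 := (h g hg τ hτ.1).mono (Set.inter_subset_left : J ⊆ I)
      have e2 : HasDerivWithinAt (fun τ : ℝ => (τ : ℂ) * inner ℂ g (G t))
          (1 * inner ℂ g (G t)) J τ :=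
        (Complex.ofRealCLM.hasDerivAt (x := τ)).hasDerivWithinAt.mul_const _
      rw [one_mul] at e2
      exact e1.sub e2
    have hb : ∀ τ ∈ J, ‖inner ℂ g (G τ) - inner ℂ g (G t)‖ ≤ ‖g‖ * ε := by
      intro τ hτ
      rw [← inner_sub_right]
      refine (norm_inner_le_norm _ _).trans ?_
      gcongr
      rw [← dist_eq_norm]
      exact (h1 hτ.1 hτ.2).le
    have := hJ.norm_image_sub_le_of_norm_hasDerivWithin_le hd hb
      (⟨ht, Metric.mem_ball_self hδ⟩ : t ∈ J) (⟨hxI, hx⟩ : x ∈ J)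
    have e : inner ℂ g r = inner ℂ g (f x) - (x : ℂ) * inner ℂ g (G t) -
        (inner ℂ g (f t) - (t : ℂ) * inner ℂ g (G t)) := by
      rw [hr, inner_sub_right, inner_sub_right, inner_smul_right_eq_smul, Complex.real_smul]
      push_cast; ring
    rw [e, ← mul_assoc]; exact this
  have hall : ∀ g : E, ‖inner ℂ g r‖ ≤ ‖g‖ * (ε * ‖x - t‖) := by
    intro g
    refine hD.induction (P := fun g => ‖inner ℂ g r‖ ≤ ‖g‖ * (ε * ‖x - t‖)) key ?_ g
    exact isClosed_le (by fun_prop) (by fun_prop)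
  have h2 := hall r
  rw [inner_self_eq_norm_sq_to_K] at h2
  rcases eq_or_ne ‖r‖ 0 with h0 | h0
  · rw [h0]; positivity
  · have h3 : 0 < ‖r‖ := lt_of_le_of_ne (norm_nonneg _) (Ne.symm h0)
    have h4 : ‖r‖ * ‖r‖ ≤ ‖r‖ * (ε * ‖x - t‖) := by
      simpa [sq] using h2
    exact le_of_mul_le_mul_left h4 h3

/-! ### The system on the Fourier side -/

/-- The symbol `-i * 2πξ` of `-∂ₓ`. -/
def symD (ξ : ℝ) : ℂ := -Complex.I * ((2 * Real.pi * ξ : ℝ) : ℂ)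

/-- The symbol `-i * tanh (2πξ)` of `-K² ∂ₓ`. -/
def symT (ξ : ℝ) : ℂ := -Complex.I * ((Real.tanh (2 * Real.pi * ξ) : ℝ) : ℂ)

lemma contDiff_symD : ContDiff ℝ ((⊤ : ℕ∞) : WithTop ℕ∞) symD :=
  contDiff_const.mul (Complex.ofRealCLM.contDiff.comp (contDiff_const.mul contDiff_id))

lemma contDiff_tanh : ContDiff ℝ ((⊤ : ℕ∞) : WithTop ℕ∞) Real.tanh := by
  rw [funext Real.tanh_eq_sinh_div_cosh]
  exact Real.contDiff_sinh.div Real.contDiff_cosh fun x => (Real.cosh_pos x).ne'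

lemma contDiff_symT : ContDiff ℝ ((⊤ : ℕ∞) : WithTop ℕ∞) symT :=
  contDiff_const.mul (Complex.ofRealCLM.contDiff.comp
    (contDiff_tanh.comp (contDiff_const.mul contDiff_id)))

lemma deriv_fourier_schwartz (g : 𝓢(ℝ, ℂ)) :
    deriv (𝓕 (g : ℝ → ℂ)) = 𝓕 fun ξ => symD ξ * g ξ := by
  have hx : Integrable (fun x : ℝ => x • g x) := by
    have := g.integrable_pow_mul volume 1
    refine this.mono' (by fun_prop) (Eventually.of_forall fun x => ?_)
    simp
  rw [Real.deriv_fourier g.integrable hx]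
  congr 1; ext ξ
  simp only [symD, smul_eq_mul]; push_cast; ring

/-- The equations are tested against `𝓕 g`. The reflection relating `𝓕⁻` to `𝓕`, together with the
oddness of `tanh`, turns the symbol `i tanh` into `-i tanh`. -/
lemma opK2dx_fourier (g : 𝓢(ℝ, ℂ)) : opK2dx (𝓕 g) = 𝓕 fun ξ => symT ξ * g ξ := by
  unfold opK2dx
  rw [Real.fourierInv_eq_fourier_comp_neg]
  congr 1; ext ξ
  have h1 : 𝓕 ((𝓕 g : 𝓢(ℝ, ℂ)) : ℝ → ℂ) (-ξ) = g ξ := by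
    rw [← Real.fourierInv_eq_fourier_neg, ← SchwartzMap.fourierInv_coe, FourierTransform.fourierInv_fourier_eq]
  rw [h1]
  congr 1
  have h2 := symK_sq_mul (2 * Real.pi * -ξ)
  rw [symT, show Real.tanh (2 * Real.pi * ξ) = -(symK (2 * Real.pi * -ξ) ^ 2 * (2 * Real.pi * -ξ)) by
    rw [h2, ← Real.tanh_neg]; congr 1; ring]
  push_cast; ring

variable {s : ℝ} {I : Set ℝ} {η v : ℝ → L2}

lemma IsSolution.weak_eta (hu : IsSolution s I η v) {g : 𝓢(ℝ, ℂ)} (hg : HasCompactSupport g)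
    {t : ℝ} (ht : t ∈ I) :
    HasDerivWithinAt (fun τ => ∫ ξ, hat (η τ) ξ * g ξ)
      ((∫ ξ, symD ξ * hat (v t) ξ * g ξ) + ∫ ξ, symT ξ * prodHat (η t) (v t) ξ * g ξ) I t := by
  have h := hu.eq_eta (𝓕 g) t ht
  obtain ⟨g1, -, h1⟩ := exists_smooth_mul hg contDiff_symD
  obtain ⟨g2, -, h2⟩ := exists_smooth_mul hg contDiff_symT
  have e1 : ∀ τ, ∫ x, (η τ x : ℂ) * (𝓕 g : 𝓢(ℝ, ℂ)) x = ∫ ξ, hat (η τ) ξ * g ξ :=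
    fun τ => (integral_hat_mul (η τ) g).symm
  have e2 : ∫ x, (v t x : ℂ) * deriv (𝓕 g : 𝓢(ℝ, ℂ)) x = ∫ ξ, symD ξ * hat (v t) ξ * g ξ := by
    rw [SchwartzMap.fourier_coe, deriv_fourier_schwartz, ← show (g1 : ℝ → ℂ) = _ from funext h1,
      ← integral_hat_mul]
    congr 1; ext ξ; rw [h1]; ring
  have e3 : ∫ x, ((η t x * v t x : ℝ) : ℂ) * opK2dx (𝓕 g) x =
      ∫ ξ, symT ξ * prodHat (η t) (v t) ξ * g ξ := by
    rw [opK2dx_fourier, ← show (g2 : ℝ → ℂ) = _ from funext h2,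
      ← integral_prodHat_mul _ _ g2.integrable]
    congr 1; ext ξ; rw [h2]; ring
  simp only [e1, e2, e3] at h
  exact h

lemma IsSolution.weak_v (hu : IsSolution s I η v) {g : 𝓢(ℝ, ℂ)} (hg : HasCompactSupport g)
    {t : ℝ} (ht : t ∈ I) :
    HasDerivWithinAt (fun τ => ∫ ξ, hat (v τ) ξ * g ξ)
      ((∫ ξ, symT ξ * hat (η t) ξ * g ξ) +
        (1 / 2 : ℝ) • ∫ ξ, symT ξ * prodHat (v t) (v t) ξ * g ξ) I t := by
  have h := hu.eq_v (𝓕 g) t ht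
  obtain ⟨g2, -, h2⟩ := exists_smooth_mul hg contDiff_symT
  have e1 : ∀ τ, ∫ x, (v τ x : ℂ) * (𝓕 g : 𝓢(ℝ, ℂ)) x = ∫ ξ, hat (v τ) ξ * g ξ :=
    fun τ => (integral_hat_mul (v τ) g).symm
  have e2 : ∫ x, (η t x : ℂ) * opK2dx (𝓕 g) x = ∫ ξ, symT ξ * hat (η t) ξ * g ξ := by
    rw [opK2dx_fourier, ← show (g2 : ℝ → ℂ) = _ from funext h2, ← integral_hat_mul]
    congr 1; ext ξ; rw [h2]; ring
  have e3 : ∫ x, ((v t x ^ 2 / 2 : ℝ) : ℂ) * opK2dx (𝓕 g) x =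
      (1 / 2 : ℝ) • ∫ ξ, symT ξ * prodHat (v t) (v t) ξ * g ξ := by
    have : ∫ ξ, symT ξ * prodHat (v t) (v t) ξ * g ξ =
        ∫ x, ((v t x * v t x : ℝ) : ℂ) * opK2dx (𝓕 g) x := by
      rw [opK2dx_fourier, ← show (g2 : ℝ → ℂ) = _ from funext h2,
        ← integral_prodHat_mul _ _ g2.integrable]
      congr 1; ext ξ; rw [h2]; ring
    rw [this, ← integral_smul]
    congr 1; ext x
    rw [Complex.real_smul]; push_cast; ring
  simp only [e1, e2, e3] at h
  exact h

/-- The time derivative of `m * hat (η t)`. -/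
def dEta (m : ℝ → ℂ) (f g : L2) : LC :=
  mulOp (fun ξ => m ξ * symD ξ) (hat g) + convOp (fun ξ => m ξ * symT ξ) (hat f) (hat g)

/-- The time derivative of `m * hat (v t)`. -/
def dV (m : ℝ → ℂ) (f g : L2) : LC :=
  mulOp (fun ξ => m ξ * symT ξ) (hat f) +
    (1 / 2 : ℝ) • convOp (fun ξ => m ξ * symT ξ) (hat g) (hat g)

lemma isometry_hat : Isometry hat := by
  refine Isometry.of_dist_eq fun f g => ?_
  rw [dist_eq_norm, dist_eq_norm, ← hat_sub, norm_hat]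

lemma continuous_hat : Continuous hat := isometry_hat.continuous

/-- Testing a multiplier against a Schwartz function. -/
lemma inner_schwartz_eq (ψ : 𝓢(ℝ, ℂ)) {F : LC} {G : ℝ → ℂ} (h : F =ᵐ[volume] G) :
    inner ℂ (ψ.toLp 2 : LC) F = ∫ ξ, G ξ * (starRingEnd ℂ) (ψ ξ) := by
  rw [L2.inner_def]
  refine integral_congr_ae ?_
  filter_upwards [h, ψ.coeFn_toLp 2 volume] with ξ h1 h2
  rw [h1, h2, RCLike.inner_apply]

/-- A smooth cutoff can be moved onto the test function, since `χ` times the conjugate of a Schwartz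
function is smooth with compact support. The weak equations thus give weak derivatives against
Schwartz functions, which are dense in `L²`. -/
lemma IsSolution.hasDeriv_smooth (hs : 0 ≤ s) (hI : I.OrdConnected) (hu : IsSolution s I η v)
    {χ : ℝ → ℂ} (hχ : HasCompactSupport χ) (hχd : ContDiff ℝ ((⊤ : ℕ∞) : WithTop ℕ∞) χ)
    (hA : Adm χ) {t : ℝ} (ht : t ∈ I) :
    HasDerivWithinAt (fun τ => mulOp χ (hat (η τ))) (dEta χ (η t) (v t)) I t ∧
      HasDerivWithinAt (fun τ => mulOp χ (hat (v τ))) (dV χ (η t) (v t)) I t := by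
  have hce := continuous_hat.comp_continuousOn (hu.continuousOn_eta hs)
  have hcv := continuous_hat.comp_continuousOn (hu.continuousOn_v hs)
  have hAD := hA.mul_continuous contDiff_symD.continuous
  have hAT := hA.mul_continuous contDiff_symT.continuous
  have hdense := SchwartzMap.denseRange_toLpCLM (E := ℝ) (F := ℂ) (p := 2) (μ := volume)
    (by norm_num)
  have htest : ∀ ψ : 𝓢(ℝ, ℂ), ∃ g : 𝓢(ℝ, ℂ), HasCompactSupport g ∧
      ∀ x, g x = χ x * (starRingEnd ℂ) (ψ x) := fun ψ =>
    ⟨(hχ.mul_right (f' := fun x => (starRingEnd ℂ) (ψ x))).toSchwartzMap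
      (hχd.mul (Complex.conjCLE.contDiff.comp (ψ.smooth _))), hχ.mul_right, fun x => rfl⟩
  constructor
  · refine hasDerivWithinAt_of_dense hdense hI (G := fun t => dEta χ (η t) (v t)) ?_ ?_ ht
    · exact ((mulOp _).continuous.comp_continuousOn hcv).add
        (((convOp _).continuous.comp_continuousOn hce).clm_apply hcv)
    · rintro _ ⟨ψ, rfl⟩ t ht
      obtain ⟨g, hg, hgx⟩ := htest ψ
      have h := hu.weak_eta hg ht
      have e1 : ∀ τ, inner ℂ (SchwartzMap.toLpCLM ℝ ℂ 2 volume ψ) (mulOp χ (hat (η τ))) =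
          ∫ ξ, hat (η τ) ξ * g ξ := fun τ => by
        rw [SchwartzMap.toLpCLM_apply, inner_schwartz_eq ψ (mulOp_ae hA _)]
        congr 1; ext ξ; rw [hgx]; ring
      have e2 : inner ℂ (SchwartzMap.toLpCLM ℝ ℂ 2 volume ψ) (dEta χ (η t) (v t)) =
          (∫ ξ, symD ξ * hat (v t) ξ * g ξ) + ∫ ξ, symT ξ * prodHat (η t) (v t) ξ * g ξ := by
        rw [SchwartzMap.toLpCLM_apply, dEta, inner_add_right, inner_schwartz_eq ψ (mulOp_ae hAD _),
          inner_schwartz_eq ψ (convOp_ae hAT _ _)]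
        congr 2
        · ext ξ; rw [hgx]; ring
        · ext ξ; rw [hgx, prodHat_eq_conv]; ring
      rw [e2]
      simp only [e1]
      exact h
  · refine hasDerivWithinAt_of_dense hdense hI (G := fun t => dV χ (η t) (v t)) ?_ ?_ ht
    · have h3 : ContinuousOn
          (fun t => convOp (fun ξ => χ ξ * symT ξ) (hat (v t)) (hat (v t))) I :=
        ((convOp _).continuous.comp_continuousOn hcv).clm_apply hcv
      exact ((mulOp _).continuous.comp_continuousOn hce).add (h3.const_smul (1 / 2 : ℝ))
    · rintro _ ⟨ψ, rfl⟩ t ht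
      obtain ⟨g, hg, hgx⟩ := htest ψ
      have h := hu.weak_v hg ht
      have e1 : ∀ τ, inner ℂ (SchwartzMap.toLpCLM ℝ ℂ 2 volume ψ) (mulOp χ (hat (v τ))) =
          ∫ ξ, hat (v τ) ξ * g ξ := fun τ => by
        rw [SchwartzMap.toLpCLM_apply, inner_schwartz_eq ψ (mulOp_ae hA _)]
        congr 1; ext ξ; rw [hgx]; ring
      have e2 : inner ℂ (SchwartzMap.toLpCLM ℝ ℂ 2 volume ψ) (dV χ (η t) (v t)) =
          (∫ ξ, symT ξ * hat (η t) ξ * g ξ) +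
            (1 / 2 : ℝ) • ∫ ξ, symT ξ * prodHat (v t) (v t) ξ * g ξ := by
        rw [SchwartzMap.toLpCLM_apply, dV, inner_add_right, inner_smul_right_eq_smul,
          inner_schwartz_eq ψ (mulOp_ae hAT _), inner_schwartz_eq ψ (convOp_ae hAT _ _)]
        congr 2
        · ext ξ; rw [hgx]; ring
        · congr 1; ext ξ; rw [hgx, prodHat_eq_conv]; ring
      rw [e2]
      simp only [e1]
      exact h

lemma exists_cutoff (N : ℝ) : ∃ χ : ℝ → ℂ, HasCompactSupport χ ∧
    ContDiff ℝ ((⊤ : ℕ∞) : WithTop ℕ∞) χ ∧ Adm χ ∧ ∀ ξ, |ξ| ≤ N → χ ξ = 1 := by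
  let b : ContDiffBump (0 : ℝ) := ⟨|N| + 1, |N| + 2, by positivity, by linarith⟩
  refine ⟨fun x => (b x : ℂ), b.hasCompactSupport.comp_left (g := fun x : ℝ => (x : ℂ)) rfl,
    Complex.ofRealCLM.contDiff.comp b.contDiff,
    ⟨Complex.measurable_ofReal.comp b.continuous.measurable, ⟨1, fun ξ => ?_⟩, |N| + 2,
      fun ξ h => ?_⟩, fun ξ h => ?_⟩
  · simpa [abs_of_nonneg b.nonneg] using b.le_one
  · have : b ξ = 0 := b.zero_of_le_dist (by simpa using h.le)
    simp [this]
  · have : b ξ = 1 := b.one_of_mem_closedBall (by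
      simp only [Metric.mem_closedBall, dist_zero_right, Real.norm_eq_abs]
      exact h.trans ((le_abs_self N).trans (by linarith [show b.rIn = |N| + 1 from rfl])))
    simp [this]

/-- Truncated solutions satisfy the system strongly. -/
lemma IsSolution.hasDeriv (hs : 0 ≤ s) (hI : I.OrdConnected) (hu : IsSolution s I η v)
    {m : ℝ → ℂ} (hm : Adm m) {t : ℝ} (ht : t ∈ I) :
    HasDerivWithinAt (fun τ => mulOp m (hat (η τ))) (dEta m (η t) (v t)) I t ∧
      HasDerivWithinAt (fun τ => mulOp m (hat (v τ))) (dV m (η t) (v t)) I t := by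
  -- Choose a smooth `χ` equal to `1` wherever `m` may be nonzero. Then `m = m χ`, and
  -- multiplication by `m` is a bounded linear map, hence commutes with the time derivative.
  obtain ⟨N, hN⟩ := hm.supp
  obtain ⟨χ, hχ, hχd, hA, hχ1⟩ := exists_cutoff N
  have hmul : ∀ ξ, m ξ * χ ξ = m ξ := fun ξ => by
    rcases lt_or_ge N |ξ| with h | h
    · rw [hN ξ h, zero_mul]
    · rw [hχ1 ξ h, mul_one]
  have hmul' : ∀ p : ℝ → ℂ, ∀ ξ, m ξ * (χ ξ * p ξ) = m ξ * p ξ := fun p ξ => by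
    rw [← mul_assoc, hmul]
  have cD := contDiff_symD.continuous
  have cT := contDiff_symT.continuous
  obtain ⟨h1, h2⟩ := hu.hasDeriv_smooth hs hI hχ hχd hA ht
  have h1' := (mulOp m).hasFDerivAt.comp_hasDerivWithinAt t h1
  have h2' := (mulOp m).hasFDerivAt.comp_hasDerivWithinAt t h2
  have e1 : mulOp m (dEta χ (η t) (v t)) = dEta m (η t) (v t) := by
    rw [dEta, dEta, map_add,
      mulOp_mulOp hm (hA.mul_continuous cD) (hm.mul_continuous cD) (hmul' _),
      mulOp_convOp hm (hA.mul_continuous cT) (hm.mul_continuous cT) (hmul' _)]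
  have e2 : mulOp m (dV χ (η t) (v t)) = dV m (η t) (v t) := by
    rw [dV, dV, map_add, map_smul,
      mulOp_mulOp hm (hA.mul_continuous cT) (hm.mul_continuous cT) (hmul' _),
      mulOp_convOp hm (hA.mul_continuous cT) (hm.mul_continuous cT) (hmul' _)]
  rw [e1] at h1'
  rw [e2] at h2'
  refine ⟨h1'.congr_deriv rfl |>.congr (fun τ _ => ?_) ?_, h2'.congr (fun τ _ => ?_) ?_⟩ <;>
  exact (mulOp_mulOp hm hA hm hmul _).symm

/-! ### Gronwall type inequalities -/

lemma hasDerivAt_primitive {M : ℝ → ℝ} {t r : ℝ} (hM : ContinuousOn M (Set.Icc 0 t))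
    (hr : r ∈ Set.Ioo 0 t) : HasDerivAt (fun x => ∫ τ in (0 : ℝ)..x, M τ) (M r) r := by
  have hi : IntervalIntegrable M volume 0 r :=
    (hM.mono (Set.Icc_subset_Icc_right hr.2.le)).intervalIntegrable_of_Icc hr.1.le
  have hc : ContinuousAt M r := hM.continuousAt (Icc_mem_nhds hr.1 hr.2)
  refine intervalIntegral.integral_hasDerivAt_right hi ?_ hc
  exact (hM.mono Set.Ioo_subset_Icc_self).stronglyMeasurableAtFilter isOpen_Ioo r hr

lemma continuousOn_primitive {M : ℝ → ℝ} {t : ℝ} (ht : 0 ≤ t) (hM : ContinuousOn M (Set.Icc 0 t)) :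
    ContinuousOn (fun x => ∫ τ in (0 : ℝ)..x, M τ) (Set.Icc 0 t) := by
  have := intervalIntegral.continuousOn_primitive_interval (μ := volume) (a := 0) (b := t) (f := M)
    (by rw [Set.uIcc_of_le ht]; exact hM.integrableOn_Icc)
  rwa [Set.uIcc_of_le ht] at this

lemma sub_le_integral {f f' M : ℝ → ℝ} {t : ℝ} (ht : 0 ≤ t) (hf : ContinuousOn f (Set.Icc 0 t))
    (hf' : ∀ r ∈ Set.Ioo 0 t, HasDerivAt f (f' r) r) (hM : ContinuousOn M (Set.Icc 0 t))
    (h : ∀ r ∈ Set.Ioo 0 t, f' r ≤ M r) : f t - f 0 ≤ ∫ τ in (0 : ℝ)..t, M τ :=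
  intervalIntegral.sub_le_integral_of_hasDeriv_right_of_le ht hf
    (fun r hr => (hf' r hr).hasDerivWithinAt) hM.integrableOn_Icc h

lemma primitive_nonneg {M : ℝ → ℝ} {t r : ℝ} (hr : r ∈ Set.Icc 0 t)
    (h : ∀ τ ∈ Set.Icc 0 t, 0 ≤ M τ) : 0 ≤ ∫ τ in (0 : ℝ)..r, M τ :=
  intervalIntegral.integral_nonneg hr.1 fun τ hτ => h τ ⟨hτ.1, hτ.2.trans hr.2⟩

/-- With `P` the right-hand side, `√P` has derivative `k X² / √P ≤ k X`. This passes from the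
squared norm to the norm without a loss in front of `x₀`. -/
lemma gronwall_sqrt {X k : ℝ → ℝ} {x₀ t : ℝ} (ht : 0 ≤ t) (hx₀ : 0 ≤ x₀)
    (hX : ContinuousOn X (Set.Icc 0 t)) (hk : ContinuousOn k (Set.Icc 0 t))
    (hX0 : ∀ r ∈ Set.Icc 0 t, 0 ≤ X r) (hk0 : ∀ r ∈ Set.Icc 0 t, 0 ≤ k r)
    (h : ∀ r ∈ Set.Icc 0 t, X r ^ 2 ≤ x₀ ^ 2 + ∫ τ in (0 : ℝ)..r, 2 * (k τ * X τ ^ 2)) :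
    X t ≤ x₀ + ∫ τ in (0 : ℝ)..t, k τ * X τ := by
  refine le_of_forall_pos_le_add fun δ hδ => ?_
  have hM : ContinuousOn (fun τ => 2 * (k τ * X τ ^ 2)) (Set.Icc 0 t) := by fun_prop
  have hM0 : ∀ τ ∈ Set.Icc 0 t, 0 ≤ 2 * (k τ * X τ ^ 2) := fun τ hτ => by
    have := hk0 τ hτ; positivity
  -- The term `δ²` keeps `P` away from zero, where the square root is not differentiable.
  set P : ℝ → ℝ := fun r => x₀ ^ 2 + δ ^ 2 + ∫ τ in (0 : ℝ)..r, 2 * (k τ * X τ ^ 2) with hP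
  have hPpos : ∀ r ∈ Set.Icc 0 t, 0 < P r := fun r hr => by
    have := primitive_nonneg hr hM0
    simp only [hP]; positivity
  have hXP : ∀ r ∈ Set.Icc 0 t, X r ≤ Real.sqrt (P r) := fun r hr => by
    refine Real.le_sqrt_of_sq_le ((h r hr).trans ?_)
    simp only [hP]; nlinarith [sq_nonneg δ]
  have hPc : ContinuousOn P (Set.Icc 0 t) := continuousOn_const.add (continuousOn_primitive ht hM)
  have key := sub_le_integral (f := fun r => Real.sqrt (P r))
    (f' := fun r => 2 * (k r * X r ^ 2) / (2 * Real.sqrt (P r))) (M := fun r => k r * X r) ht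
    (Real.continuous_sqrt.comp_continuousOn hPc)
    (fun r hr => ((hasDerivAt_primitive hM hr).const_add _).sqrt
      (hPpos r (Set.Ioo_subset_Icc_self hr)).ne')
    (by fun_prop)
    (fun r hr => by
      have hr' := Set.Ioo_subset_Icc_self hr
      have h1 := Real.sqrt_pos.2 (hPpos r hr')
      rw [div_le_iff₀ (by positivity)]
      have h2 := hXP r hr'
      have h3 := mul_nonneg (hk0 r hr') (hX0 r hr')
      nlinarith [mul_le_mul_of_nonneg_left h2 h3])
  have h0 : Real.sqrt (P 0) ≤ x₀ + δ := by
    rw [Real.sqrt_le_left (by positivity)]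
    simp only [hP, intervalIntegral.integral_same]; nlinarith
  have := hXP t ⟨ht, le_rfl⟩
  linarith

lemma gronwall_exp {X k : ℝ → ℝ} {x₀ t : ℝ} (ht : 0 ≤ t) (hx₀ : 0 ≤ x₀)
    (hX : ContinuousOn X (Set.Icc 0 t)) (hk : ContinuousOn k (Set.Icc 0 t))
    (hX0 : ∀ r ∈ Set.Icc 0 t, 0 ≤ X r) (hk0 : ∀ r ∈ Set.Icc 0 t, 0 ≤ k r)
    (h : ∀ r ∈ Set.Icc 0 t, X r ≤ x₀ + ∫ τ in (0 : ℝ)..r, k τ * X τ) :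
    X t ≤ x₀ * Real.exp (∫ τ in (0 : ℝ)..t, k τ) := by
  refine le_of_forall_pos_le_add fun ε hε => ?_
  set E := Real.exp (∫ τ in (0 : ℝ)..t, k τ) with hE
  have hEpos : 0 < E := Real.exp_pos _
  -- The shift by `δ` makes `log P` meaningful when `x₀ = 0`. It is amplified by the factor `E`, so
  -- it costs exactly `ε`.
  set δ := ε / E with hδ'
  have hδ : 0 < δ := by positivity
  have hM : ContinuousOn (fun τ => k τ * X τ) (Set.Icc 0 t) := by fun_prop
  have hM0 : ∀ τ ∈ Set.Icc 0 t, 0 ≤ k τ * X τ := fun τ hτ => mul_nonneg (hk0 τ hτ) (hX0 τ hτ)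
  set P : ℝ → ℝ := fun r => x₀ + δ + ∫ τ in (0 : ℝ)..r, k τ * X τ with hP
  have hPpos : ∀ r ∈ Set.Icc 0 t, 0 < P r := fun r hr => by
    have := primitive_nonneg hr hM0
    simp only [hP]; positivity
  have hXP : ∀ r ∈ Set.Icc 0 t, X r ≤ P r := fun r hr => by
    have := h r hr
    simp only [hP]; linarith
  have hPc : ContinuousOn P (Set.Icc 0 t) := continuousOn_const.add (continuousOn_primitive ht hM)
  have key := sub_le_integral (f := fun r => Real.log (P r))
    (f' := fun r => k r * X r / P r) (M := k) ht
    (hPc.log fun r hr => (hPpos r hr).ne')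
    (fun r hr => ((hasDerivAt_primitive hM hr).const_add _).log
      (hPpos r (Set.Ioo_subset_Icc_self hr)).ne')
    hk
    (fun r hr => by
      have hr' := Set.Ioo_subset_Icc_self hr
      rw [div_le_iff₀ (hPpos r hr')]
      exact mul_le_mul_of_nonneg_left (hXP r hr') (hk0 r hr'))
  have h0 : P 0 = x₀ + δ := by simp [hP]
  rw [h0] at key
  have h1 : P t ≤ (x₀ + δ) * E := by
    rw [← Real.log_le_log_iff (hPpos t ⟨ht, le_rfl⟩) (by positivity),
      Real.log_mul (by positivity) (by positivity), hE, Real.log_exp]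
    linarith
  have h2 := hXP t ⟨ht, le_rfl⟩
  have h3 : δ * E = ε := by rw [hδ']; field_simp
  nlinarith

/-- Differentiate `log (log P)`, where `P` is the right-hand side plus `e`. The shift gives `log P ≥
1`, so the iterated logarithm makes sense and `1 + log P ≤ 2 log P`, which is the source of the rate
`2 c`. -/
lemma gronwall_log {X : ℝ → ℝ} {x₀ c t : ℝ} (ht : 0 ≤ t) (hx₀ : 0 ≤ x₀) (hc : 0 ≤ c)
    (hX : ContinuousOn X (Set.Icc 0 t)) (hX0 : ∀ r ∈ Set.Icc 0 t, 0 ≤ X r)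
    (h : ∀ r ∈ Set.Icc 0 t, X r ≤ x₀ +
      ∫ τ in (0 : ℝ)..r, c * (1 + Real.log (Real.exp 1 + X τ)) * X τ) :
    X t ≤ Real.exp (Real.log (Real.exp 1 + x₀) * Real.exp (2 * c * t)) := by
  have he : 0 < Real.exp 1 := Real.exp_pos 1
  have hlog : ∀ x : ℝ, 0 ≤ x → 1 ≤ Real.log (Real.exp 1 + x) := fun x hx => by
    rw [Real.le_log_iff_exp_le (by positivity)]; linarith
  have hM : ContinuousOn (fun τ => c * (1 + Real.log (Real.exp 1 + X τ)) * X τ) (Set.Icc 0 t) := by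
    refine ((continuousOn_const.add ((continuousOn_const.add hX).log fun r hr => ?_)).const_mul
      c).mul hX
    exact (add_pos_of_pos_of_nonneg he (hX0 r hr)).ne'
  have hM0 : ∀ τ ∈ Set.Icc 0 t, 0 ≤ c * (1 + Real.log (Real.exp 1 + X τ)) * X τ := fun τ hτ => by
    have := hX0 τ hτ
    have := hlog _ this
    exact mul_nonneg (mul_nonneg hc (by linarith)) (hX0 τ hτ)
  set P : ℝ → ℝ := fun r => Real.exp 1 + x₀ +
    ∫ τ in (0 : ℝ)..r, c * (1 + Real.log (Real.exp 1 + X τ)) * X τ with hP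
  have hXP : ∀ r ∈ Set.Icc 0 t, Real.exp 1 + X r ≤ P r := fun r hr => by
    have := h r hr
    simp only [hP]; linarith
  have hPpos : ∀ r ∈ Set.Icc 0 t, 0 < P r := fun r hr => by
    have := hXP r hr
    have := hX0 r hr
    linarith
  have hL : ∀ r ∈ Set.Icc 0 t, 1 ≤ Real.log (P r) := fun r hr => by
    rw [Real.le_log_iff_exp_le (hPpos r hr)]
    have := hXP r hr
    have := hX0 r hr
    linarith
  have hPc : ContinuousOn P (Set.Icc 0 t) := continuousOn_const.add (continuousOn_primitive ht hM)
  have key := sub_le_integral (f := fun r => Real.log (Real.log (P r)))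
    (f' := fun r => c * (1 + Real.log (Real.exp 1 + X r)) * X r / P r / Real.log (P r))
    (M := fun _ => 2 * c) ht
    ((hPc.log fun r hr => (hPpos r hr).ne').log fun r hr => (zero_lt_one.trans_le (hL r hr)).ne')
    (fun r hr => (((hasDerivAt_primitive hM hr).const_add _).log
      (hPpos r (Set.Ioo_subset_Icc_self hr)).ne').log
        (zero_lt_one.trans_le (hL r (Set.Ioo_subset_Icc_self hr))).ne')
    continuousOn_const
    (fun r hr => by
      have hr' := Set.Ioo_subset_Icc_self hr
      have h1 := hL r hr'
      have h2 := hPpos r hr'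
      have h3 := hXP r hr'
      have h4 := hX0 r hr'
      have h5 : Real.log (Real.exp 1 + X r) ≤ Real.log (P r) :=
        Real.log_le_log (by positivity) h3
      have h6 := hlog _ h4
      rw [div_le_iff₀ (by linarith), div_le_iff₀ h2]
      calc c * (1 + Real.log (Real.exp 1 + X r)) * X r
          ≤ c * (Real.log (P r) + Real.log (P r)) * P r := by gcongr; linarith
        _ = _ := by ring)
  have h0 : P 0 = Real.exp 1 + x₀ := by simp [hP]
  simp only [h0, intervalIntegral.integral_const, smul_eq_mul, sub_zero] at key
  have ht' : t ∈ Set.Icc 0 t := ⟨ht, le_rfl⟩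
  have hL0 := hlog _ hx₀
  have h1 : Real.log (P t) ≤ Real.log (Real.exp 1 + x₀) * Real.exp (2 * c * t) := by
    have := hL t ht'
    rw [← Real.log_le_log_iff (by linarith) (by positivity),
      Real.log_mul (by positivity) (by positivity), Real.log_exp]
    linarith
  calc X t ≤ P t := by linarith [hXP t ht']
    _ = Real.exp (Real.log (P t)) := (Real.exp_log (hPpos t ht')).symm
    _ ≤ _ := Real.exp_le_exp.2 h1

/-! ### The truncated energy -/

lemma enorm_inner_le (F G : LC) : ‖inner ℂ F G‖ₑ ≤ ∫⁻ ξ, ‖F ξ‖ₑ * ‖G ξ‖ₑ := by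
  rw [L2.inner_def]
  refine (enorm_integral_le_lintegral_enorm _).trans_eq ?_
  congr 1; ext ξ
  rw [RCLike.inner_apply, enorm_mul, mul_comm]
  simp [enorm_eq_nnnorm]

lemma re_le_of_enorm_le {z : ℂ} {M : ℝ} (hM : 0 ≤ M) (h : ‖z‖ₑ ≤ ENNReal.ofReal M) : z.re ≤ M := by
  rw [← ofReal_norm, ENNReal.ofReal_le_ofReal_iff hM] at h
  exact (Complex.re_le_norm z).trans h

/-- The symbol `p (2πξ)` truncated to `|ξ| ≤ N`. -/
def cut (N : ℝ) (p : ℝ → ℝ) : ℝ → ℂ :=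
  (Set.Icc (-N) N).indicator fun ξ => (p (2 * Real.pi * ξ) : ℂ)

lemma adm_cut (N : ℝ) {p q : ℝ → ℝ} (hp : Measurable p) (hq : Continuous q)
    (h : ∀ κ, |p κ| ≤ q κ) : Adm (cut N p) := by
  obtain ⟨B, hB⟩ := (isCompact_Icc (a := -N) (b := N)).exists_bound_of_continuousOn
    (f := fun ξ => q (2 * Real.pi * ξ)) (by fun_prop)
  refine ⟨Measurable.indicator (Complex.measurable_ofReal.comp (hp.comp (by fun_prop)))
    measurableSet_Icc, ⟨|B|, fun ξ => ?_⟩, N, fun ξ hξ => ?_⟩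
  · by_cases hξ : ξ ∈ Set.Icc (-N) N
    · rw [cut, Set.indicator_of_mem hξ, Complex.norm_real, Real.norm_eq_abs]
      exact (h _).trans ((le_abs_self _).trans ((hB ξ hξ).trans (le_abs_self B)))
    · rw [cut, Set.indicator_of_notMem hξ]; simp
  · exact Set.indicator_of_notMem (fun hm : ξ ∈ Set.Icc (-N) N => hξ.not_ge (abs_le.2 hm)) _

lemma adm_cut_symJ (N s : ℝ) : Adm (cut N (symJ s)) :=
  adm_cut N (continuous_symJ s).measurable (continuous_symJ s) fun κ => (abs_symJ s κ).le

lemma adm_cut_symX (N s : ℝ) : Adm (cut N (symX s)) :=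
  adm_cut N (measurable_symX s) (continuous_symJ (s + 1 / 2)) fun κ => by
    rw [abs_symX]; exact symX_le s κ

lemma enorm_cut {N : ℝ} {p : ℝ → ℝ} (hp : ∀ κ, 0 ≤ p κ) (ξ : ℝ) :
    ‖cut N p ξ‖ₑ = (Set.Icc (-N) N).indicator (fun ξ => ENNReal.ofReal (p (2 * Real.pi * ξ))) ξ := by
  unfold cut
  by_cases hξ : ξ ∈ Set.Icc (-N) N
  · rw [Set.indicator_of_mem hξ, Set.indicator_of_mem hξ, ← ofReal_norm, Complex.norm_real,
      Real.norm_of_nonneg (hp _)]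
  · rw [Set.indicator_of_notMem hξ, Set.indicator_of_notMem hξ]; simp

lemma enorm_cut_le {N : ℝ} {p : ℝ → ℝ} (hp : ∀ κ, 0 ≤ p κ) (ξ : ℝ) :
    ‖cut N p ξ‖ₑ ≤ ENNReal.ofReal (p (2 * Real.pi * ξ)) := by
  rw [enorm_cut hp]
  exact Set.indicator_le_self (Set.Icc (-N) N) (fun ξ => ENNReal.ofReal (p (2 * Real.pi * ξ))) ξ

/-- The squared norm of the truncation of `(f, g)` in `X ^ s`. -/
def energy (s N : ℝ) (f g : L2) : ℝ :=
  ‖mulOp (cut N (symJ s)) (hat f)‖ ^ 2 + ‖mulOp (cut N (symX s)) (hat g)‖ ^ 2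

lemma ofReal_norm_sq (F : LC) : ENNReal.ofReal (‖F‖ ^ 2) = ∫⁻ ξ, ‖F ξ‖ₑ ^ 2 := by
  rw [ENNReal.ofReal_pow (norm_nonneg _), ofReal_norm, Lp.enorm_def, eLpNorm_two, N2_sq]

lemma ofReal_norm_mulOp_cut {N : ℝ} {p : ℝ → ℝ} (hp : ∀ κ, 0 ≤ p κ) (hA : Adm (cut N p)) (f : L2) :
    ENNReal.ofReal (‖mulOp (cut N p) (hat f)‖ ^ 2) =
      ∫⁻ ξ in Set.Icc (-N) N, ‖multHat p f ξ‖ₑ ^ 2 := by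
  rw [ofReal_norm_sq, ← lintegral_indicator measurableSet_Icc]
  refine lintegral_congr_ae ?_
  filter_upwards [mulOp_ae hA (hat f)] with ξ h
  rw [h, enorm_mul, enorm_cut hp]
  by_cases hξ : ξ ∈ Set.Icc (-N) N
  · rw [Set.indicator_of_mem hξ, Set.indicator_of_mem hξ, enorm_multHat hp]
  · rw [Set.indicator_of_notMem hξ, Set.indicator_of_notMem hξ]; simp

lemma ofReal_multNorm_sq {m : ℝ → ℝ} {f : L2} (h : MemLp (multHat m f) 2 volume) :
    ENNReal.ofReal (multNorm m f ^ 2) = ∫⁻ ξ, ‖multHat m f ξ‖ₑ ^ 2 := by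
  rw [ENNReal.ofReal_pow (multNorm_nonneg _ _), MemLp.ofReal_multNorm h, eLpNorm_two, N2_sq]

lemma tendsto_norm_mulOp_cut {p : ℝ → ℝ} (hp : ∀ κ, 0 ≤ p κ) (hA : ∀ N, Adm (cut N p)) {f : L2}
    (hf : MemLp (multHat p f) 2 volume) :
    Tendsto (fun N : ℝ => ‖mulOp (cut N p) (hat f)‖ ^ 2) atTop (𝓝 (multNorm p f ^ 2)) := by
  have h := (aecover_Icc (μ := (volume : Measure ℝ)) tendsto_neg_atTop_atBot
    tendsto_id).lintegral_tendsto_of_countably_generated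
    (f := fun ξ => ‖multHat p f ξ‖ₑ ^ 2) (by exact hf.1.enorm.pow_const 2)
  rw [← ofReal_multNorm_sq hf] at h
  have h2 := (ENNReal.tendsto_toReal ENNReal.ofReal_ne_top).comp h
  rw [ENNReal.toReal_ofReal (by positivity)] at h2
  refine h2.congr fun N => ?_
  simp only [Function.comp, id]
  rw [← ofReal_norm_mulOp_cut hp (hA N), ENNReal.toReal_ofReal (by positivity)]

lemma norm_mulOp_cut_le {p : ℝ → ℝ} (hp : ∀ κ, 0 ≤ p κ) {N : ℝ} (hA : Adm (cut N p)) {f : L2}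
    (hf : MemLp (multHat p f) 2 volume) :
    ‖mulOp (cut N p) (hat f)‖ ^ 2 ≤ multNorm p f ^ 2 := by
  rw [← ENNReal.ofReal_le_ofReal_iff (by positivity), ofReal_norm_mulOp_cut hp hA,
    ofReal_multNorm_sq hf]
  exact setLIntegral_le_lintegral _ _

lemma tendsto_energy {s : ℝ} {f g : L2} (hf : MemH s f) (hg : MemH (s + 1 / 2) g) :
    Tendsto (fun N => energy s N f g) atTop (𝓝 (normX s f g ^ 2)) := by
  rw [normX_sq]
  exact (tendsto_norm_mulOp_cut (fun κ => (symJ_pos s κ).le) (fun N => adm_cut_symJ N s) hf).add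
    (tendsto_norm_mulOp_cut (fun κ => (symX_pos s κ).le) (fun N => adm_cut_symX N s) hg.symX)

lemma energy_le {s : ℝ} {f g : L2} (hf : MemH s f) (hg : MemH (s + 1 / 2) g) (N : ℝ) :
    energy s N f g ≤ normX s f g ^ 2 := by
  rw [normX_sq]
  exact add_le_add (norm_mulOp_cut_le (fun κ => (symJ_pos s κ).le) (adm_cut_symJ N s) hf)
    (norm_mulOp_cut_le (fun κ => (symX_pos s κ).le) (adm_cut_symX N s) hg.symX)

lemma hasDerivWithinAt_norm_sq {F : ℝ → LC} {F' : LC} {I : Set ℝ} {t : ℝ}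
    (h : HasDerivWithinAt F F' I t) :
    HasDerivWithinAt (fun τ => ‖F τ‖ ^ 2) (2 * (inner ℂ (F t) F').re) I t := by
  have h1 := h.inner ℂ h
  have h2 := Complex.reCLM.hasFDerivAt.comp_hasDerivWithinAt t h1
  have e : ∀ τ, ‖F τ‖ ^ 2 = (inner ℂ (F τ) (F τ)).re := fun τ => by
    rw [inner_self_eq_norm_sq_to_K]; norm_cast
  refine (h2.congr (fun τ _ => ?_) ?_).congr_deriv ?_
  · simp [e]
  · simp [e]
  · simp only [Complex.reCLM_apply, Complex.add_re]
    rw [← inner_conj_symm F' (F t), Complex.conj_re]; ring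

/-- The nonlinear contribution to the derivative of the energy. -/
def flux (s : ℝ) (f g : L2) : ℝ≥0∞ :=
  (∫⁻ ξ, jE (2 * s) ξ * (‖hat f ξ‖ₑ * ‖prodHat f g ξ‖ₑ)) +
    ∫⁻ ξ, jE (2 * s + 1) ξ * (‖hat g ξ‖ₑ * ‖prodHat g g ξ‖ₑ)

/-- The identity `K⁻² tanh κ = κ`: weighted by `K⁻¹` twice, `K²∂ₓ` becomes `∂ₓ`. Both the
cancellation of the linear terms and the cost of one derivative in `v²` rest on it. -/
lemma cut_sq_symT (N s ξ : ℝ) : cut N (symX s) ξ * (cut N (symX s) ξ * symT ξ) =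
    cut N (symJ s) ξ * (cut N (symJ s) ξ * symD ξ) := by
  unfold cut
  by_cases hξ : ξ ∈ Set.Icc (-N) N
  · rw [Set.indicator_of_mem hξ, Set.indicator_of_mem hξ]
    have h := symK_inv_sq_mul (2 * Real.pi * ξ)
    rw [symT, symD]
    simp only [symX]
    generalize 2 * Real.pi * ξ = κ at h
    have h' := congrArg (fun x : ℝ => (x : ℂ)) h
    push_cast at h' ⊢
    linear_combination (-Complex.I * (symJ s κ : ℂ) ^ 2) * h'
  · rw [Set.indicator_of_notMem hξ, Set.indicator_of_notMem hξ]; simp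

lemma conj_cut (N : ℝ) (p : ℝ → ℝ) (ξ : ℝ) : (starRingEnd ℂ) (cut N p ξ) = cut N p ξ := by
  unfold cut
  by_cases hξ : ξ ∈ Set.Icc (-N) N
  · rw [Set.indicator_of_mem hξ, Complex.conj_ofReal]
  · rw [Set.indicator_of_notMem hξ, map_zero]

lemma conj_symD (ξ : ℝ) : (starRingEnd ℂ) (symD ξ) = -symD ξ := by
  simp only [symD, map_mul, map_neg, Complex.conj_I, Complex.conj_ofReal]; ring

lemma conj_symT (ξ : ℝ) : (starRingEnd ℂ) (symT ξ) = -symT ξ := by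
  simp only [symT, map_mul, map_neg, Complex.conj_I, Complex.conj_ofReal]; ring

lemma enorm_symT_le (ξ : ℝ) : ‖symT ξ‖ₑ ≤ 1 := by
  rw [← ofReal_norm, symT, norm_mul, norm_neg, Complex.norm_I, one_mul, Complex.norm_real,
    Real.norm_eq_abs]
  exact ENNReal.ofReal_le_one.2 (abs_tanh_le_one _)

lemma enorm_symD_le (ξ : ℝ) : ‖symD ξ‖ₑ ≤ jE 1 ξ := by
  rw [← ofReal_norm, symD, norm_mul, norm_neg, Complex.norm_I, one_mul, Complex.norm_real,
    Real.norm_eq_abs]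
  exact ENNReal.ofReal_le_ofReal (abs_le_symJ_one _)

/-- The linear terms cancel in the derivative of the energy. -/
lemma linear_cancel (s N : ℝ) (a b : LC) :
    (inner ℂ (mulOp (cut N (symJ s)) a) (mulOp (fun ξ => cut N (symJ s) ξ * symD ξ) b)).re +
      (inner ℂ (mulOp (cut N (symX s)) b) (mulOp (fun ξ => cut N (symX s) ξ * symT ξ) a)).re = 0 := by
  have hJ := adm_cut_symJ N s
  have hX := adm_cut_symX N s
  have hJD := hJ.mul_continuous contDiff_symD.continuous
  have hXT := hX.mul_continuous contDiff_symT.continuous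
  -- The symbols agree by `cut_sq_symT` and are purely imaginary, so the second inner product is
  -- minus the conjugate of the first.
  have key : inner ℂ (mulOp (cut N (symX s)) b) (mulOp (fun ξ => cut N (symX s) ξ * symT ξ) a) =
      -inner ℂ (mulOp (fun ξ => cut N (symJ s) ξ * symD ξ) b) (mulOp (cut N (symJ s)) a) := by
    rw [L2.inner_def, L2.inner_def, ← integral_neg]
    refine integral_congr_ae ?_
    filter_upwards [mulOp_ae hJ a, mulOp_ae hX b, mulOp_ae hJD b, mulOp_ae hXT a] with ξ h1 h2 h3 h4
    rw [h1, h2, h3, h4, RCLike.inner_apply, RCLike.inner_apply, map_mul, map_mul, map_mul, conj_cut,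
      conj_cut, conj_symD]
    linear_combination (a ξ * (starRingEnd ℂ) (b ξ)) * cut_sq_symT N s ξ
  rw [key, Complex.neg_re, ← inner_conj_symm, Complex.conj_re, add_neg_cancel]

/-- As `|tanh| ≤ 1`, the nonlinearity `K²∂ₓ(ηv)` costs no derivative. -/
lemma enorm_inner_eta_le (s N : ℝ) (f g : L2) :
    ‖inner ℂ (mulOp (cut N (symJ s)) (hat f))
      (convOp (fun ξ => cut N (symJ s) ξ * symT ξ) (hat f) (hat g))‖ₑ ≤
      ∫⁻ ξ, jE (2 * s) ξ * (‖hat f ξ‖ₑ * ‖prodHat f g ξ‖ₑ) := by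
  have hJ := adm_cut_symJ N s
  have hJT := hJ.mul_continuous contDiff_symT.continuous
  refine (enorm_inner_le _ _).trans (lintegral_mono_ae ?_)
  filter_upwards [mulOp_ae hJ (hat f), convOp_ae hJT (hat f) (hat g)] with ξ h1 h2
  rw [h1, h2, enorm_mul, enorm_mul, enorm_mul, ← prodHat_eq_conv]
  have e1 : ‖cut N (symJ s) ξ‖ₑ ≤ jE s ξ := enorm_cut_le (fun κ => (symJ_pos s κ).le) ξ
  calc _ ≤ jE s ξ * ‖hat f ξ‖ₑ * (jE s ξ * 1 * ‖prodHat f g ξ‖ₑ) := by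
        gcongr; exact enorm_symT_le ξ
    _ = jE (2 * s) ξ * (‖hat f ξ‖ₑ * ‖prodHat f g ξ‖ₑ) := by
        rw [two_mul, ← jE_add]; ring

/-- The two factors `K⁻¹` undo `K²` in `K²∂ₓ`, so a full derivative remains and raises the weight to
`2 * s + 1`. -/
lemma enorm_inner_v_le (s N : ℝ) (g : L2) :
    ‖inner ℂ (mulOp (cut N (symX s)) (hat g))
      (convOp (fun ξ => cut N (symX s) ξ * symT ξ) (hat g) (hat g))‖ₑ ≤
      ∫⁻ ξ, jE (2 * s + 1) ξ * (‖hat g ξ‖ₑ * ‖prodHat g g ξ‖ₑ) := by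
  have hX := adm_cut_symX N s
  have hXT := hX.mul_continuous contDiff_symT.continuous
  refine (enorm_inner_le _ _).trans (lintegral_mono_ae ?_)
  filter_upwards [mulOp_ae hX (hat g), convOp_ae hXT (hat g) (hat g)] with ξ h1 h2
  rw [h1, h2, ← prodHat_eq_conv]
  have e1 : ‖cut N (symJ s) ξ‖ₑ ≤ jE s ξ := enorm_cut_le (fun κ => (symJ_pos s κ).le) ξ
  calc ‖cut N (symX s) ξ * hat g ξ‖ₑ * ‖cut N (symX s) ξ * symT ξ * prodHat g g ξ‖ₑ
      = ‖cut N (symX s) ξ * (cut N (symX s) ξ * symT ξ)‖ₑ * (‖hat g ξ‖ₑ * ‖prodHat g g ξ‖ₑ) := by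
        simp only [enorm_mul]; ring
    _ ≤ jE s ξ * (jE s ξ * jE 1 ξ) * (‖hat g ξ‖ₑ * ‖prodHat g g ξ‖ₑ) := by
        rw [cut_sq_symT, enorm_mul, enorm_mul]
        gcongr; exact enorm_symD_le ξ
    _ = _ := by rw [two_mul, ← jE_add, ← jE_add]; ring

variable {s : ℝ} {I : Set ℝ} {η v : ℝ → L2}

lemma IsSolution.hasDeriv_energy (hs : 0 ≤ s) (hI : I.OrdConnected) (hu : IsSolution s I η v)
    (N : ℝ) {t : ℝ} (ht : t ∈ I) {M : ℝ} (hM : 0 ≤ M)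
    (hflux : flux s (η t) (v t) ≤ ENNReal.ofReal M) :
    ∃ E', HasDerivWithinAt (fun τ => energy s N (η τ) (v τ)) E' I t ∧ E' ≤ 2 * (2 * M) := by
  have h1 := hasDerivWithinAt_norm_sq (hu.hasDeriv hs hI (adm_cut_symJ N s) ht).1
  have h2 := hasDerivWithinAt_norm_sq (hu.hasDeriv hs hI (adm_cut_symX N s) ht).2
  refine ⟨_, h1.add h2, ?_⟩
  rw [dEta, dV, inner_add_right, inner_add_right, inner_smul_right_eq_smul, Complex.add_re,
    Complex.add_re, Complex.real_smul, Complex.re_ofReal_mul]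
  have h3 := linear_cancel s N (hat (η t)) (hat (v t))
  have h4 := re_le_of_enorm_le hM
    ((enorm_inner_eta_le s N (η t) (v t)).trans (le_self_add.trans hflux))
  have h5 := re_le_of_enorm_le hM
    ((enorm_inner_v_le s N (v t)).trans (le_add_self.trans hflux))
  linarith

/-- The truncated energy inequality is integrated in time. Its right-hand side is bounded by full
norms, uniformly in `N`, so `N → ∞` is needed only on the left. `gronwall_sqrt` removes the squares.
-/
lemma IsSolution.normX_le (hs : 0 ≤ s) (hI : I.OrdConnected) (h0 : 0 ∈ I)
    (hu : IsSolution s I η v) {k : ℝ → ℝ} (hk : ContinuousOn k I) (hk0 : ∀ t ∈ I, 0 ≤ k t)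
    (hflux : ∀ t ∈ I, flux s (η t) (v t) ≤ ENNReal.ofReal (k t * normX s (η t) (v t) ^ 2))
    {t : ℝ} (ht : t ∈ I) (ht0 : 0 ≤ t) :
    normX s (η t) (v t) ≤ normX s (η 0) (v 0) +
      ∫ τ in (0 : ℝ)..t, 2 * k τ * normX s (η τ) (v τ) := by
  have hsub : ∀ r ∈ Set.Icc 0 t, Set.Icc 0 r ⊆ I := fun r hr =>
    hI.out h0 (hI.out h0 ht hr)
  have hX := hu.continuousOn_normX
  refine gronwall_sqrt ht0 (normX_nonneg _ _ _) (hX.mono (hI.out h0 ht))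
    ((hk.const_mul 2).mono (hI.out h0 ht) |>.congr fun _ _ => rfl) (fun r _ => normX_nonneg _ _ _)
    (fun r hr => mul_nonneg zero_le_two (hk0 r (hI.out h0 ht hr))) fun r hr => ?_
  have hrI : r ∈ I := hI.out h0 ht hr
  refine le_of_tendsto (tendsto_energy (hu.mem_eta r hrI) (hu.mem_v r hrI))
    (Eventually.of_forall fun N => ?_)
  have hder : ∀ τ ∈ I, ∃ E', HasDerivWithinAt (fun τ => energy s N (η τ) (v τ)) E' I τ ∧
      E' ≤ 2 * (2 * k τ * normX s (η τ) (v τ) ^ 2) := fun τ hτ => by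
    obtain ⟨E', h1, h2⟩ := hu.hasDeriv_energy hs hI N hτ
      (mul_nonneg (hk0 τ hτ) (sq_nonneg _)) (hflux τ hτ)
    exact ⟨E', h1, h2.trans_eq (by ring)⟩
  choose! E' hE' hE'le using hder
  have key := sub_le_integral (f := fun τ => energy s N (η τ) (v τ)) (f' := E')
    (M := fun τ => 2 * (2 * k τ * normX s (η τ) (v τ) ^ 2)) hr.1
    (fun τ hτ => (hE' τ (hsub r hr hτ)).continuousWithinAt.mono (hsub r hr))
    (fun τ hτ => (hE' τ (hsub r hr (Set.Ioo_subset_Icc_self hτ))).hasDerivAt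
      (mem_of_superset (Icc_mem_nhds hτ.1 hτ.2) (hsub r hr)))
    (continuousOn_const.mul ((continuousOn_const.mul (hk.mono (hsub r hr))).mul
      ((hX.mono (hsub r hr)).pow 2)))
    (fun τ hτ => hE'le τ (hsub r hr (Set.Ioo_subset_Icc_self hτ)))
  have := energy_le (hu.mem_eta 0 h0) (hu.mem_v 0 h0) N
  linarith

/-! ### Convolution estimates for `s ≥ 1/2` -/

/-- The modulus of the Fourier transform. -/
def aHat (f : L2) (ξ : ℝ) : ℝ≥0∞ := ‖hat f ξ‖ₑ

lemma measurable_aHat (f : L2) : Measurable (aHat f) :=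
  (Lp.stronglyMeasurable (hat f)).measurable.enorm

lemma enorm_prodHat_le (f g : L2) (ξ : ℝ) : ‖prodHat f g ξ‖ₑ ≤ convE (aHat f) (aHat g) ξ := by
  rw [prodHat_eq_conv]; exact enorm_conv_le _ _ ξ

lemma lintegral_mul_convE {F A B : ℝ → ℝ≥0∞} (hA : Measurable A) (hB : Measurable B) :
    ∫⁻ ξ, F ξ * convE A B ξ = tri (fun _ _ => 1) F A B := by
  unfold tri convE
  congr 1; ext ξ
  rw [← lintegral_const_mul _ (by fun_prop)]
  congr 1; ext ζ; ring

lemma tri_one_comm {F A B : ℝ → ℝ≥0∞} (hA : Measurable A) (hB : Measurable B) :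
    tri (fun _ _ => 1) F A B = tri (fun _ _ => 1) F B A := by
  rw [← lintegral_mul_convE hA hB, ← lintegral_mul_convE hB hA]
  simp_rw [convE_comm A B]

/-- A fractional Leibniz rule for moduli: the bracket of a sum of frequencies is at most a constant
times the sum of the brackets, so the weight falls on one factor or the other. -/
lemma lintegral_weight_convE_le {s : ℝ} (hs : 0 ≤ s) {F A B : ℝ → ℝ≥0∞} (hF : Measurable F)
    (hA : Measurable A) (hB : Measurable B) :
    ∫⁻ ξ, jE s ξ * (F ξ * convE A B ξ) ≤ ENNReal.ofReal (2 ^ s) *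
      (tri (fun _ _ => 1) F (fun ζ => jE s ζ * A ζ) B +
        tri (fun _ _ => 1) F A (fun ζ => jE s ζ * B ζ)) := by
  have hj := measurable_jE s
  have hjA : Measurable fun ζ => jE s ζ * A ζ := hj.mul hA
  have hjB : Measurable fun ζ => jE s ζ * B ζ := hj.mul hB
  have m1 : Measurable fun ξ => F ξ * convE (fun ζ => jE s ζ * A ζ) B ξ :=
    hF.mul (measurable_convE hjA hB)
  have m2 : Measurable fun ξ => F ξ * convE A (fun ζ => jE s ζ * B ζ) ξ :=
    hF.mul (measurable_convE hA hjB)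
  rw [← lintegral_mul_convE hjA hB, ← lintegral_mul_convE hA hjB,
    ← lintegral_add_left m1, ← lintegral_const_mul _ (by fun_prop)]
  refine lintegral_mono fun ξ => ?_
  have key : jE s ξ * convE A B ξ ≤ ENNReal.ofReal (2 ^ s) *
      (convE (fun ζ => jE s ζ * A ζ) B ξ + convE A (fun ζ => jE s ζ * B ζ) ξ) := by
    unfold convE
    rw [← lintegral_add_left (by fun_prop), ← lintegral_const_mul _ (by fun_prop),
      ← lintegral_const_mul _ (by fun_prop)]
    refine lintegral_mono fun ζ => ?_
    calc jE s ξ * (A ζ * B (ξ - ζ))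
        ≤ ENNReal.ofReal (2 ^ s) * (jE s ζ + jE s (ξ - ζ)) * (A ζ * B (ξ - ζ)) := by
          gcongr; exact jE_le_add hs ξ ζ
      _ = _ := by ring
  calc jE s ξ * (F ξ * convE A B ξ) = F ξ * (jE s ξ * convE A B ξ) := by ring
    _ ≤ F ξ * (ENNReal.ofReal (2 ^ s) *
        (convE (fun ζ => jE s ζ * A ζ) B ξ + convE A (fun ζ => jE s ζ * B ζ) ξ)) := by gcongr
    _ = _ := by ring

lemma measurable_jE_comp (r : ℝ) {φ : ℝ × ℝ → ℝ} (hφ : Measurable φ) :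
    Measurable fun p => jE r (φ p) := (measurable_jE r).comp hφ

/-- More than half a derivative on `B` makes it integrable, and Young's inequality applies. The
threshold `3 / 4` lets the single constant `c32` serve. -/
lemma tri_one_le_low {r : ℝ} (hr : 3 / 4 ≤ r) {F A B : ℝ → ℝ≥0∞} (hF : Measurable F)
    (hA : Measurable A) (hB : Measurable B) :
    tri (fun _ _ => 1) F A B ≤
      c32 ^ (1 / 2 : ℝ) * (N2 F * N2 A * N2 fun ζ => jE r ζ * B ζ) := by
  have hj := measurable_jE r
  refine (tri_mono (K' := fun ξ ζ => jE (-r) (ξ - ζ)) (f' := F) (g' := A)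
    (h' := fun θ => jE r θ * B θ) fun ξ ζ => le_of_eq ?_).trans
    (tri_le_snd (measurable_jE_comp _ (by fun_prop)) hF hA (hj.mul hB) fun ζ => ?_)
  · have := jE_neg_mul r (ξ - ζ)
    calc 1 * (F ξ * A ζ * B (ξ - ζ)) =
        (jE (-r) (ξ - ζ) * jE r (ξ - ζ)) * (F ξ * A ζ * B (ξ - ζ)) := by rw [this]
      _ = _ := by ring
  · rw [lintegral_sub_right_eq_self (fun ξ => jE (-r) ξ ^ 2) ζ]
    refine lintegral_mono fun ξ => ?_
    rw [jE_pow_two]; exact jE_mono (by linarith) ξ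

/-- The regularity is divided between the two convolved factors, at least `1/2` and `1/4`, which
together exceed the required `1/2`. -/
lemma tri_one_le_mix {s : ℝ} (hs : 1 / 2 ≤ s) {F A B : ℝ → ℝ≥0∞} (hF : Measurable F)
    (hA : Measurable A) (hB : Measurable B) :
    tri (fun _ _ => 1) F A B ≤ (2 * c32) ^ (1 / 2 : ℝ) *
      (N2 F * (N2 fun ζ => jE s ζ * A ζ) * N2 fun ζ => jE (1 / 4) ζ * B ζ) := by
  have hj := measurable_jE s
  have hj' := measurable_jE (1 / 4)
  refine (tri_mono (K' := fun ξ ζ => jE (-s) ζ * jE (-(1 / 4)) (ξ - ζ)) (f' := F)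
    (g' := fun ζ => jE s ζ * A ζ)
    (h' := fun θ => jE (1 / 4) θ * B θ) fun ξ ζ => le_of_eq ?_).trans
    (tri_le_fst ((measurable_jE_comp _ (by fun_prop)).mul (measurable_jE_comp _ (by fun_prop)))
      hF (hj.mul hA) (hj'.mul hB) fun ξ => ?_)
  · have h1 := jE_neg_mul s ζ
    have h2 := jE_neg_mul (1 / 4) (ξ - ζ)
    calc 1 * (F ξ * A ζ * B (ξ - ζ)) =
        (jE (-s) ζ * jE s ζ) * (jE (-(1 / 4)) (ξ - ζ) * jE (1 / 4) (ξ - ζ)) *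
          (F ξ * A ζ * B (ξ - ζ)) := by rw [h1, h2]; ring
      _ = _ := by ring
  · refine (lintegral_mono fun ζ => ?_).trans (lintegral_jE_mul_le' ξ)
    rw [mul_pow, jE_pow_two, jE_pow_two]
    gcongr
    · exact jE_mono (by linarith) ζ
    · exact jE_mono (by norm_num) _

/-! ### Norms -/

lemma N2_jE_aHat {s : ℝ} {f : L2} (hf : MemH s f) :
    N2 (fun ξ => jE s ξ * aHat f ξ) = ENNReal.ofReal (normH s f) := by
  rw [normH, MemLp.ofReal_multNorm hf, eLpNorm_two]
  congr 1; ext ξ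
  rw [enorm_multHat fun κ => (symJ_pos s κ).le]; rfl

lemma N2_aHat (f : L2) : N2 (aHat f) = ENNReal.ofReal ‖f‖ := by
  have := N2_jE_aHat (memH_zero f)
  simpa [jE_zero, normH_zero] using this

/-- By the Leibniz rule `s` derivatives fall on `η` or on `v`. In the first case `v` has `s + 1/4 ≥
3/4` derivatives to spare and `tri_one_le_low` applies. In the second `η` keeps `s ≥ 1/2` and `J^s
v` uses another `1/4`, which is `tri_one_le_mix`. In `v²` both cases are of the first kind by
symmetry, now with `s + 1/2` derivatives to distribute. -/
lemma exists_flux_le_of_half_le {s : ℝ} (hs : 1 / 2 ≤ s) : ∃ C : ℝ, 0 < C ∧ ∀ f g : L2,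
    MemH s f → MemH (s + 1 / 2) g →
    flux s f g ≤ ENNReal.ofReal (C * normH (s + 1 / 4) g * normX s f g ^ 2) := by
  set c : ℝ≥0∞ := (2 * c32) ^ (1 / 2 : ℝ) with hc
  have hctop : c ≠ ∞ := ENNReal.rpow_ne_top_of_nonneg (by norm_num)
    (ENNReal.mul_ne_top (by norm_num) c32_lt_top.ne)
  have hcle : c32 ^ (1 / 2 : ℝ) ≤ c := by
    rw [hc]; gcongr; rw [two_mul]; exact le_self_add
  set D : ℝ≥0∞ := ENNReal.ofReal (2 ^ s) * (c + c) + ENNReal.ofReal (2 ^ (s + 1 / 2)) * (c + c) * 4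
    with hD
  have hDtop : D ≠ ∞ := by
    have h4 : (4 : ℝ≥0∞) ≠ ∞ := by norm_num
    rw [hD]
    exact ENNReal.add_ne_top.2 ⟨ENNReal.mul_ne_top ENNReal.ofReal_ne_top
      (ENNReal.add_ne_top.2 ⟨hctop, hctop⟩), ENNReal.mul_ne_top (ENNReal.mul_ne_top
        ENNReal.ofReal_ne_top (ENNReal.add_ne_top.2 ⟨hctop, hctop⟩)) h4⟩
  refine ⟨D.toReal + 1, by positivity, fun f g hf hg => ?_⟩
  have hA := measurable_aHat f
  have hB := measurable_aHat g
  have hj := measurable_jE s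
  have hjr := measurable_jE (s + 1 / 2)
  have hjA : Measurable fun ξ => jE s ξ * aHat f ξ := hj.mul hA
  have hjB : Measurable fun ξ => jE s ξ * aHat g ξ := hj.mul hB
  have hjrB : Measurable fun ξ => jE (s + 1 / 2) ξ * aHat g ξ := hjr.mul hB
  set X := ENNReal.ofReal (normX s f g) with hX
  set V := ENNReal.ofReal (normH (s + 1 / 4) g) with hV
  have n1 : N2 (fun ξ => jE s ξ * aHat f ξ) ≤ X := by
    rw [N2_jE_aHat hf]; exact ENNReal.ofReal_le_ofReal (normH_le_normX s f g)
  have n2 : N2 (fun ξ => jE (s + 1 / 2) ξ * aHat g ξ) ≤ 2 * X := by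
    rw [N2_jE_aHat hg, hX, show (2 : ℝ≥0∞) = ENNReal.ofReal 2 by simp,
      ← ENNReal.ofReal_mul (by norm_num)]
    exact ENNReal.ofReal_le_ofReal (normH_half_le_normX hg f)
  have n3 : N2 (fun ξ => jE (s + 1 / 4) ξ * aHat g ξ) = V := N2_jE_aHat (hg.mono (by linarith))
  have n4 : N2 (fun ξ => jE (1 / 4) ξ * (jE s ξ * aHat g ξ)) = V := by
    rw [← n3]; congr 1; ext ξ; rw [← mul_assoc, jE_add, add_comm]
  have e1 : ∫⁻ ξ, jE (2 * s) ξ * (‖hat f ξ‖ₑ * ‖prodHat f g ξ‖ₑ) ≤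
      ENNReal.ofReal (2 ^ s) * (c + c) * (V * X ^ 2) := by
    calc _ ≤ ∫⁻ ξ, jE s ξ * (jE s ξ * aHat f ξ * convE (aHat f) (aHat g) ξ) := by
          refine lintegral_mono fun ξ => ?_
          have := enorm_prodHat_le f g ξ
          rw [two_mul, ← jE_add]
          calc _ ≤ jE s ξ * jE s ξ * (aHat f ξ * convE (aHat f) (aHat g) ξ) := by
                gcongr; exact le_rfl
            _ = _ := by ring
      _ ≤ _ := lintegral_weight_convE_le (by linarith) hjA hA hB
      _ ≤ ENNReal.ofReal (2 ^ s) * (c * (X * X * V) + c * (X * X * V)) := by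
          gcongr
          · refine (tri_one_le_low (r := s + 1 / 4) (by linarith) hjA hjA hB).trans ?_
            rw [n3]; gcongr
          · refine (tri_one_le_mix hs hjA hA hjB).trans ?_
            rw [n4]; gcongr
      _ = _ := by ring
  have e2 : ∫⁻ ξ, jE (2 * s + 1) ξ * (‖hat g ξ‖ₑ * ‖prodHat g g ξ‖ₑ) ≤
      ENNReal.ofReal (2 ^ (s + 1 / 2)) * (c + c) * 4 * (V * X ^ 2) := by
    have hlow := (tri_one_le_low (r := s + 1 / 4) (by linarith) hjrB hjrB hB).trans
      (show _ ≤ c * (2 * X * (2 * X) * V) by rw [n3]; gcongr)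
    calc _ ≤ ∫⁻ ξ, jE (s + 1 / 2) ξ *
          (jE (s + 1 / 2) ξ * aHat g ξ * convE (aHat g) (aHat g) ξ) := by
          refine lintegral_mono fun ξ => ?_
          have := enorm_prodHat_le g g ξ
          rw [show 2 * s + 1 = (s + 1 / 2) + (s + 1 / 2) by ring, ← jE_add]
          calc _ ≤ jE (s + 1 / 2) ξ * jE (s + 1 / 2) ξ *
                (aHat g ξ * convE (aHat g) (aHat g) ξ) := by
                gcongr; exact le_rfl
            _ = _ := by ring
      _ ≤ _ := lintegral_weight_convE_le (by linarith) hjrB hB hB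
      _ ≤ ENNReal.ofReal (2 ^ (s + 1 / 2)) *
          (c * (2 * X * (2 * X) * V) + c * (2 * X * (2 * X) * V)) := by
          refine mul_le_mul_right ?_ _
          rw [tri_one_comm hB hjrB]; exact add_le_add hlow hlow
      _ = _ := by ring
  calc flux s f g ≤ D * (V * X ^ 2) := by
        rw [hD, add_mul]; exact add_le_add e1 e2
    _ = ENNReal.ofReal (D.toReal * normH (s + 1 / 4) g * normX s f g ^ 2) := by
        rw [mul_assoc, ENNReal.ofReal_mul ENNReal.toReal_nonneg, ENNReal.ofReal_toReal hDtop,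
          ENNReal.ofReal_mul (normH_nonneg _ _), ENNReal.ofReal_pow (normX_nonneg _ _ _)]
    _ ≤ _ := by
        refine ENNReal.ofReal_le_ofReal ?_
        have := normH_nonneg (s + 1 / 4) g
        gcongr; linarith

/-! ### Scale invariant integrals -/

lemma lintegral_scale {f : ℝ → ℝ≥0∞} (hf : Measurable f) {c : ℝ} (hc : c ≠ 0) :
    ∫⁻ x, f (c * x) = ENNReal.ofReal |c|⁻¹ * ∫⁻ x, f x := by
  have h := lintegral_map (μ := volume) hf (measurable_const_mul c)
  rw [Real.map_volume_mul_left hc, lintegral_smul_measure, abs_inv] at h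
  exact h.symm

lemma lintegral_eq_of_scale {f g : ℝ → ℝ≥0∞} (hf : Measurable f) {c A : ℝ} (hc : c ≠ 0) (hA : 0 ≤ A)
    (h : ∀ x, x ≠ 0 → g x = ENNReal.ofReal A * f (c * x)) :
    ∫⁻ x, g x = ENNReal.ofReal (A * |c|⁻¹) * ∫⁻ x, f x := by
  have h1 : ∫⁻ x, g x = ∫⁻ x, ENNReal.ofReal A * f (c * x) := by
    refine lintegral_congr_ae ?_
    filter_upwards [Measure.ae_ne volume (0 : ℝ)] with x hx using h x hx
  rw [h1, lintegral_const_mul _ (by fun_prop), lintegral_scale hf hc, ENNReal.ofReal_mul hA, mul_assoc]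

lemma lintegral_abs_eq {G : ℝ → ℝ≥0∞} :
    ∫⁻ x, G |x| = 2 * ∫⁻ x in Set.Ioi (0 : ℝ), G x := by
  have e1 : ∫⁻ x in Set.Ioi (0 : ℝ), G |x| = ∫⁻ x in Set.Ioi (0 : ℝ), G x :=
    setLIntegral_congr_fun measurableSet_Ioi fun x hx => by
      show G |x| = G x
      rw [abs_of_pos (show 0 < x from hx)]
  have e2 : ∫⁻ x in Set.Iio (0 : ℝ), G |x| = ∫⁻ x in Set.Ioi (0 : ℝ), G |x| := by
    rw [← lintegral_indicator measurableSet_Iio, ← lintegral_indicator measurableSet_Ioi,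
      ← lintegral_neg_eq_self (μ := volume)]
    congr 1; ext x
    by_cases hx : 0 < x
    · rw [Set.indicator_of_mem (show -x ∈ Set.Iio 0 by simpa using hx),
        Set.indicator_of_mem (show x ∈ Set.Ioi 0 from hx), abs_neg]
    · rw [Set.indicator_of_notMem (show -x ∉ Set.Iio 0 by simpa using hx),
        Set.indicator_of_notMem (show x ∉ Set.Ioi 0 from hx)]
  rw [← lintegral_add_compl _ (measurableSet_Iio (a := (0 : ℝ))), Set.compl_Iio,
    setLIntegral_congr Ioi_ae_eq_Ici.symm, e2, e1, two_mul]

lemma lintegral_lt_top_of_le_rpow {f : ℝ → ℝ} {C a b : ℝ} (ha : -1 < a) (hb : b < -1)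
    (h0 : ∀ u, u ≠ 0 → |u| ≤ 1 → f u ≤ C * |u| ^ a)
    (h1 : ∀ u, 1 < |u| → f u ≤ C * |u| ^ b) : ∫⁻ u, ENNReal.ofReal (f u) < ∞ := by
  have i0 : IntegrableOn (fun x : ℝ => C * x ^ a) (Set.Ioc 0 1) :=
    ((intervalIntegrable_iff_integrableOn_Ioc_of_le zero_le_one).1
      (intervalIntegral.intervalIntegrable_rpow' ha)).const_mul C
  have i1 : IntegrableOn (fun x : ℝ => C * x ^ b) (Set.Ioi 1) :=
    (integrableOn_Ioi_rpow_of_lt hb zero_lt_one).const_mul C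
  set G : ℝ → ℝ≥0∞ := fun x => if x ≤ 1 then ENNReal.ofReal (C * x ^ a) else ENNReal.ofReal (C * x ^ b)
  have hle : ∫⁻ u, ENNReal.ofReal (f u) ≤ ∫⁻ u, G |u| := by
    refine lintegral_mono_ae ?_
    filter_upwards [Measure.ae_ne volume (0 : ℝ)] with u hu
    by_cases h : |u| ≤ 1
    · simp only [G, if_pos h]; exact ENNReal.ofReal_le_ofReal (h0 u hu h)
    · simp only [G, if_neg h]; exact ENNReal.ofReal_le_ofReal (h1 u (not_le.1 h))
  refine hle.trans_lt ?_
  rw [lintegral_abs_eq]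
  refine ENNReal.mul_lt_top (by norm_num) ?_
  rw [← Set.Ioc_union_Ioi_eq_Ioi (zero_le_one (α := ℝ)),
    lintegral_union measurableSet_Ioi Set.Ioc_disjoint_Ioi_same]
  refine ENNReal.add_lt_top.2 ⟨?_, ?_⟩
  · rw [setLIntegral_congr_fun measurableSet_Ioc fun x hx => show G x = ENNReal.ofReal (C * x ^ a) from if_pos hx.2]
    exact i0.lintegral_lt_top
  · rw [setLIntegral_congr_fun measurableSet_Ioi
      fun x hx => show G x = ENNReal.ofReal (C * x ^ b) from if_neg (not_le.2 hx)]
    exact i1.lintegral_lt_top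

/-- The modulus of `exp (2πiu) - 1`. -/
def osc (u : ℝ) : ℝ := ‖(𝐞 u : ℂ) - 1‖

lemma osc_nonneg (u : ℝ) : 0 ≤ osc u := norm_nonneg _

lemma continuous_osc : Continuous osc := by
  unfold osc
  have := continuous_char 1
  simp only [one_mul] at this
  fun_prop

lemma osc_le_two (u : ℝ) : osc u ≤ 2 := by
  refine (norm_sub_le _ _).trans ?_
  rw [Circle.norm_coe, norm_one]; norm_num

lemma osc_le (u : ℝ) : osc u ≤ 2 * Real.pi * |u| := by
  unfold osc
  rw [Real.fourierChar_apply, mul_comm _ Complex.I]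
  refine (Real.norm_exp_I_mul_ofReal_sub_one_le).trans_eq ?_
  rw [Real.norm_eq_abs, abs_mul, abs_of_pos (by positivity)]

lemma osc_sq_le (u : ℝ) : osc u ^ 2 ≤ 4 := by
  nlinarith [osc_le_two u, osc_nonneg u]

lemma osc_sq_le' (u : ℝ) : osc u ^ 2 ≤ 4 * Real.pi ^ 2 * |u| ^ 2 := by
  calc osc u ^ 2 ≤ (2 * Real.pi * |u|) ^ 2 := by gcongr; exacts [osc_nonneg u, osc_le u]
    _ = _ := by ring

lemma four_le : (4 : ℝ) ≤ 4 * Real.pi ^ 2 := by nlinarith [Real.pi_gt_three]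

/-- The constant of the Gagliardo seminorm. -/
def cG (σ : ℝ) : ℝ≥0∞ := ∫⁻ u, ENNReal.ofReal (|u| ^ (-1 - 2 * σ) * osc u ^ 2)

lemma cG_lt_top {σ : ℝ} (h0 : 0 < σ) (h1 : σ < 1) : cG σ < ∞ := by
  refine lintegral_lt_top_of_le_rpow (C := 4 * Real.pi ^ 2) (a := 1 - 2 * σ) (b := -1 - 2 * σ)
    (by linarith) (by linarith) (fun u hu _ => ?_) fun u hu => ?_
  · have hu' := abs_pos.2 hu
    calc |u| ^ (-1 - 2 * σ) * osc u ^ 2 ≤ |u| ^ (-1 - 2 * σ) * (4 * Real.pi ^ 2 * |u| ^ 2) := by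
          gcongr; exact osc_sq_le' u
      _ = 4 * Real.pi ^ 2 * (|u| ^ (-1 - 2 * σ) * |u| ^ (2 : ℝ)) := by
          rw [Real.rpow_two]; ring
      _ = _ := by rw [← Real.rpow_add hu']; congr 2; ring
  · rw [mul_comm]
    gcongr
    exact (osc_sq_le u).trans four_le

/-- Needed to divide by `cG`. For `u` between `1/4` and `1/2` the angle `2πu` has nonpositive
cosine, so `osc u ≥ 1`. -/
lemma cG_pos {σ : ℝ} (h0 : 0 < σ) : 0 < cG σ := by
  have h : ∀ u ∈ Set.Ioo (1 / 4 : ℝ) (1 / 2), (1 : ℝ≥0∞) ≤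
      ENNReal.ofReal (|u| ^ (-1 - 2 * σ) * osc u ^ 2) := by
    intro u hu
    rw [ENNReal.one_le_ofReal]
    have hu0 : 0 < u := by linarith [hu.1]
    rw [abs_of_pos hu0]
    have h1 : 1 ≤ u ^ (-1 - 2 * σ) :=
      Real.one_le_rpow_of_pos_of_le_one_of_nonpos hu0 (by linarith [hu.2]) (by linarith)
    have h2 : 1 ≤ osc u := by
      have hcos : Real.cos (2 * Real.pi * u) ≤ 0 := by
        refine Real.cos_nonpos_of_pi_div_two_le_of_le ?_ ?_ <;>
        nlinarith [Real.pi_pos, hu.1, hu.2]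
      have h3 := Complex.abs_re_le_norm ((𝐞 u : ℂ) - 1)
      have h4 : ((𝐞 u : ℂ) - 1).re = Real.cos (2 * Real.pi * u) - 1 := by
        rw [Real.fourierChar_apply, Complex.sub_re, Complex.exp_ofReal_mul_I_re, Complex.one_re]
      rw [h4, abs_of_nonpos (by linarith)] at h3
      unfold osc; linarith
    nlinarith
  calc (0 : ℝ≥0∞) < ENNReal.ofReal (1 / 4) := by simp
    _ = ∫⁻ _ in Set.Ioo (1 / 4 : ℝ) (1 / 2), 1 := by
        rw [setLIntegral_one, Real.volume_Ioo]; norm_num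
    _ ≤ ∫⁻ u in Set.Ioo (1 / 4 : ℝ) (1 / 2), ENNReal.ofReal (|u| ^ (-1 - 2 * σ) * osc u ^ 2) :=
        setLIntegral_mono' measurableSet_Ioo h
    _ ≤ _ := setLIntegral_le_lintegral _ _

lemma lintegral_osc {σ ξ : ℝ} (hξ : ξ ≠ 0) :
    ∫⁻ h, ENNReal.ofReal (|h| ^ (-1 - 2 * σ) * osc (h * ξ) ^ 2) =
      ENNReal.ofReal (|ξ| ^ (2 * σ)) * cG σ := by
  have hm : Measurable fun u : ℝ => ENNReal.ofReal (|u| ^ (-1 - 2 * σ) * osc u ^ 2) := by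
    have := continuous_osc.measurable; fun_prop
  have hξ' := abs_pos.2 hξ
  rw [lintegral_eq_of_scale hm (c := ξ) (A := |ξ| ^ (1 + 2 * σ)) hξ (by positivity) fun h hh => ?_]
  · rw [cG]; congr 2
    rw [← Real.rpow_neg_one, ← Real.rpow_add hξ']; congr 1; ring
  · rw [← ENNReal.ofReal_mul (by positivity), abs_mul, Real.mul_rpow hξ'.le (abs_nonneg h),
      mul_comm ξ h]
    congr 1
    have : |ξ| ^ (1 + 2 * σ) * |ξ| ^ (-1 - 2 * σ) = 1 := by
      rw [← Real.rpow_add hξ']; simp [show 1 + 2 * σ + (-1 - 2 * σ) = 0 by ring]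
    linear_combination (-(|h| ^ (-1 - 2 * σ) * osc (h * ξ) ^ 2)) * this

/-! ### The Gagliardo seminorm -/

lemma enorm_sq_eq (p : L2) : ‖p‖ₑ ^ 2 = ∫⁻ x, ‖p x‖ₑ ^ 2 := by
  rw [Lp.enorm_def, eLpNorm_eq_lintegral_rpow_enorm_toReal (by norm_num) (by norm_num)]
  simp only [ENNReal.toReal_ofNat, ENNReal.rpow_ofNat]
  exact ENNReal.rpow_half_sq _

lemma enorm_sq_eq_aHat (p : L2) : ‖p‖ₑ ^ 2 = ∫⁻ ξ, aHat p ξ ^ 2 := by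
  rw [← enorm_norm, ← norm_hat, enorm_norm, Lp.enorm_def, eLpNorm_two, N2_sq]; rfl

lemma aHat_translate_sub (h : ℝ) (p : L2) :
    aHat (translate h p - p) =ᵐ[volume] fun ξ => ENNReal.ofReal (osc (h * ξ)) * aHat p ξ := by
  unfold aHat
  rw [hat_sub]
  filter_upwards [Lp.coeFn_sub (hat (translate h p)) (hat p), hat_translate h p] with ξ h1 h2
  rw [h1, Pi.sub_apply, h2, osc, ofReal_norm, ← enorm_mul]
  congr 1; ring

lemma enorm_translate_sub_sq (h : ℝ) (p : L2) : ‖translate h p - p‖ₑ ^ 2 =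
    ∫⁻ ξ, ENNReal.ofReal (osc (h * ξ) ^ 2) * aHat p ξ ^ 2 := by
  rw [enorm_sq_eq_aHat]
  refine lintegral_congr_ae ?_
  filter_upwards [aHat_translate_sub h p] with ξ hξ
  rw [hξ, mul_pow, ENNReal.ofReal_pow (osc_nonneg _)]

lemma enorm_translate_sub_sq' (h : ℝ) (p : L2) : ‖translate h p - p‖ₑ ^ 2 =
    ∫⁻ x, ‖p (x + h) - p x‖ₑ ^ 2 := by
  rw [enorm_sq_eq]
  refine lintegral_congr_ae ?_
  filter_upwards [Lp.coeFn_sub (translate h p) p, translate_ae h p] with x h1 h2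
  rw [h1, Pi.sub_apply, h2]

lemma measurable_osc_mul : Measurable fun p : ℝ × ℝ => osc (p.1 * p.2) :=
  continuous_osc.measurable.comp (by fun_prop)

lemma measurable_translate_sub (p : L2) : Measurable fun h => ‖translate h p - p‖ₑ ^ 2 := by
  simp_rw [enorm_translate_sub_sq]
  refine Measurable.lintegral_prod_right'
    (f := fun q : ℝ × ℝ => ENNReal.ofReal (osc (q.1 * q.2) ^ 2) * aHat p q.2 ^ 2) ?_
  have h1 := measurable_osc_mul
  have h2 := measurable_aHat p
  fun_prop

/-- The Gagliardo seminorm. -/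
def gag (σ : ℝ) (p : L2) : ℝ≥0∞ :=
  ∫⁻ h, ENNReal.ofReal (|h| ^ (-1 - 2 * σ)) * ‖translate h p - p‖ₑ ^ 2

/-- Plancherel in `x` for each increment `h`, Tonelli, and the substitution `u = hξ`. -/
lemma gag_eq (σ : ℝ) (p : L2) :
    gag σ p = cG σ * ∫⁻ ξ, ENNReal.ofReal (|ξ| ^ (2 * σ)) * aHat p ξ ^ 2 := by
  have h2 : Measurable fun q : ℝ × ℝ => aHat p q.2 ^ 2 :=
    ((measurable_aHat p).comp measurable_snd).pow_const 2
  have h3 : Measurable fun q : ℝ × ℝ =>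
      ENNReal.ofReal (|q.1| ^ (-1 - 2 * σ) * osc (q.1 * q.2) ^ 2) :=
    ENNReal.measurable_ofReal.comp
      (((measurable_fst.norm).pow_const _).mul (measurable_osc_mul.pow_const 2))
  have e1 : gag σ p = ∫⁻ h, ∫⁻ ξ,
      ENNReal.ofReal (|h| ^ (-1 - 2 * σ) * osc (h * ξ) ^ 2) * aHat p ξ ^ 2 := by
    unfold gag
    congr 1; ext h
    have h4 : Measurable fun ξ => ENNReal.ofReal (osc (h * ξ) ^ 2) * aHat p ξ ^ 2 :=
      (ENNReal.measurable_ofReal.comp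
        ((measurable_osc_mul.comp measurable_prodMk_left).pow_const 2)).mul
        ((measurable_aHat p).pow_const 2)
    rw [enorm_translate_sub_sq, ← lintegral_const_mul _ h4]
    congr 1; ext ξ
    rw [ENNReal.ofReal_mul (Real.rpow_nonneg (abs_nonneg h) _), mul_assoc]
  have e2 := lintegral_lintegral_swap (μ := volume) (ν := volume)
    (f := fun h ξ => ENNReal.ofReal (|h| ^ (-1 - 2 * σ) * osc (h * ξ) ^ 2) * aHat p ξ ^ 2)
    (Measurable.aemeasurable (f := fun q : ℝ × ℝ =>
      ENNReal.ofReal (|q.1| ^ (-1 - 2 * σ) * osc (q.1 * q.2) ^ 2) * aHat p q.2 ^ 2) (h3.mul h2))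
  have h5 : Measurable fun ξ => ENNReal.ofReal (|ξ| ^ (2 * σ)) * aHat p ξ ^ 2 :=
    (ENNReal.measurable_ofReal.comp ((measurable_norm).pow_const _)).mul
      ((measurable_aHat p).pow_const 2)
  rw [e1, e2, ← lintegral_const_mul _ h5]
  refine lintegral_congr_ae ?_
  filter_upwards [Measure.ae_ne volume (0 : ℝ)] with ξ hξ
  have h6 : Measurable fun h => ENNReal.ofReal (|h| ^ (-1 - 2 * σ) * osc (h * ξ) ^ 2) :=
    h3.comp measurable_prodMk_right
  rw [lintegral_mul_const _ h6, lintegral_osc hξ]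
  ring

lemma symJ_sq_eq (σ κ : ℝ) : symJ σ κ ^ 2 = (1 + κ ^ 2) ^ σ := by
  rw [sq, symJ_add, symJ]; congr 1; ring

lemma abs_rpow_two_mul (σ κ : ℝ) : |κ| ^ (2 * σ) = (κ ^ 2) ^ σ := by
  rw [Real.rpow_mul (abs_nonneg κ), Real.rpow_two, sq_abs]

lemma rpow_le_jE_sq {σ : ℝ} (h0 : 0 ≤ σ) (ξ : ℝ) : ENNReal.ofReal (|ξ| ^ (2 * σ)) ≤ jE σ ξ ^ 2 := by
  rw [jE, ← ENNReal.ofReal_pow (symJ_pos _ _).le, symJ_sq_eq, abs_rpow_two_mul]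
  refine ENNReal.ofReal_le_ofReal (Real.rpow_le_rpow (by positivity) ?_ h0)
  have : 1 ≤ (2 * Real.pi) ^ 2 := by nlinarith [Real.pi_gt_three]
  nlinarith [sq_nonneg ξ, mul_le_mul_of_nonneg_right this (sq_nonneg ξ)]

lemma jE_sq_le {σ : ℝ} (h0 : 0 ≤ σ) (h1 : σ ≤ 1) (ξ : ℝ) :
    jE σ ξ ^ 2 ≤ 1 + ENNReal.ofReal ((2 * Real.pi) ^ (2 * σ)) * ENNReal.ofReal (|ξ| ^ (2 * σ)) := by
  rw [jE, ← ENNReal.ofReal_pow (symJ_pos _ _).le, symJ_sq_eq, ← ENNReal.ofReal_mul (by positivity),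
    ← Real.mul_rpow (by positivity) (abs_nonneg _), ← ENNReal.ofReal_one,
    ← ENNReal.ofReal_add zero_le_one (by positivity)]
  refine ENNReal.ofReal_le_ofReal ?_
  have := Real.rpow_add_le_add_rpow zero_le_one (sq_nonneg (2 * Real.pi * ξ)) h0 h1
  rwa [Real.one_rpow, ← abs_rpow_two_mul, abs_mul, abs_of_pos (by positivity : 0 < 2 * Real.pi)] at this

lemma gag_le {σ : ℝ} (h0 : 0 ≤ σ) (p : L2) :
    gag σ p ≤ cG σ * N2 (fun ξ => jE σ ξ * aHat p ξ) ^ 2 := by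
  rw [gag_eq, N2_sq]
  gcongr with ξ
  rw [mul_pow]; gcongr; exact rpow_le_jE_sq h0 ξ

lemma N2_sq_le_gag {σ : ℝ} (h0 : 0 < σ) (h1 : σ < 1) (p : L2) :
    N2 (fun ξ => jE σ ξ * aHat p ξ) ^ 2 ≤
      ‖p‖ₑ ^ 2 + ENNReal.ofReal ((2 * Real.pi) ^ (2 * σ)) * (cG σ)⁻¹ * gag σ p := by
  have hA := measurable_aHat p
  rw [gag_eq, N2_sq, mul_assoc, ← mul_assoc (cG σ)⁻¹, ENNReal.inv_mul_cancel (cG_pos h0).ne'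
    (cG_lt_top h0 h1).ne, one_mul, enorm_sq_eq_aHat, ← lintegral_const_mul _ (by fun_prop),
    ← lintegral_add_left (by fun_prop)]
  refine lintegral_mono fun ξ => ?_
  rw [mul_pow]
  calc jE σ ξ ^ 2 * aHat p ξ ^ 2 ≤ (1 + ENNReal.ofReal ((2 * Real.pi) ^ (2 * σ)) *
        ENNReal.ofReal (|ξ| ^ (2 * σ))) * aHat p ξ ^ 2 := by
        gcongr; exact jE_sq_le h0.le h1.le ξ
    _ = _ := by ring

/-! ### The bilinear Gagliardo estimate -/

/-- The weight `min(|h|, |h|^s |θ|^(s-1))`. -/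
def gW (s h θ : ℝ) : ℝ := min |h| (|h| ^ s * |θ| ^ (s - 1))

lemma gW_nonneg (s h θ : ℝ) : 0 ≤ gW s h θ := le_min (abs_nonneg _) (by positivity)

lemma gW_pos {s h θ : ℝ} (hh : h ≠ 0) (hθ : θ ≠ 0) : 0 < gW s h θ := by
  have := abs_pos.2 hh
  have := abs_pos.2 hθ
  exact lt_min (by assumption) (by positivity)

lemma measurable_gW (s : ℝ) : Measurable fun p : ℝ × ℝ => gW s p.1 p.2 :=
  (measurable_fst.norm).min ((measurable_fst.norm.pow_const _).mul (measurable_snd.norm.pow_const _))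

lemma gW_anti {s : ℝ} (hs : s ≤ 1) (h : ℝ) {x y : ℝ} (hx : x ≠ 0) (hxy : |x| ≤ |y|) :
    gW s h y ≤ gW s h x := by
  have hx' := abs_pos.2 hx
  refine min_le_min le_rfl ?_
  have := Real.rpow_le_rpow_of_nonpos hx' hxy (show s - 1 ≤ 0 by linarith)
  gcongr

lemma gW_eq (s h θ : ℝ) (hh : h ≠ 0) (hθ : θ ≠ 0) :
    gW s h θ = |h| * min 1 (|h * θ| ^ (s - 1)) := by
  have h1 := abs_pos.2 hh
  have h2 := abs_pos.2 hθ
  rw [gW, mul_min_of_nonneg _ _ h1.le, mul_one, abs_mul, Real.mul_rpow h1.le h2.le, ← mul_assoc]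
  congr 2
  nth_rewrite 2 [← Real.rpow_one |h|]
  rw [← Real.rpow_add h1]; congr 1; ring

lemma gW_eq' (s h θ : ℝ) (hh : h ≠ 0) (hθ : θ ≠ 0) :
    gW s h θ = |θ|⁻¹ * min |h * θ| (|h * θ| ^ s) := by
  have h1 := abs_pos.2 hh
  have h2 := abs_pos.2 hθ
  rw [gW, mul_min_of_nonneg _ _ (by positivity), abs_mul, Real.mul_rpow h1.le h2.le,
    Real.rpow_sub_one h2.ne']
  congr 1 <;> field_simp

/-- The value at `|h| = 1` of the integral of `|ζ|^(-2s)` against `gW`. Convergence at zero uses `s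
< 1/2`, at infinity `0 < s`. -/
def cW (s : ℝ) : ℝ≥0∞ := ∫⁻ u, ENNReal.ofReal (|u| ^ (-(2 * s)) * min 1 (|u| ^ (s - 1)))

lemma cW_lt_top {s : ℝ} (h0 : 0 < s) (h1 : s < 1 / 2) : cW s < ∞ := by
  refine lintegral_lt_top_of_le_rpow (C := 1) (a := -(2 * s)) (b := -1 - s)
    (by linarith) (by linarith) (fun u hu _ => ?_) fun u hu => ?_
  · rw [mul_comm]
    gcongr; exact min_le_left _ _
  · have hu' : 0 < |u| := by linarith
    calc _ ≤ |u| ^ (-(2 * s)) * |u| ^ (s - 1) := by gcongr; exact min_le_right _ _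
      _ = _ := by rw [← Real.rpow_add hu', one_mul]; congr 1; ring

lemma lintegral_gW {s h : ℝ} (hh : h ≠ 0) :
    ∫⁻ ζ, ENNReal.ofReal (|ζ| ^ (-(2 * s)) * gW s h ζ) = ENNReal.ofReal (|h| ^ (2 * s)) * cW s := by
  have hm : Measurable fun u : ℝ => ENNReal.ofReal (|u| ^ (-(2 * s)) * min 1 (|u| ^ (s - 1))) := by
    refine ENNReal.measurable_ofReal.comp ((measurable_norm.pow_const _).mul
      (measurable_const.min (measurable_norm.pow_const _)))
  have h' := abs_pos.2 hh
  rw [lintegral_eq_of_scale hm (c := h) (A := |h| ^ (1 + 2 * s)) hh (by positivity) fun ζ hζ => ?_]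
  · rw [cW]; congr 2
    rw [← Real.rpow_neg_one, ← Real.rpow_add h']; congr 1; ring
  · rw [← ENNReal.ofReal_mul (by positivity), gW_eq s h ζ hh hζ, abs_mul,
      Real.mul_rpow (z := -(2 * s)) h'.le (abs_nonneg ζ)]
    congr 1
    have : |h| ^ (1 + 2 * s) * |h| ^ (-(2 * s)) = |h| := by
      rw [← Real.rpow_add h']; simp [show 1 + 2 * s + -(2 * s) = 1 by ring]
    linear_combination (-(|ζ| ^ (-(2 * s)) * min 1 ((|h| * |ζ|) ^ (s - 1)))) * this

/-- Both `|ζ|^(-2s)` and `gW` decrease in the modulus of their frequency, so at each point the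
product is at most the one with both arguments replaced by the smaller of `ζ` and `ξ - ζ`. The sum
of the two resulting integrals does not depend on `ξ`. -/
lemma lintegral_gW_sub_le {s h : ℝ} (h0 : 0 < s) (h1 : s < 1 / 2) (hh : h ≠ 0) (ξ : ℝ) :
    ∫⁻ ζ, ENNReal.ofReal (|ζ| ^ (-(2 * s)) * gW s h (ξ - ζ)) ≤
      2 * cW s * ENNReal.ofReal (|h| ^ (2 * s)) := by
  have hm : Measurable fun ζ : ℝ => ENNReal.ofReal (|ζ| ^ (-(2 * s)) * gW s h ζ) :=
    ENNReal.measurable_ofReal.comp ((measurable_norm.pow_const _).mul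
      ((measurable_gW s).comp measurable_prodMk_left))
  calc _ ≤ ∫⁻ ζ, (ENNReal.ofReal (|ζ| ^ (-(2 * s)) * gW s h ζ) +
        ENNReal.ofReal (|ξ - ζ| ^ (-(2 * s)) * gW s h (ξ - ζ))) := by
        refine lintegral_mono_ae ?_
        filter_upwards [Measure.ae_ne volume (0 : ℝ), Measure.ae_ne volume ξ] with ζ hζ hζ'
        have hθ : ξ - ζ ≠ 0 := sub_ne_zero.2 hζ'.symm
        rcases le_total |ζ| |ξ - ζ| with hle | hle
        · refine le_add_right (ENNReal.ofReal_le_ofReal ?_)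
          have := gW_anti (by linarith : s ≤ 1) h hζ hle
          gcongr
        · refine le_add_left (ENNReal.ofReal_le_ofReal ?_)
          have h3 := Real.rpow_le_rpow_of_nonpos (abs_pos.2 hθ) hle (show -(2 * s) ≤ 0 by linarith)
          have := gW_nonneg s h (ξ - ζ)
          gcongr
    _ = _ := by
        rw [lintegral_add_left hm, lintegral_sub_left_eq_self
          (fun ζ => ENNReal.ofReal (|ζ| ^ (-(2 * s)) * gW s h ζ)) ξ, lintegral_gW hh]
        ring

/-- The complementary constant: the integral over `h` of `|h|⁻¹ osc² / gW` at `|θ| = 1`. The weight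
`gW` is chosen so that `cW` and `cO` are both finite. -/
def cO (s : ℝ) : ℝ≥0∞ := ∫⁻ u, ENNReal.ofReal (|u|⁻¹ * (osc u ^ 2 * (min |u| (|u| ^ s))⁻¹))

lemma cO_lt_top {s : ℝ} (h0 : 0 < s) (h1 : s < 1 / 2) : cO s < ∞ := by
  refine lintegral_lt_top_of_le_rpow (C := 4 * Real.pi ^ 2) (a := 0) (b := -1 - s)
    (by linarith) (by linarith) (fun u hu hu1 => ?_) fun u hu => ?_
  · have hu' := abs_pos.2 hu
    rw [min_eq_left (by
      nth_rewrite 1 [← Real.rpow_one |u|]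
      exact Real.rpow_le_rpow_of_exponent_ge hu' hu1 (by linarith)), Real.rpow_zero, mul_one]
    calc _ ≤ |u|⁻¹ * (4 * Real.pi ^ 2 * |u| ^ 2 * |u|⁻¹) := by gcongr; exact osc_sq_le' u
      _ = _ := by field_simp
  · have hu' : 0 < |u| := by linarith
    rw [min_eq_right (by
      nth_rewrite 2 [← Real.rpow_one |u|]
      exact Real.rpow_le_rpow_of_exponent_le hu.le (by linarith))]
    calc _ ≤ |u|⁻¹ * (4 * Real.pi ^ 2 * (|u| ^ s)⁻¹) := by
          gcongr; exact (osc_sq_le u).trans four_le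
      _ = _ := by
          rw [Real.rpow_sub hu', Real.rpow_neg_one]; field_simp

lemma measurable_osc_gW (s : ℝ) : Measurable fun p : ℝ × ℝ =>
    ENNReal.ofReal (osc (p.1 * p.2) ^ 2 * (gW s p.1 p.2)⁻¹) :=
  ENNReal.measurable_ofReal.comp ((measurable_osc_mul.pow_const 2).mul (measurable_gW s).inv)

lemma lintegral_osc_gW {s θ : ℝ} (hθ : θ ≠ 0) :
    ∫⁻ h, ENNReal.ofReal |h|⁻¹ * ENNReal.ofReal (osc (h * θ) ^ 2 * (gW s h θ)⁻¹) =
      ENNReal.ofReal |θ| * cO s := by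
  have hm : Measurable fun u : ℝ =>
      ENNReal.ofReal (|u|⁻¹ * (osc u ^ 2 * (min |u| (|u| ^ s))⁻¹)) := by
    have := continuous_osc.measurable
    refine ENNReal.measurable_ofReal.comp (measurable_norm.inv.mul
      ((this.pow_const 2).mul (measurable_norm.min (measurable_norm.pow_const _)).inv))
  have h' := abs_pos.2 hθ
  rw [lintegral_eq_of_scale hm (c := θ) (A := |θ| ^ 2) hθ (by positivity) fun h hh => ?_]
  · rw [cO]; congr 2; field_simp
  · rw [← ENNReal.ofReal_mul (by positivity), ← ENNReal.ofReal_mul (by positivity),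
      gW_eq' s h θ hh hθ, mul_comm θ h]
    congr 1
    have := abs_pos.2 hh
    rw [abs_mul]
    field_simp

lemma N2_rpow_mul_le {s : ℝ} (h0 : 0 < s) (A : ℝ → ℝ≥0∞) :
    N2 (fun ζ => ENNReal.ofReal (|ζ| ^ s) * A ζ) ≤ N2 (fun ξ => jE s ξ * A ξ) := by
  refine N2_mono fun ζ => ?_
  gcongr
  have := rpow_le_jE_sq h0.le ζ
  rw [mul_comm, Real.rpow_mul (abs_nonneg ζ), Real.rpow_two, ENNReal.ofReal_pow (by positivity)] at this
  rw [← ENNReal.sq_rpow_half (ENNReal.ofReal _), ← ENNReal.sq_rpow_half (jE s ζ)]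
  gcongr

lemma measurable_osc_div_gW (s h : ℝ) : Measurable fun θ => osc (h * θ) * (√(gW s h θ))⁻¹ := by
  have mG : Measurable fun θ => gW s h θ := (measurable_gW s).comp measurable_prodMk_left
  have mo : Measurable fun θ => osc (h * θ) := continuous_osc.measurable.comp (measurable_const_mul h)
  fun_prop

/-- Cauchy-Schwarz in the convolution with kernel `|ζ|^(-s) √gW(h, ξ - ζ)`. The inverse powers are
absorbed by `A`, which has `s` derivatives, and by the oscillating factor, while the square integral
of the kernel is `O(|h|^{2s})` uniformly in `ξ`. -/
lemma N2_convE_osc_le {s : ℝ} (h0 : 0 < s) (h1 : s < 1 / 2) {A B : ℝ → ℝ≥0∞}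
    (hA : Measurable A) (hB : Measurable B) {h : ℝ} (hh : h ≠ 0) :
    N2 (convE A fun θ => ENNReal.ofReal (osc (h * θ)) * B θ) ^ 2 ≤
      2 * cW s * ENNReal.ofReal (|h| ^ (2 * s)) * (N2 (fun ξ => jE s ξ * A ξ) ^ 2 *
        ∫⁻ θ, ENNReal.ofReal (osc (h * θ) ^ 2 * (gW s h θ)⁻¹) * B θ ^ 2) := by
  have hg := N2_rpow_mul_le h0 A
  have mg : Measurable fun ζ => ENNReal.ofReal (|ζ| ^ s) * A ζ :=
    (ENNReal.measurable_ofReal.comp (measurable_norm.pow_const _)).mul hA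
  set q : ℝ → ℝ≥0∞ := fun θ => ENNReal.ofReal (osc (h * θ) * (√(gW s h θ))⁻¹) * B θ with hq
  have mG : Measurable fun θ => gW s h θ := (measurable_gW s).comp measurable_prodMk_left
  have mos := measurable_osc_div_gW s h
  have mq : Measurable q := mos.ennreal_ofReal.mul hB
  have mGs : Measurable fun p : ℝ × ℝ => gW s h (p.1 - p.2) :=
    mG.comp (measurable_fst.sub measurable_snd)
  have mp : Measurable fun p : ℝ × ℝ => |p.2| ^ (-s) := measurable_snd.norm.pow_const _
  have mK : Measurable fun p : ℝ × ℝ => ENNReal.ofReal (|p.2| ^ (-s) * √(gW s h (p.1 - p.2))) :=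
    (mp.mul mGs.sqrt).ennreal_ofReal
  have e1 : convE A (fun θ => ENNReal.ofReal (osc (h * θ)) * B θ) = fun ξ => ∫⁻ ζ,
      ENNReal.ofReal (|ζ| ^ (-s) * √(gW s h (ξ - ζ))) *
        (ENNReal.ofReal (|ζ| ^ s) * A ζ * q (ξ - ζ)) := by
    ext ξ
    refine lintegral_congr_ae ?_
    filter_upwards [Measure.ae_ne volume (0 : ℝ), Measure.ae_ne volume ξ] with ζ hζ hζ'
    have hθ : ξ - ζ ≠ 0 := sub_ne_zero.2 hζ'.symm
    have hz := abs_pos.2 hζ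
    have hGp := Real.sqrt_pos.2 (gW_pos (s := s) hh hθ)
    have e : ENNReal.ofReal (osc (h * (ξ - ζ))) =
        ENNReal.ofReal (|ζ| ^ (-s) * √(gW s h (ξ - ζ))) * (ENNReal.ofReal (|ζ| ^ s) *
          ENNReal.ofReal (osc (h * (ξ - ζ)) * (√(gW s h (ξ - ζ)))⁻¹)) := by
      rw [← ENNReal.ofReal_mul (by positivity), ← ENNReal.ofReal_mul (by positivity)]
      congr 1
      rw [Real.rpow_neg hz.le]
      field_simp
    simp only [hq]
    rw [e]; ring
  have e2 : N2 q ^ 2 = ∫⁻ θ, ENNReal.ofReal (osc (h * θ) ^ 2 * (gW s h θ)⁻¹) * B θ ^ 2 := by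
    rw [N2_sq]
    congr 1; ext θ
    rw [hq, mul_pow, ← ENNReal.ofReal_pow (mul_nonneg (osc_nonneg _) (by positivity)), mul_pow,
      inv_pow, Real.sq_sqrt (gW_nonneg _ _ _)]
  have hM : ∀ ξ : ℝ, ∫⁻ ζ, ENNReal.ofReal (|ζ| ^ (-s) * √(gW s h (ξ - ζ))) ^ 2 ≤
      2 * cW s * ENNReal.ofReal (|h| ^ (2 * s)) := fun ξ => by
    refine le_trans (le_of_eq (lintegral_congr fun ζ => ?_)) (lintegral_gW_sub_le h0 h1 hh ξ)
    have e3 : (|ζ| ^ (-s)) ^ 2 = |ζ| ^ (-(2 * s)) := by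
      rw [← Real.rpow_natCast, ← Real.rpow_mul (abs_nonneg ζ)]
      congr 1; push_cast; ring
    rw [← ENNReal.ofReal_pow (by positivity), mul_pow, Real.sq_sqrt (gW_nonneg _ _ _), e3]
  have hN := N2_conv_le (K := fun ξ ζ => ENNReal.ofReal (|ζ| ^ (-s) * √(gW s h (ξ - ζ)))) mK mg mq hM
  rw [e1, ← e2]
  calc _ ≤ ((2 * cW s * ENNReal.ofReal (|h| ^ (2 * s))) ^ (1 / 2 : ℝ) *
        (N2 (fun ζ => ENNReal.ofReal (|ζ| ^ s) * A ζ) * N2 q)) ^ 2 := by gcongr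
    _ = 2 * cW s * ENNReal.ofReal (|h| ^ (2 * s)) *
        (N2 (fun ζ => ENNReal.ofReal (|ζ| ^ s) * A ζ) ^ 2 * N2 q ^ 2) := by
        rw [mul_pow, ENNReal.rpow_half_sq, mul_pow]
    _ ≤ _ := by gcongr

/-- The gain `|h|^{2s}` reduces the singular weight in `h` to `|h|⁻¹`. Tonelli and
`lintegral_osc_gW` then produce the factor `|θ|`, that is, half a derivative on `B`. -/
lemma gagliardo_convE_le {s : ℝ} (h0 : 0 < s) (h1 : s < 1 / 2) {A B : ℝ → ℝ≥0∞}
    (hA : Measurable A) (hB : Measurable B) :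
    ∫⁻ h, ENNReal.ofReal (|h| ^ (-1 - 2 * s)) *
        N2 (convE A fun θ => ENNReal.ofReal (osc (h * θ)) * B θ) ^ 2 ≤
      2 * cW s * cO s * (N2 (fun ξ => jE s ξ * A ξ) ^ 2 * N2 (fun ξ => jE (1 / 2) ξ * B ξ) ^ 2) := by
  have key := fun (h : ℝ) (hh : h ≠ 0) => N2_convE_osc_le h0 h1 hA hB hh
  have mB : Measurable fun p : ℝ × ℝ => B p.2 ^ 2 := (hB.comp measurable_snd).pow_const 2
  have mh : Measurable fun h : ℝ => ENNReal.ofReal |h|⁻¹ :=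
    ENNReal.measurable_ofReal.comp measurable_norm.inv
  have mI : Measurable fun p : ℝ × ℝ => ENNReal.ofReal |p.1|⁻¹ *
      ENNReal.ofReal (osc (p.1 * p.2) ^ 2 * (gW s p.1 p.2)⁻¹) :=
    (mh.comp measurable_fst).mul (measurable_osc_gW s)
  have hsw := lintegral_lintegral_swap (μ := volume) (ν := volume)
    (f := fun h θ => ENNReal.ofReal |h|⁻¹ *
      ENNReal.ofReal (osc (h * θ) ^ 2 * (gW s h θ)⁻¹) * B θ ^ 2)
    (Measurable.aemeasurable (f := fun p : ℝ × ℝ => ENNReal.ofReal |p.1|⁻¹ *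
      ENNReal.ofReal (osc (p.1 * p.2) ^ 2 * (gW s p.1 p.2)⁻¹) * B p.2 ^ 2) (mI.mul mB))
  have mJ : Measurable fun h => ∫⁻ θ, ENNReal.ofReal |h|⁻¹ *
      ENNReal.ofReal (osc (h * θ) ^ 2 * (gW s h θ)⁻¹) * B θ ^ 2 :=
    (mI.mul mB).lintegral_prod_right'
  have hfin : ∫⁻ h, ∫⁻ θ, ENNReal.ofReal |h|⁻¹ *
      ENNReal.ofReal (osc (h * θ) ^ 2 * (gW s h θ)⁻¹) * B θ ^ 2 ≤
      cO s * N2 (fun ξ => jE (1 / 2) ξ * B ξ) ^ 2 := by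
    have mj : Measurable fun ξ => (jE (1 / 2) ξ * B ξ) ^ 2 :=
      ((measurable_jE (1 / 2)).mul hB).pow_const 2
    rw [hsw, N2_sq, ← lintegral_const_mul _ mj]
    refine lintegral_mono_ae ?_
    filter_upwards [Measure.ae_ne volume (0 : ℝ)] with θ hθ
    have mIθ : Measurable fun h =>
        ENNReal.ofReal |h|⁻¹ * ENNReal.ofReal (osc (h * θ) ^ 2 * (gW s h θ)⁻¹) :=
      mI.comp measurable_prodMk_right
    rw [lintegral_mul_const _ mIθ, lintegral_osc_gW hθ]
    have := rpow_le_jE_sq (σ := 1 / 2) (by norm_num) θ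
    rw [show (2 * (1 / 2) : ℝ) = 1 by norm_num, Real.rpow_one] at this
    calc _ = cO s * (ENNReal.ofReal |θ| * B θ ^ 2) := by ring
      _ ≤ cO s * (jE (1 / 2) θ ^ 2 * B θ ^ 2) := by gcongr
      _ = _ := by rw [mul_pow]
  calc _ ≤ ∫⁻ h, 2 * cW s * N2 (fun ξ => jE s ξ * A ξ) ^ 2 * ∫⁻ θ, ENNReal.ofReal |h|⁻¹ *
      ENNReal.ofReal (osc (h * θ) ^ 2 * (gW s h θ)⁻¹) * B θ ^ 2 := by
        refine lintegral_mono_ae ?_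
        filter_upwards [Measure.ae_ne volume (0 : ℝ)] with h hh
        have h' := abs_pos.2 hh
        have mθ : Measurable fun θ => ENNReal.ofReal (osc (h * θ) ^ 2 * (gW s h θ)⁻¹) * B θ ^ 2 :=
          ((measurable_osc_gW s).comp measurable_prodMk_left).mul (hB.pow_const 2)
        simp_rw [mul_assoc (ENNReal.ofReal |h|⁻¹)]
        rw [lintegral_const_mul _ mθ]
        refine (mul_le_mul_right (key h hh) _).trans_eq ?_
        have e : ENNReal.ofReal |h|⁻¹ =
            ENNReal.ofReal (|h| ^ (-1 - 2 * s)) * ENNReal.ofReal (|h| ^ (2 * s)) := by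
          rw [← ENNReal.ofReal_mul (by positivity), ← Real.rpow_add h', ← Real.rpow_neg_one]
          congr 2; ring
        rw [e]; ring
    _ ≤ _ := by
        rw [lintegral_const_mul _ mJ]
        refine (mul_le_mul_right hfin _).trans_eq (by ring)

/-! ### The Sobolev embedding into `L^∞` -/

lemma toC_ae_eq_fourier {v : L2} (hv : Integrable (hat v)) :
    toC v =ᵐ[volume] fun x => 𝓕 (fun ξ => hat v ξ) (-x) := by
  have hcont : Continuous (𝓕 (fun ξ => hat v ξ)) :=
    VectorFourier.fourierIntegral_continuous Real.continuous_fourierChar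
      (by exact continuous_inner) hv
  have hc2 : Continuous fun x => 𝓕 (fun ξ => hat v ξ) (-x) := hcont.comp continuous_neg
  refine ae_eq_of_integral_contDiff_smul_eq (locallyIntegrable_Lp _) hc2.locallyIntegrable
    fun g hg hc => ?_
  have hc' : HasCompactSupport (fun x => (g x : ℂ)) := hc.comp_left (g := fun x : ℝ => (x : ℂ)) rfl
  have hg' : ContDiff ℝ ((⊤ : ℕ∞) : WithTop ℕ∞) (fun x => (g x : ℂ)) :=
    Complex.ofRealCLM.contDiff.comp hg
  set φ : 𝓢(ℝ, ℂ) := hc'.toSchwartzMap hg'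
  have h1 := integral_hat_mul v (𝓕⁻ φ)
  have e1 : 𝓕 ((𝓕⁻ φ : 𝓢(ℝ, ℂ)) : ℝ → ℂ) = φ := by
    rw [← SchwartzMap.fourier_coe, FourierTransform.fourier_fourierInv_eq]
  have hφn : Integrable fun x => φ (-x) := φ.integrable.comp_neg
  have h2 := VectorFourier.integral_fourierIntegral_smul_eq_flip (L := innerₗ ℝ) (μ := volume)
    (ν := volume) (f := fun ξ => hat v ξ) (g := fun x => φ (-x))
    Real.continuous_fourierChar continuous_inner hv hφn
  have hfl : (innerₗ ℝ).flip = innerₗ ℝ := by ext; simp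
  rw [hfl] at h2
  have h3 : ∫ x, 𝓕 (fun ξ => hat v ξ) x * φ (-x) = ∫ x, hat v x * 𝓕 (fun x => φ (-x)) x := h2
  have e2 : 𝓕 (fun x => φ (-x)) = ((𝓕⁻ φ : 𝓢(ℝ, ℂ)) : ℝ → ℂ) := by
    rw [SchwartzMap.fourierInv_coe]; ext x
    rw [Real.fourierInv_eq_fourier_comp_neg]
  rw [e1] at h1
  rw [e2, h1, ← integral_neg_eq_self] at h3
  simp only [neg_neg] at h3
  calc ∫ x, g x • toC v x = ∫ x, (v x : ℂ) * φ x := by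
        refine integral_congr_ae ?_
        filter_upwards [toC_ae v] with x hx
        rw [hx, Complex.real_smul, mul_comm]; rfl
    _ = _ := h3.symm
    _ = _ := by
        congr 1; ext x; rw [Complex.real_smul, mul_comm]; rfl

/-- Fourier inversion when the transform is integrable; otherwise the bound is infinite. -/
lemma eLpNorm_top_le (v : L2) : eLpNorm v ∞ volume ≤ ∫⁻ ξ, aHat v ξ := by
  by_cases h : ∫⁻ ξ, aHat v ξ = ∞
  · rw [h]; exact le_top
  have hv : Integrable (hat v) :=
    ⟨(Lp.aestronglyMeasurable _), lt_top_iff_ne_top.2 h⟩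
  rw [eLpNorm_exponent_top]
  refine eLpNormEssSup_le_of_ae_enorm_bound ?_
  filter_upwards [toC_ae v, toC_ae_eq_fourier hv] with x h1 h2
  have h3 : ‖v x‖ₑ = ‖toC v x‖ₑ := by
    rw [h1]; simp [enorm_eq_nnnorm]
  rw [h3, h2, Real.fourier_real_eq]
  refine (enorm_integral_le_lintegral_enorm _).trans (le_of_eq ?_)
  refine lintegral_congr fun ξ => ?_
  rw [Circle.smul_def, enorm_smul, ← ofReal_norm, Circle.norm_coe, ENNReal.ofReal_one, one_mul]
  rfl

/-- The constant of the Sobolev embedding. -/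
def cL (s : ℝ) : ℝ≥0∞ := N2 (jE (-(1 / 2 + s / 2)))

lemma cL_lt_top {s : ℝ} (hs : 0 < s) : cL s < ∞ := by
  unfold cL N2
  refine ENNReal.rpow_lt_top_of_nonneg (by norm_num) ?_
  simp_rw [jE_pow_two, show 2 * -(1 / 2 + s / 2) = -(1 + s) by ring]
  exact (lintegral_jE_lt_top (by linarith)).ne

lemma lintegral_le_cL (s : ℝ) {B : ℝ → ℝ≥0∞} (hB : Measurable B) :
    ∫⁻ ξ, B ξ ≤ cL s * N2 fun ξ => jE (1 / 2 + s / 2) ξ * B ξ := by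
  have hj := measurable_jE (1 / 2 + s / 2)
  have hjB : Measurable fun ξ => jE (1 / 2 + s / 2) ξ * B ξ := hj.mul hB
  refine le_trans (le_of_eq ?_) (lintegral_mul_le_N2 (measurable_jE _) hjB)
  congr 1; ext ξ
  rw [← mul_assoc, jE_neg_mul, one_mul]

lemma eLpNorm_top_lt_top {s : ℝ} (hs : 0 < s) {v : L2} (hv : MemH (s + 1 / 2) v) :
    eLpNorm v ∞ volume ≤ cL s * ENNReal.ofReal (normH (s + 1 / 2) v) := by
  refine (eLpNorm_top_le v).trans ((lintegral_le_cL s (measurable_aHat v)).trans ?_)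
  rw [← N2_jE_aHat hv]
  gcongr
  refine N2_mono fun ξ => ?_
  gcongr; exact jE_mono (by linarith) ξ

lemma memLp_top {s : ℝ} (hs : 0 < s) {v : L2} (hv : MemH (s + 1 / 2) v) :
    MemLp v ∞ volume :=
  ⟨Lp.aestronglyMeasurable v, (eLpNorm_top_lt_top hs hv).trans_lt
    (ENNReal.mul_lt_top (cL_lt_top hs) ENNReal.ofReal_lt_top)⟩

lemma abs_normLinfty_sub_le {s : ℝ} (hs : 0 < s) {v w : L2} (hv : MemH (s + 1 / 2) v)
    (hw : MemH (s + 1 / 2) w) :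
    |normLinfty v - normLinfty w| ≤ (cL s).toReal * normH (s + 1 / 2) (v - w) := by
  have hm := memLp_top hs hv
  have hm' := memLp_top hs hw
  have h := eLpNorm_top_lt_top hs (hv.sub hw)
  have h1 := ENNReal.toReal_mono (ENNReal.mul_ne_top (cL_lt_top hs).ne ENNReal.ofReal_ne_top) h
  rw [ENNReal.toReal_mul, ENNReal.toReal_ofReal (normH_nonneg _ _)] at h1
  refine le_trans ?_ h1
  have e : (eLpNorm (v - w : L2) ∞ volume).toReal = ‖hm.toLp - hm'.toLp‖ := by
    rw [← MemLp.toLp_sub, Lp.norm_toLp, eLpNorm_congr_ae (Lp.coeFn_sub v w)]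
  rw [e, normLinfty, normLinfty, ← Lp.norm_toLp _ hm, ← Lp.norm_toLp _ hm']
  exact abs_norm_sub_norm_le _ _

lemma normLinfty_nonneg (v : L2) : 0 ≤ normLinfty v := ENNReal.toReal_nonneg

lemma IsSolution.continuousOn_normLinfty {s : ℝ} {I : Set ℝ} {η v : ℝ → L2} (hs : 0 < s)
    (hu : IsSolution s I η v) : ContinuousOn (fun t => normLinfty (v t)) I := by
  refine continuousOn_of_abs_sub_le (C := (cL s).toReal * 2) hu fun t ht r hr => ?_
  refine (abs_normLinfty_sub_le hs (hu.mem_v t ht) (hu.mem_v r hr)).trans ?_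
  rw [mul_assoc]
  gcongr
  exact normH_half_le_normX ((hu.mem_v t ht).sub (hu.mem_v r hr)) _

/-! ### The logarithmic inequality for the `L^∞` norm -/

lemma jE_neg_le_rpow {r : ℝ} (hr : 0 ≤ r) {ξ : ℝ} (hξ : ξ ≠ 0) :
    jE (-r) ξ ≤ ENNReal.ofReal (|ξ| ^ (-r)) := by
  rw [jE, symJ]
  refine ENNReal.ofReal_le_ofReal ?_
  have h := abs_pos.2 hξ
  have e : |ξ| ^ (-r) = (ξ ^ 2) ^ (-r / 2) := by
    rw [← sq_abs, ← Real.rpow_two, ← Real.rpow_mul h.le]; congr 1; ring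
  rw [e]
  refine Real.rpow_le_rpow_of_nonpos (by positivity) ?_ (by linarith)
  have : 1 ≤ (2 * Real.pi) ^ 2 := by nlinarith [Real.pi_gt_three]
  nlinarith [mul_le_mul_of_nonneg_right this (sq_nonneg ξ)]

lemma setLIntegral_jE_neg_one_le {R : ℝ} (hR : 1 ≤ R) :
    ∫⁻ ξ in Set.Icc (-R) R, jE (-1) ξ ≤ ENNReal.ofReal (2 * (1 + Real.log R)) := by
  have hj1 : ∀ ξ, jE (-1) ξ ≤ 1 := fun ξ => by
    rw [← jE_zero ξ]; exact jE_mono (by norm_num) ξ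
  set G : ℝ → ℝ≥0∞ := fun x => (Set.Iic R).indicator (jE (-1)) x with hG
  have e : ∫⁻ ξ in Set.Icc (-R) R, jE (-1) ξ = ∫⁻ ξ, G |ξ| := by
    rw [← lintegral_indicator measurableSet_Icc]
    congr 1; ext ξ
    have e2 : jE (-1) |ξ| = jE (-1) ξ := by
      rcases abs_choice ξ with h | h <;> rw [h]
      exact jE_neg_arg _ _
    by_cases h : |ξ| ≤ R
    · rw [Set.indicator_of_mem (show ξ ∈ Set.Icc (-R) R from abs_le.1 h), hG]
      simp only
      rw [Set.indicator_of_mem (show |ξ| ∈ Set.Iic R from h), e2]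
    · rw [Set.indicator_of_notMem (show ξ ∉ Set.Icc (-R) R from fun h' => h (abs_le.2 h')), hG]
      simp only
      rw [Set.indicator_of_notMem (show |ξ| ∉ Set.Iic R from h)]
  have h1 : ∫⁻ x in Set.Ioc (0 : ℝ) 1, G x ≤ 1 := by
    calc _ ≤ ∫⁻ _ in Set.Ioc (0 : ℝ) 1, 1 :=
          lintegral_mono fun x => (Set.indicator_le_self _ _ x).trans (hj1 x)
      _ = 1 := by simp
  have h2 : ∫⁻ x in Set.Ioi (1 : ℝ), G x ≤ ENNReal.ofReal (Real.log R) := by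
    have hint : IntegrableOn (fun x : ℝ => x⁻¹) (Set.Ioc 1 R) := by
      refine (intervalIntegrable_iff_integrableOn_Ioc_of_le hR).1
        (intervalIntegral.intervalIntegrable_inv (fun x hx => ?_) continuousOn_id)
      rw [Set.uIcc_of_le hR] at hx; linarith [hx.1]
    have hval : ∫ x in Set.Ioc 1 R, x⁻¹ = Real.log R := by
      rw [← intervalIntegral.integral_of_le hR, integral_inv_of_pos one_pos (by linarith), div_one]
    calc _ ≤ ∫⁻ x in Set.Ioi (1 : ℝ), (Set.Ioc 1 R).indicator (fun x => ENNReal.ofReal x⁻¹) x := by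
          refine setLIntegral_mono' measurableSet_Ioi fun x hx => ?_
          by_cases h : x ≤ R
          · rw [hG]; simp only
            rw [Set.indicator_of_mem (show x ∈ Set.Iic R from h),
              Set.indicator_of_mem (show x ∈ Set.Ioc 1 R from ⟨hx, h⟩)]
            have hx' : (1 : ℝ) < x := hx
            have := jE_neg_le_rpow zero_le_one (ξ := x) (by linarith)
            rwa [abs_of_pos (by linarith), Real.rpow_neg_one] at this
          · rw [hG]; simp only
            rw [Set.indicator_of_notMem (show x ∉ Set.Iic R from h)]; exact zero_le
      _ ≤ ∫⁻ x, (Set.Ioc 1 R).indicator (fun x => ENNReal.ofReal x⁻¹) x := setLIntegral_le_lintegral _ _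
      _ = ENNReal.ofReal (Real.log R) := by
          rw [lintegral_indicator measurableSet_Ioc, ← hval,
            ofReal_integral_eq_lintegral_ofReal hint]
          refine (ae_restrict_iff' measurableSet_Ioc).2 (Eventually.of_forall fun x hx => ?_)
          have := hx.1
          simp only [Pi.zero_apply]; positivity
  have hlog := Real.log_nonneg hR
  rw [e, lintegral_abs_eq, ← Set.Ioc_union_Ioi_eq_Ioi (zero_le_one (α := ℝ)),
    lintegral_union measurableSet_Ioi Set.Ioc_disjoint_Ioi_same, ENNReal.ofReal_mul (by norm_num),
    ENNReal.ofReal_add zero_le_one hlog]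
  simp only [ENNReal.ofReal_ofNat, ENNReal.ofReal_one]
  gcongr

/-- Split at `|ξ| = R`. Below, Cauchy-Schwarz against `⟨ξ⟩^{-1/2}` costs a power of the logarithm of
`R`, the borderline failure of `H^{1/2} ⊂ L^∞`. Above, `s/2` of the surplus derivatives is traded
for `R^(-s/2)` and the rest gives integrability. -/
lemma lintegral_le_log {s R : ℝ} (hs : 0 < s) (hR : 1 ≤ R) {B : ℝ → ℝ≥0∞} (hB : Measurable B) :
    ∫⁻ ξ, B ξ ≤ ENNReal.ofReal (2 * (1 + Real.log R)) * N2 (fun ξ => jE (1 / 2) ξ * B ξ) +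
      ENNReal.ofReal (R ^ (-(s / 2))) * (cL s * N2 fun ξ => jE (s + 1 / 2) ξ * B ξ) := by
  have hlog := Real.log_nonneg hR
  have hj := measurable_jE (1 / 2)
  have hj' := measurable_jE (-(1 / 2))
  have hjB : Measurable fun ξ => jE (1 / 2) ξ * B ξ := hj.mul hB
  rw [← lintegral_add_compl B (measurableSet_Icc (a := -R) (b := R))]
  refine add_le_add ?_ ?_
  · have h := lintegral_mul_le (volume.restrict (Set.Icc (-R) R)) hj'.aemeasurable hjB.aemeasurable
    have e : ∫⁻ ξ in Set.Icc (-R) R, B ξ =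
        ∫⁻ ξ in Set.Icc (-R) R, jE (-(1 / 2)) ξ * (jE (1 / 2) ξ * B ξ) := by
      congr 1; ext ξ; rw [← mul_assoc, jE_neg_mul, one_mul]
    rw [e]
    refine h.trans ?_
    gcongr
    · simp_rw [jE_pow_two, show (2 : ℝ) * -(1 / 2) = -1 by norm_num]
      -- Cauchy-Schwarz yields the square root of this quantity. As it is at least `1`, the root can
      -- be given away.
      have h1 : (1 : ℝ≥0∞) ≤ ENNReal.ofReal (2 * (1 + Real.log R)) := by
        rw [ENNReal.one_le_ofReal]; linarith
      calc _ ≤ ENNReal.ofReal (2 * (1 + Real.log R)) ^ (1 / 2 : ℝ) := by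
            gcongr; exact setLIntegral_jE_neg_one_le hR
        _ ≤ ENNReal.ofReal (2 * (1 + Real.log R)) ^ (1 : ℝ) :=
            ENNReal.rpow_le_rpow_of_exponent_le h1 (by norm_num)
        _ = _ := ENNReal.rpow_one _
    · unfold N2; gcongr; exact Measure.restrict_le_self
  · have hB2 : Measurable fun ξ => jE (s / 2) ξ * B ξ := (measurable_jE _).mul hB
    calc ∫⁻ ξ in (Set.Icc (-R) R)ᶜ, B ξ
        ≤ ∫⁻ ξ in (Set.Icc (-R) R)ᶜ, ENNReal.ofReal (R ^ (-(s / 2))) * (jE (s / 2) ξ * B ξ) := by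
          refine setLIntegral_mono' measurableSet_Icc.compl fun ξ hξ => ?_
          have hR' : R < |ξ| := by
            by_contra h; exact hξ (abs_le.1 (not_lt.1 h))
          have hξ0 : ξ ≠ 0 := abs_pos.1 (by linarith)
          rw [← mul_assoc]
          refine le_mul_of_one_le_left zero_le ?_
          rw [← jE_neg_mul (s / 2) ξ]
          gcongr
          refine (jE_neg_le_rpow (by linarith) hξ0).trans (ENNReal.ofReal_le_ofReal ?_)
          exact Real.rpow_le_rpow_of_nonpos (by linarith) hR'.le (by linarith)
      _ ≤ ∫⁻ ξ, ENNReal.ofReal (R ^ (-(s / 2))) * (jE (s / 2) ξ * B ξ) :=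
          setLIntegral_le_lintegral _ _
      _ ≤ _ := by
          rw [lintegral_const_mul _ hB2]
          gcongr
          refine (lintegral_le_cL s hB2).trans (le_of_eq ?_)
          congr 2; ext ξ; rw [← mul_assoc, jE_add]; congr 2; ring

/-- An inequality of Brezis-Gallouet type, obtained by choosing the splitting frequency according to
the size of the strong norm. -/
lemma exists_normLinfty_le_log {s : ℝ} (hs : 0 < s) : ∃ C : ℝ, 0 < C ∧ ∀ f v : L2,
    MemH (s + 1 / 2) v → normLinfty v ≤
      C * (1 + normH (1 / 2) v * (1 + Real.log (Real.exp 1 + normX s f v))) := by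
  refine ⟨2 + 4 / s + 2 * (cL s).toReal, by positivity, fun f v hv => ?_⟩
  set y := normX s f v with hy
  have hy0 : 0 ≤ y := normX_nonneg _ _ _
  have he : 1 < Real.exp 1 := Real.one_lt_exp_iff.2 one_pos
  have hey : 1 ≤ Real.exp 1 + y := by linarith
  set L := Real.log (Real.exp 1 + y) with hL
  have hL0 : 0 ≤ L := Real.log_nonneg hey
  -- With this exponent `R^(-s/2)` equals `1 / (e + y)`, which cancels the `H^{s+1/2}` norm of `v`,
  -- at most `2 y`, while `log R` is still a multiple of `log (e + y)`.
  set R := (Real.exp 1 + y) ^ (2 / s) with hRdef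
  have hR : 1 ≤ R := Real.one_le_rpow hey (by positivity)
  have hlogR : Real.log R = 2 / s * L := Real.log_rpow (by linarith) _
  have hRs : R ^ (-(s / 2)) = (Real.exp 1 + y)⁻¹ := by
    rw [hRdef, ← Real.rpow_mul (by linarith), ← Real.rpow_neg_one]
    congr 1; field_simp
  have h := (eLpNorm_top_le v).trans (lintegral_le_log hs hR (measurable_aHat v))
  have hH := normH_nonneg (1 / 2) v
  rw [N2_jE_aHat hv, N2_jE_aHat (hv.mono (by linarith)), hlogR, hRs,
    ← ENNReal.ofReal_toReal (cL_lt_top hs).ne, ← ENNReal.ofReal_mul (by positivity),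
    ← ENNReal.ofReal_mul (by positivity), ← ENNReal.ofReal_mul (by positivity),
    ← ENNReal.ofReal_add (by positivity) (by have := normH_nonneg (s + 1 / 2) v; positivity)] at h
  have h1 := ENNReal.toReal_mono ENNReal.ofReal_ne_top h
  rw [ENNReal.toReal_ofReal (by have := normH_nonneg (s + 1 / 2) v; positivity)] at h1
  refine h1.trans ?_
  have h2 : (Real.exp 1 + y)⁻¹ * ((cL s).toReal * normH (s + 1 / 2) v) ≤ 2 * (cL s).toReal := by
    rw [inv_mul_le_iff₀ (by linarith)]
    have := normH_half_le_normX hv f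
    have h3 : normH (s + 1 / 2) v ≤ 2 * (Real.exp 1 + y) := by linarith
    calc _ ≤ (cL s).toReal * (2 * (Real.exp 1 + y)) := by gcongr
      _ = _ := by ring
  have h4 : 2 * (1 + 2 / s * L) ≤ (2 + 4 / s) * (1 + L) := by
    have : 0 ≤ 4 / s := by positivity
    have e : 2 * (1 + 2 / s * L) = 2 + 4 / s * L := by ring
    nlinarith
  calc _ ≤ (2 + 4 / s) * (1 + L) * normH (1 / 2) v + 2 * (cL s).toReal := by gcongr
    _ ≤ _ := by
        have e1 : 0 ≤ (cL s).toReal := ENNReal.toReal_nonneg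
        have e2 : 0 ≤ 4 / s := by positivity
        have e3 : 0 ≤ normH (1 / 2) v * (1 + L) := by positivity
        nlinarith [mul_nonneg e1 e3]

/-! ### Products -/

lemma exists_mul_L2 (f g : L2) {V : ℝ≥0∞} (hV : V ≠ ∞) (hg : ∀ᵐ x, ‖g x‖ₑ ≤ V) :
    ∃ p : L2, (p =ᵐ[volume] fun x => f x * g x) ∧ ‖p‖ₑ ≤ V * ‖f‖ₑ := by
  have hmeas : AEStronglyMeasurable (fun x => f x * g x) volume :=
    (Lp.aestronglyMeasurable f).mul (Lp.aestronglyMeasurable g)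
  have hb : eLpNorm (fun x => f x * g x) 2 volume ≤ V * eLpNorm f 2 volume := by
    rw [← ENNReal.coe_toNNReal hV]
    refine eLpNorm_le_nnreal_smul_eLpNorm_of_ae_le_mul' ?_ 2
    filter_upwards [hg] with x hx
    rw [enorm_mul, mul_comm, ENNReal.coe_toNNReal hV]
    gcongr
  have hp : MemLp (fun x => f x * g x) 2 volume :=
    ⟨hmeas, hb.trans_lt (ENNReal.mul_lt_top hV.lt_top (Lp.eLpNorm_lt_top f))⟩
  refine ⟨hp.toLp, hp.coeFn_toLp, ?_⟩
  rw [Lp.enorm_def, eLpNorm_congr_ae hp.coeFn_toLp, Lp.enorm_def]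
  exact hb

lemma ae_enorm_le (v : L2) : ∀ᵐ x, ‖v x‖ₑ ≤ eLpNorm v ∞ volume := by
  rw [eLpNorm_exponent_top]; exact enorm_ae_le_eLpNormEssSup v volume

lemma ae_shift {P : ℝ → Prop} (h : ∀ᵐ x, P x) (a : ℝ) : ∀ᵐ x, P (x + a) :=
  (measurePreserving_add_right volume a).quasiMeasurePreserving.ae h

lemma enorm_add_sq_le (a b : ℝ) : ‖a + b‖ₑ ^ 2 ≤ 2 * ‖a‖ₑ ^ 2 + 2 * ‖b‖ₑ ^ 2 := by
  simp only [← ofReal_norm]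
  rw [show (2 : ℝ≥0∞) = ENNReal.ofReal 2 by simp, ← ENNReal.ofReal_pow (norm_nonneg _),
    ← ENNReal.ofReal_pow (norm_nonneg _), ← ENNReal.ofReal_pow (norm_nonneg _),
    ← ENNReal.ofReal_mul (by norm_num), ← ENNReal.ofReal_mul (by norm_num),
    ← ENNReal.ofReal_add (by positivity) (by positivity)]
  refine ENNReal.ofReal_le_ofReal ?_
  simp only [Real.norm_eq_abs, sq_abs]
  nlinarith [sq_nonneg (a - b)]

/-- Boundedness of `v` puts `f` times the increment of `v` in `L²`, so Plancherel and the
convolution theorem apply, whatever `f` in `L²`. -/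
lemma enorm_sq_mul_translate_sub_le (f v : L2) (hv : eLpNorm v ∞ volume ≠ ∞) (h : ℝ) :
    ∫⁻ x, ‖f x‖ₑ ^ 2 * ‖v (x + h) - v x‖ₑ ^ 2 ≤
      N2 (convE (aHat f) fun θ => ENNReal.ofReal (osc (h * θ)) * aHat v θ) ^ 2 := by
  set q := translate h v - v
  have hq : q =ᵐ[volume] fun x => v (x + h) - v x := by
    filter_upwards [Lp.coeFn_sub (translate h v) v, translate_ae h v] with x h1 h2
    rw [h1, Pi.sub_apply, h2]
  have hqb : ∀ᵐ x, ‖q x‖ₑ ≤ eLpNorm v ∞ volume + eLpNorm v ∞ volume := by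
    filter_upwards [hq, ae_enorm_le v, ae_shift (ae_enorm_le v) h] with x h1 h2 h3
    rw [h1]
    exact enorm_sub_le.trans (add_le_add h3 h2)
  obtain ⟨r, hr, -⟩ := exists_mul_L2 f q (ENNReal.add_ne_top.2 ⟨hv, hv⟩) hqb
  have e1 : ∫⁻ x, ‖f x‖ₑ ^ 2 * ‖v (x + h) - v x‖ₑ ^ 2 = ‖r‖ₑ ^ 2 := by
    rw [enorm_sq_eq]
    refine lintegral_congr_ae ?_
    filter_upwards [hr, hq] with x h1 h2
    rw [h1, h2, enorm_mul, mul_pow]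
  rw [e1, enorm_sq_eq_aHat, N2_sq]
  refine lintegral_mono_ae ?_
  filter_upwards [hat_eq_prodHat hr] with ξ hξ
  unfold aHat
  rw [hξ]
  gcongr
  refine (enorm_prodHat_le f q ξ).trans (le_of_eq ?_)
  refine lintegral_congr_ae ?_
  have h1 := (Measure.measurePreserving_sub_left volume ξ).quasiMeasurePreserving.ae (aHat_translate_sub h v)
  filter_upwards [h1] with ζ hζ
  rw [hζ]; rfl

/-- The discrete Leibniz rule: an increment of `f` is paid for by the `L^∞` norm of `v`, and an
increment of `v` is left to the bilinear estimate `gagliardo_convE_le`. -/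
lemma enorm_translate_mul_sub_sq_le {f v p : L2} (hv : eLpNorm v ∞ volume ≠ ∞)
    (hp : p =ᵐ[volume] fun x => f x * v x) (h : ℝ) :
    ‖translate h p - p‖ₑ ^ 2 ≤ 2 * eLpNorm v ∞ volume ^ 2 * ‖translate h f - f‖ₑ ^ 2 +
      2 * N2 (convE (aHat f) fun θ => ENNReal.ofReal (osc (h * θ)) * aHat v θ) ^ 2 := by
  have hf2 : AEMeasurable (fun x => ‖f (x + h) - f x‖ₑ ^ 2) volume := by
    have := (memLp_translate f h).aestronglyMeasurable.sub (Lp.aestronglyMeasurable f)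
    exact this.enorm.pow_const 2
  refine le_trans ?_ (add_le_add le_rfl
    (mul_le_mul_right (enorm_sq_mul_translate_sub_le f v hv h) 2))
  rw [enorm_translate_sub_sq', enorm_translate_sub_sq', ← lintegral_const_mul'' _ hf2,
    ← lintegral_const_mul' _ _ (by norm_num), ← lintegral_add_left' (hf2.const_mul _)]
  refine lintegral_mono_ae ?_
  filter_upwards [hp, ae_shift hp h, ae_shift (ae_enorm_le v) h] with x h1 h2 h3
  rw [h1, h2, show f (x + h) * v (x + h) - f x * v x =
    (f (x + h) - f x) * v (x + h) + f x * (v (x + h) - v x) by ring]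
  refine (enorm_add_sq_le _ _).trans ?_
  rw [enorm_mul, enorm_mul, mul_pow, mul_pow]
  calc _ ≤ 2 * (‖f (x + h) - f x‖ₑ ^ 2 * eLpNorm v ∞ volume ^ 2) +
        2 * (‖f x‖ₑ ^ 2 * ‖v (x + h) - v x‖ₑ ^ 2) := by gcongr
    _ = _ := by ring

lemma enorm_translate_sq_sub_sq_le {v p : L2} (hp : p =ᵐ[volume] fun x => v x * v x) (h : ℝ) :
    ‖translate h p - p‖ₑ ^ 2 ≤ 4 * eLpNorm v ∞ volume ^ 2 * ‖translate h v - v‖ₑ ^ 2 := by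
  have hf2 : AEMeasurable (fun x => ‖v (x + h) - v x‖ₑ ^ 2) volume := by
    have := (memLp_translate v h).aestronglyMeasurable.sub (Lp.aestronglyMeasurable v)
    exact this.enorm.pow_const 2
  rw [enorm_translate_sub_sq', enorm_translate_sub_sq', ← lintegral_const_mul'' _ hf2]
  refine lintegral_mono_ae ?_
  filter_upwards [hp, ae_shift hp h, ae_enorm_le v, ae_shift (ae_enorm_le v) h] with x h1 h2 h3 h4
  rw [h1, h2, show v (x + h) * v (x + h) - v x * v x =
    (v (x + h) + v x) * (v (x + h) - v x) by ring, enorm_mul, mul_pow]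
  gcongr
  calc ‖v (x + h) + v x‖ₑ ^ 2 ≤ (eLpNorm v ∞ volume + eLpNorm v ∞ volume) ^ 2 := by
        gcongr; exact (enorm_add_le _ _).trans (add_le_add h4 h3)
    _ = _ := by ring

lemma gag_mul_le {s : ℝ} (h0 : 0 < s) (h1 : s < 1 / 2) {f v p : L2} (hv : eLpNorm v ∞ volume ≠ ∞)
    (hp : p =ᵐ[volume] fun x => f x * v x) :
    gag s p ≤ 2 * eLpNorm v ∞ volume ^ 2 * gag s f + 2 * (2 * cW s * cO s *
      (N2 (fun ξ => jE s ξ * aHat f ξ) ^ 2 * N2 (fun ξ => jE (1 / 2) ξ * aHat v ξ) ^ 2)) := by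
  have mr : Measurable fun h : ℝ => ENNReal.ofReal (|h| ^ (-1 - 2 * s)) :=
    (measurable_norm.pow_const _).ennreal_ofReal
  have mt : Measurable fun h : ℝ => ENNReal.ofReal (|h| ^ (-1 - 2 * s)) * ‖translate h f - f‖ₑ ^ 2 :=
    mr.mul (measurable_translate_sub f)
  calc gag s p ≤ ∫⁻ h, (2 * eLpNorm v ∞ volume ^ 2 *
        (ENNReal.ofReal (|h| ^ (-1 - 2 * s)) * ‖translate h f - f‖ₑ ^ 2) +
        2 * (ENNReal.ofReal (|h| ^ (-1 - 2 * s)) *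
          N2 (convE (aHat f) fun θ => ENNReal.ofReal (osc (h * θ)) * aHat v θ) ^ 2)) := by
        refine lintegral_mono fun h => ?_
        refine (mul_le_mul_right (enorm_translate_mul_sub_sq_le hv hp h) _).trans_eq ?_
        ring
    _ ≤ _ := by
        rw [lintegral_add_left (mt.const_mul _), lintegral_const_mul _ mt,
          lintegral_const_mul' _ _ (by norm_num)]
        gcongr
        · exact le_rfl
        · exact gagliardo_convE_le h0 h1 (measurable_aHat f) (measurable_aHat v)

lemma gag_sq_le (σ : ℝ) {v p : L2} (hp : p =ᵐ[volume] fun x => v x * v x) :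
    gag σ p ≤ 4 * eLpNorm v ∞ volume ^ 2 * gag σ v := by
  have mr : Measurable fun h : ℝ => ENNReal.ofReal (|h| ^ (-1 - 2 * σ)) :=
    (measurable_norm.pow_const _).ennreal_ofReal
  have mt : Measurable fun h : ℝ => ENNReal.ofReal (|h| ^ (-1 - 2 * σ)) * ‖translate h v - v‖ₑ ^ 2 :=
    mr.mul (measurable_translate_sub v)
  unfold gag
  rw [← lintegral_const_mul _ mt]
  refine lintegral_mono fun h => ?_
  refine (mul_le_mul_right (enorm_translate_sq_sub_sq_le hp h) _).trans_eq ?_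
  ring

lemma enorm_le_N2 {s : ℝ} (hs : 0 ≤ s) (f : L2) : ‖f‖ₑ ≤ N2 fun ξ => jE s ξ * aHat f ξ := by
  rw [← ofReal_norm, ← N2_aHat]
  exact N2_mono fun ξ => le_mul_of_one_le_left zero_le (one_le_jE hs ξ)

lemma le_of_sq_le_sq {a b : ℝ≥0∞} (h : a ^ 2 ≤ b ^ 2) : a ≤ b := by
  rw [← ENNReal.sq_rpow_half a, ← ENNReal.sq_rpow_half b]
  gcongr

/-- For `0 < s < 1/2`, functions in `H^{1/2} ∩ L^∞` multiply `H^s`. The Gagliardo seminorm of the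
product controls the `H^s` norm once its `L²` norm is known. -/
lemma exists_N2_mul_le {s : ℝ} (h0 : 0 < s) (h1 : s < 1 / 2) : ∃ D : ℝ≥0∞, D ≠ ∞ ∧
    ∀ f v p : L2, eLpNorm v ∞ volume ≠ ∞ → (p =ᵐ[volume] fun x => f x * v x) →
      N2 (fun ξ => jE s ξ * aHat p ξ) ≤
        D * ((N2 (fun ξ => jE (1 / 2) ξ * aHat v ξ) + eLpNorm v ∞ volume) *
          N2 fun ξ => jE s ξ * aHat f ξ) := by
  set c : ℝ≥0∞ := ENNReal.ofReal ((2 * Real.pi) ^ (2 * s)) * (cG s)⁻¹ with hc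
  have hcG := cG_lt_top h0 (by linarith)
  have hct : c ≠ ∞ := ENNReal.mul_ne_top ENNReal.ofReal_ne_top (ENNReal.inv_ne_top.2 (cG_pos h0).ne')
  set d : ℝ≥0∞ := 1 + c * (2 * cG s) + c * (2 * (2 * cW s * cO s)) with hd
  have hdt : d ≠ ∞ := by
    have h2 : (2 : ℝ≥0∞) ≠ ∞ := by norm_num
    have := (cW_lt_top h0 h1).ne
    have := (cO_lt_top h0 h1).ne
    have := hcG.ne
    rw [hd]
    simp only [ne_eq, ENNReal.add_eq_top, ENNReal.mul_eq_top, not_or]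
    simp_all
  refine ⟨d ^ (1 / 2 : ℝ), ENNReal.rpow_ne_top_of_nonneg (by norm_num) hdt,
    fun f v p hv hp => le_of_sq_le_sq ?_⟩
  rw [mul_pow, ENNReal.rpow_half_sq]
  set V := eLpNorm v ∞ volume with hV
  set H := N2 (fun ξ => jE (1 / 2) ξ * aHat v ξ)
  set F := N2 (fun ξ => jE s ξ * aHat f ξ)
  obtain ⟨p', hp', hn⟩ := exists_mul_L2 f v hv (ae_enorm_le v)
  have hpp : p = p' := Lp.ext (hp.trans hp'.symm)
  rw [← hpp] at hn
  have hg1 := gag_mul_le h0 h1 hv hp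
  have hg2 := gag_le h0.le f
  calc _ ≤ ‖p‖ₑ ^ 2 + c * gag s p := N2_sq_le_gag h0 (by linarith) p
    _ ≤ (V * F) ^ 2 + c * (2 * V ^ 2 * (cG s * F ^ 2) + 2 * (2 * cW s * cO s * (F ^ 2 * H ^ 2))) := by
        gcongr
        · exact hn.trans (by gcongr; exact enorm_le_N2 h0.le f)
        · exact hg1.trans (by gcongr)
    _ = (1 + c * (2 * cG s)) * (V ^ 2 * F ^ 2) + c * (2 * (2 * cW s * cO s)) * (H ^ 2 * F ^ 2) := by
        ring
    _ ≤ (1 + c * (2 * cG s)) * ((H + V) ^ 2 * F ^ 2) +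
        c * (2 * (2 * cW s * cO s)) * ((H + V) ^ 2 * F ^ 2) := by
        gcongr
        · exact le_add_self
        · exact le_self_add
    _ = _ := by rw [hd]; ring

/-- For a square the increment factors as `(v(x+h) + v(x)) (v(x+h) - v(x))`, so the `L^∞` norm alone
suffices and no bilinear estimate is required. -/
lemma exists_N2_sq_le {r : ℝ} (h0 : 0 < r) (h1 : r < 1) : ∃ D : ℝ≥0∞, D ≠ ∞ ∧
    ∀ v p : L2, eLpNorm v ∞ volume ≠ ∞ → (p =ᵐ[volume] fun x => v x * v x) →
      N2 (fun ξ => jE r ξ * aHat p ξ) ≤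
        D * (eLpNorm v ∞ volume * N2 fun ξ => jE r ξ * aHat v ξ) := by
  set c : ℝ≥0∞ := ENNReal.ofReal ((2 * Real.pi) ^ (2 * r)) * (cG r)⁻¹ with hc
  have hcG := cG_lt_top h0 h1
  have hct : c ≠ ∞ := ENNReal.mul_ne_top ENNReal.ofReal_ne_top (ENNReal.inv_ne_top.2 (cG_pos h0).ne')
  set d : ℝ≥0∞ := 1 + c * (4 * cG r) with hd
  have hdt : d ≠ ∞ := by
    have := hcG.ne
    rw [hd]
    simp only [ne_eq, ENNReal.add_eq_top, ENNReal.mul_eq_top, not_or]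
    simp_all
  refine ⟨d ^ (1 / 2 : ℝ), ENNReal.rpow_ne_top_of_nonneg (by norm_num) hdt,
    fun v p hv hp => le_of_sq_le_sq ?_⟩
  rw [mul_pow, ENNReal.rpow_half_sq]
  set V := eLpNorm v ∞ volume with hV
  set F := N2 (fun ξ => jE r ξ * aHat v ξ)
  obtain ⟨p', hp', hn⟩ := exists_mul_L2 v v hv (ae_enorm_le v)
  have hpp : p = p' := Lp.ext (hp.trans hp'.symm)
  rw [← hpp] at hn
  have hg1 := gag_sq_le r hp
  have hg2 := gag_le h0.le v
  calc _ ≤ ‖p‖ₑ ^ 2 + c * gag r p := N2_sq_le_gag h0 h1 p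
    _ ≤ (V * F) ^ 2 + c * (4 * V ^ 2 * (cG r * F ^ 2)) := by
        gcongr
        · exact hn.trans (by gcongr; exact enorm_le_N2 h0.le v)
        · exact hg1.trans (by gcongr)
    _ = _ := by rw [hd]; ring

lemma exists_flux_le_of_lt_half {s : ℝ} (h0 : 0 < s) (h1 : s < 1 / 2) : ∃ C : ℝ, 0 < C ∧
    ∀ f g : L2, MemH s f → MemH (s + 1 / 2) g →
    flux s f g ≤ ENNReal.ofReal (C * (normH (1 / 2) g + normLinfty g) * normX s f g ^ 2) := by
  obtain ⟨D, hD, hDle⟩ := exists_N2_mul_le h0 h1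
  -- The second component has regularity `s + 1/2`, and first differences detect only orders below
  -- `1`. This is one use of `s < 1/2`.
  obtain ⟨E, hE, hEle⟩ := exists_N2_sq_le (r := s + 1 / 2) (by linarith) (by linarith)
  have h4 : (4 : ℝ≥0∞) ≠ ∞ := by norm_num
  have hDE : D + 4 * E ≠ ∞ := ENNReal.add_ne_top.2 ⟨hD, ENNReal.mul_ne_top h4 hE⟩
  refine ⟨(D + 4 * E).toReal + 1, by positivity, fun f g hf hg => ?_⟩
  have hVt := (memLp_top h0 hg).eLpNorm_ne_top
  obtain ⟨p, hp, -⟩ := exists_mul_L2 f g hVt (ae_enorm_le g)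
  obtain ⟨q, hq, -⟩ := exists_mul_L2 g g hVt (ae_enorm_le g)
  have hV : eLpNorm g ∞ volume = ENNReal.ofReal (normLinfty g) := (ENNReal.ofReal_toReal hVt).symm
  have hX : N2 (fun ξ => jE s ξ * aHat f ξ) ≤ ENNReal.ofReal (normX s f g) := by
    rw [N2_jE_aHat hf]; exact ENNReal.ofReal_le_ofReal (normH_le_normX s f g)
  have hY : N2 (fun ξ => jE (s + 1 / 2) ξ * aHat g ξ) ≤ 2 * ENNReal.ofReal (normX s f g) := by
    rw [N2_jE_aHat hg, show (2 : ℝ≥0∞) = ENNReal.ofReal 2 by simp,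
      ← ENNReal.ofReal_mul (by norm_num)]
    exact ENNReal.ofReal_le_ofReal (normH_half_le_normX hg f)
  have hH : N2 (fun ξ => jE (1 / 2) ξ * aHat g ξ) = ENNReal.ofReal (normH (1 / 2) g) :=
    N2_jE_aHat (hg.mono (by linarith))
  have hDle := hDle f g p hVt hp
  have hEle := hEle g q hVt hq
  rw [hH, hV] at hDle
  rw [hV] at hEle
  set X := ENNReal.ofReal (normX s f g)
  set H := ENNReal.ofReal (normH (1 / 2) g)
  set V := ENNReal.ofReal (normLinfty g)
  have mm : ∀ (r : ℝ) (u : L2), Measurable fun ξ => jE r ξ * aHat u ξ :=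
    fun r u => (measurable_jE r).mul (measurable_aHat u)
  have e1 : ∫⁻ ξ, jE (2 * s) ξ * (‖hat f ξ‖ₑ * ‖prodHat f g ξ‖ₑ) ≤ D * ((H + V) * X ^ 2) := by
    calc _ = ∫⁻ ξ, (jE s ξ * aHat f ξ) * (jE s ξ * aHat p ξ) := by
          refine lintegral_congr_ae ?_
          filter_upwards [hat_eq_prodHat hp] with ξ hξ
          rw [two_mul, ← jE_add, ← hξ]
          simp only [aHat]; ring
      _ ≤ _ := lintegral_mul_le_N2 (mm s f) (mm s p)
      _ ≤ X * (D * ((H + V) * X)) := by gcongr; exact hDle.trans (by gcongr)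
      _ = _ := by ring
  have e2 : ∫⁻ ξ, jE (2 * s + 1) ξ * (‖hat g ξ‖ₑ * ‖prodHat g g ξ‖ₑ) ≤
      4 * E * ((H + V) * X ^ 2) := by
    calc _ = ∫⁻ ξ, (jE (s + 1 / 2) ξ * aHat g ξ) * (jE (s + 1 / 2) ξ * aHat q ξ) := by
          refine lintegral_congr_ae ?_
          filter_upwards [hat_eq_prodHat hq] with ξ hξ
          rw [show 2 * s + 1 = (s + 1 / 2) + (s + 1 / 2) by ring, ← jE_add, ← hξ]
          simp only [aHat]; ring
      _ ≤ _ := lintegral_mul_le_N2 (mm _ g) (mm _ q)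
      _ ≤ 2 * X * (E * (V * (2 * X))) := by gcongr; exact hEle.trans (by gcongr)
      _ = 4 * E * (V * X ^ 2) := by ring
      _ ≤ _ := by gcongr; exact le_add_self
  calc flux s f g ≤ (D + 4 * E) * ((H + V) * X ^ 2) := by
        rw [add_mul]; exact add_le_add e1 e2
    _ = ENNReal.ofReal ((D + 4 * E).toReal * (normH (1 / 2) g + normLinfty g) *
        normX s f g ^ 2) := by
        rw [mul_assoc, ENNReal.ofReal_mul ENNReal.toReal_nonneg, ENNReal.ofReal_toReal hDE,
          ENNReal.ofReal_mul (add_nonneg (normH_nonneg _ _) (normLinfty_nonneg _)),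
          ENNReal.ofReal_pow (normX_nonneg _ _ _),
          ENNReal.ofReal_add (normH_nonneg _ _) (normLinfty_nonneg _)]
    _ ≤ _ := by
        refine ENNReal.ofReal_le_ofReal ?_
        have := add_nonneg (normH_nonneg (1 / 2) g) (normLinfty_nonneg g)
        gcongr; linarith

/-! ### Multilinear estimates in the energy space -/

/-- The indicator of `|ξ| ≤ N < |θ|`. -/
def regE (N ξ θ : ℝ) : ℝ≥0∞ := if |ξ| ≤ N ∧ N < |θ| then 1 else 0

lemma measurable_regE (N : ℝ) : Measurable fun p : ℝ × ℝ => regE N p.1 p.2 :=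
  Measurable.ite ((measurableSet_le measurable_fst.norm measurable_const).inter
    (measurableSet_lt measurable_const measurable_snd.norm)) measurable_const measurable_const

lemma regE_sq (N ξ θ : ℝ) : regE N ξ θ ^ 2 = regE N ξ θ := by
  unfold regE; split_ifs <;> simp

/-- If `|ξ| ≤ N < |ξ - ζ|`, then `ξ` lies within `|ζ|` of `N` or of `-N`: two intervals, of length
independent of `N`. -/
lemma lintegral_regE_le (N ζ : ℝ) : ∫⁻ ξ, regE N ξ (ξ - ζ) ≤ ENNReal.ofReal (2 * |ζ|) := by
  calc ∫⁻ ξ, regE N ξ (ξ - ζ)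
      ≤ ∫⁻ ξ, (Set.Icc (-N) (-N + |ζ|) ∪ Set.Icc (N - |ζ|) N).indicator 1 ξ := by
        refine lintegral_mono fun ξ => ?_
        unfold regE
        split_ifs with h
        · rw [Set.indicator_of_mem]; · rfl
          obtain ⟨h1, h2⟩ := h
          rw [abs_le] at h1
          rcases lt_abs.1 h2 with h2 | h2
          · exact Or.inr ⟨by linarith [neg_abs_le ζ], h1.2⟩
          · exact Or.inl ⟨h1.1, by linarith [le_abs_self ζ]⟩
        · exact zero_le
    _ = volume (Set.Icc (-N) (-N + |ζ|) ∪ Set.Icc (N - |ζ|) N) := by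
        rw [lintegral_indicator_one (measurableSet_Icc.union measurableSet_Icc)]
    _ ≤ ENNReal.ofReal |ζ| + ENNReal.ofReal |ζ| := by
        refine (measure_union_le _ _).trans (le_of_eq ?_)
        rw [Real.volume_Icc, Real.volume_Icc]; congr 2 <;> ring
    _ = _ := by rw [← ENNReal.ofReal_add (abs_nonneg _) (abs_nonneg _)]; congr 1; ring

lemma ofReal_abs_le_jE (ζ : ℝ) : ENNReal.ofReal |ζ| ≤ jE 1 ζ := by
  have := rpow_le_jE_sq (σ := 1 / 2) (by norm_num) ζ
  rwa [show (2 * (1 / 2) : ℝ) = 1 by norm_num, Real.rpow_one, jE_pow_two,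
    show (2 * (1 / 2) : ℝ) = 1 by norm_num] at this

lemma jE_neg_one_mul_abs_le (ζ : ℝ) : jE (-1) ζ * ENNReal.ofReal (2 * |ζ|) ≤ 2 := by
  calc _ ≤ jE (-1) ζ * (2 * jE 1 ζ) := by
        rw [ENNReal.ofReal_mul (by norm_num), ENNReal.ofReal_ofNat]
        gcongr; exact ofReal_abs_le_jE ζ
    _ = 2 * (jE (-1) ζ * jE 1 ζ) := by ring
    _ = 2 := by rw [jE_neg_mul, mul_one]

/-- The restriction to low frequencies. -/
def loE (N : ℝ) (A : ℝ → ℝ≥0∞) : ℝ → ℝ≥0∞ := (Set.Icc (-N) N).indicator A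

/-- The restriction to high frequencies. -/
def hiE (N : ℝ) (A : ℝ → ℝ≥0∞) : ℝ → ℝ≥0∞ := (Set.Icc (-N) N)ᶜ.indicator A

variable {N : ℝ} {A B : ℝ → ℝ≥0∞}

lemma loE_le (ξ : ℝ) : loE N A ξ ≤ A ξ := Set.indicator_le_self (Set.Icc (-N) N) A ξ

lemma measurable_hiE (hA : Measurable A) : Measurable (hiE N A) := hA.indicator measurableSet_Icc.compl

lemma loE_mul_hiE_le (ξ θ : ℝ) : loE N A ξ * hiE N B θ ≤ regE N ξ θ * (A ξ * hiE N B θ) := by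
  by_cases h1 : |ξ| ≤ N
  · by_cases h2 : N < |θ|
    · rw [regE, if_pos ⟨h1, h2⟩, one_mul]; gcongr; exact loE_le ξ
    · rw [hiE, Set.indicator_of_notMem (show θ ∉ (Set.Icc (-N) N)ᶜ from
        fun h => h (abs_le.1 (not_lt.1 h2)))]; simp
  · rw [loE, Set.indicator_of_notMem (show ξ ∉ Set.Icc (-N) N from fun h => h1 (abs_le.2 h))]; simp

/-- Half a derivative on `B` misses integrability by a logarithm. For a fixed difference `θ` of the
low and the high frequency, the set of admissible frequencies has measure at most `2 |θ|`, and
`⟨θ⟩⁻¹` compensates this exactly. -/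
lemma tri_lo_hi_le (hA : Measurable A) (hB : Measurable B) :
    tri (fun _ _ => 1) (loE N A) (hiE N A) B ≤
      2 ^ (1 / 2 : ℝ) * (N2 A * N2 (hiE N A) * N2 fun θ => jE (1 / 2) θ * B θ) := by
  have hjB : Measurable fun θ => jE (1 / 2) θ * B θ := (measurable_jE _).mul hB
  refine (tri_mono (K' := fun ξ ζ => regE N ξ ζ * jE (-(1 / 2)) (ξ - ζ)) (f' := A)
    (g' := hiE N A) (h' := fun θ => jE (1 / 2) θ * B θ) fun ξ ζ => ?_).trans
    (tri_le_diff ((measurable_regE N).mul (measurable_jE_comp _ (by fun_prop))) hA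
      (measurable_hiE hA) hjB fun θ => ?_)
  · have h1 := loE_mul_hiE_le (N := N) (A := A) (B := A) ξ ζ
    calc 1 * (loE N A ξ * hiE N A ζ * B (ξ - ζ))
        ≤ 1 * (regE N ξ ζ * (A ξ * hiE N A ζ) * B (ξ - ζ)) := by gcongr
      _ = 1 * (regE N ξ ζ * (A ξ * hiE N A ζ) *
          (jE (-(1 / 2)) (ξ - ζ) * jE (1 / 2) (ξ - ζ) * B (ξ - ζ))) := by
          rw [jE_neg_mul, one_mul (B _)]
      _ = _ := by ring
  · have e : ∫⁻ ζ, (regE N (ζ + θ) ζ * jE (-(1 / 2)) (ζ + θ - ζ)) ^ 2 =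
        jE (-1) θ * ∫⁻ ζ, regE N (ζ + θ) ζ := by
      have hm : Measurable fun ζ => regE N (ζ + θ) ζ :=
        (measurable_regE N).comp (f := fun ζ : ℝ => (ζ + θ, ζ)) (by fun_prop)
      rw [← lintegral_const_mul _ hm]
      congr 1; ext ζ
      rw [mul_pow, regE_sq, add_sub_cancel_left, jE_pow_two, mul_comm]; congr 2; norm_num
    have e2 : ∫⁻ ζ, regE N (ζ + θ) ζ = ∫⁻ ξ, regE N ξ (ξ - θ) := by
      rw [← lintegral_add_right_eq_self (fun ξ => regE N ξ (ξ - θ)) θ]; simp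
    rw [e, e2]
    exact (mul_le_mul_right (lintegral_regE_le N θ) _).trans (jE_neg_one_mul_abs_le θ)

/-- Of the full derivative on the low frequency, one half stays there and the other half moves to
the high frequency, which is larger. The measure argument of `tri_lo_hi_le` handles the third
factor. -/
lemma tri_jE_lo_hi_le (hA : Measurable A) (hB : Measurable B) :
    tri (fun ξ _ => jE 1 ξ) (loE N B) A (hiE N B) ≤
      2 ^ (1 / 2 : ℝ) * ((N2 fun θ => jE (1 / 2) θ * B θ) * (N2 fun θ => jE (1 / 2) θ * A θ) *
        N2 fun θ => jE (1 / 2) θ * hiE N B θ) := by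
  have hjA : Measurable fun θ => jE (1 / 2) θ * A θ := (measurable_jE _).mul hA
  have hjB : Measurable fun θ => jE (1 / 2) θ * B θ := (measurable_jE _).mul hB
  have hjH : Measurable fun θ => jE (1 / 2) θ * hiE N B θ := (measurable_jE _).mul (measurable_hiE hB)
  have mR : Measurable fun p : ℝ × ℝ => regE N p.1 (p.1 - p.2) :=
    (measurable_regE N).comp (f := fun p : ℝ × ℝ => (p.1, p.1 - p.2)) (by fun_prop)
  refine (tri_mono (K' := fun ξ ζ => regE N ξ (ξ - ζ) * jE (-(1 / 2)) ζ)
    (f' := fun θ => jE (1 / 2) θ * B θ) (g' := fun θ => jE (1 / 2) θ * A θ)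
    (h' := fun θ => jE (1 / 2) θ * hiE N B θ) fun ξ ζ => ?_).trans
    (tri_le_snd (mR.mul (measurable_jE_comp _ (by fun_prop))) hjB hjA hjH fun ζ => ?_)
  · have h1 := loE_mul_hiE_le (N := N) (A := B) (B := B) ξ (ξ - ζ)
    have h2 : regE N ξ (ξ - ζ) * jE (1 / 2) ξ ≤ regE N ξ (ξ - ζ) * jE (1 / 2) (ξ - ζ) := by
      unfold regE
      split_ifs with h
      · gcongr
        unfold jE
        refine ENNReal.ofReal_le_ofReal (symJ_mono_abs (by norm_num) ?_)
        rw [abs_mul _ ξ, abs_mul _ (ξ - ζ)]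
        exact mul_le_mul_of_nonneg_left (h.1.trans h.2.le) (abs_nonneg _)
      · simp
    have h3 : jE 1 ξ = jE (1 / 2) ξ * jE (1 / 2) ξ := by rw [jE_add]; norm_num
    calc jE 1 ξ * (loE N B ξ * A ζ * hiE N B (ξ - ζ))
        = jE 1 ξ * (loE N B ξ * hiE N B (ξ - ζ)) * A ζ := by ring
      _ ≤ jE 1 ξ * (regE N ξ (ξ - ζ) * (B ξ * hiE N B (ξ - ζ))) * A ζ := by gcongr
      _ = (regE N ξ (ξ - ζ) * jE (1 / 2) ξ) * (jE (1 / 2) ξ * B ξ) * A ζ * hiE N B (ξ - ζ) := by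
          rw [h3]; ring
      _ ≤ (regE N ξ (ξ - ζ) * jE (1 / 2) (ξ - ζ)) * (jE (1 / 2) ξ * B ξ) *
          (jE (-(1 / 2)) ζ * jE (1 / 2) ζ * A ζ) * hiE N B (ξ - ζ) := by
          rw [jE_neg_mul, one_mul]; gcongr
      _ = _ := by ring
  · have e : ∫⁻ ξ, (regE N ξ (ξ - ζ) * jE (-(1 / 2)) ζ) ^ 2 = jE (-1) ζ * ∫⁻ ξ, regE N ξ (ξ - ζ) := by
      have hm : Measurable fun ξ => regE N ξ (ξ - ζ) :=
        (measurable_regE N).comp (f := fun ξ : ℝ => (ξ, ξ - ζ)) (by fun_prop)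
      rw [← lintegral_const_mul _ hm]
      congr 1; ext ξ
      rw [mul_pow, regE_sq, jE_pow_two, mul_comm]; congr 2; norm_num
    rw [e]
    exact (mul_le_mul_right (lintegral_regE_le N ζ) _).trans (jE_neg_one_mul_abs_le ζ)

/-! ### Commutators with the symbol `tanh` -/

/-- The constant `∫ ⟨κ⟩⁻²`. -/
def c2 : ℝ≥0∞ := ∫⁻ ξ, jE (-2) ξ

lemma c2_lt_top : c2 < ∞ := lintegral_jE_lt_top (by norm_num)

lemma one_sub_abs_tanh_le (κ : ℝ) : 1 - |Real.tanh κ| ≤ symJ (-2) κ := by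
  have h1 := abs_tanh_le_one κ
  have h2 : 1 - |Real.tanh κ| ≤ 1 - Real.tanh κ ^ 2 := by
    rw [← sq_abs]; nlinarith [abs_nonneg (Real.tanh κ)]
  have hc := Real.cosh_pos κ
  have h3 : 1 - Real.tanh κ ^ 2 = (Real.cosh κ ^ 2)⁻¹ := by
    rw [Real.tanh_eq_sinh_div_cosh]
    field_simp
    linarith [Real.cosh_sq κ]
  have h4 : symJ (-2) κ = (1 + κ ^ 2)⁻¹ := by
    rw [symJ, ← Real.rpow_neg_one]; norm_num
  have h5 : 1 + κ ^ 2 ≤ Real.cosh κ ^ 2 := by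
    have h6 := abs_le_abs_sinh κ
    have h7 : κ ^ 2 ≤ Real.sinh κ ^ 2 := sq_le_sq.2 h6
    linarith [Real.cosh_sq κ]
  rw [h4]
  refine h2.trans (h3.le.trans ?_)
  exact inv_anti₀ (by positivity) h5

lemma abs_tanh_sub_le {x y : ℝ} (h : 0 ≤ x * y) :
    |Real.tanh x - Real.tanh y| ≤ symJ (-2) x + symJ (-2) y := by
  have hx := one_sub_abs_tanh_le x
  have hy := one_sub_abs_tanh_le y
  have hx1 := abs_tanh_le_one x
  have hy1 := abs_tanh_le_one y
  have px := (symJ_pos (-2) x).le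
  have py := (symJ_pos (-2) y).le
  rcases mul_nonneg_iff.1 h with ⟨h1, h2⟩ | ⟨h1, h2⟩
  · have e1 : 0 ≤ Real.tanh x := by
      rw [Real.tanh_eq_sinh_div_cosh]; exact div_nonneg (Real.sinh_nonneg_iff.2 h1) (Real.cosh_pos x).le
    have e2 : 0 ≤ Real.tanh y := by
      rw [Real.tanh_eq_sinh_div_cosh]; exact div_nonneg (Real.sinh_nonneg_iff.2 h2) (Real.cosh_pos y).le
    rw [abs_of_nonneg e1] at *
    rw [abs_of_nonneg e2] at *
    rw [abs_le]; constructor <;> linarith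
  · have e1 : Real.tanh x ≤ 0 := by
      rw [Real.tanh_eq_sinh_div_cosh]
      exact div_nonpos_of_nonpos_of_nonneg (Real.sinh_nonpos_iff.2 h1) (Real.cosh_pos x).le
    have e2 : Real.tanh y ≤ 0 := by
      rw [Real.tanh_eq_sinh_div_cosh]
      exact div_nonpos_of_nonpos_of_nonneg (Real.sinh_nonpos_iff.2 h2) (Real.cosh_pos y).le
    rw [abs_of_nonpos e1] at *
    rw [abs_of_nonpos e2] at *
    rw [abs_le]; constructor <;> linarith

lemma enorm_symT_sub (ξ ζ : ℝ) : ‖symT ξ - symT ζ‖ₑ =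
    ENNReal.ofReal |Real.tanh (2 * Real.pi * ξ) - Real.tanh (2 * Real.pi * ζ)| := by
  rw [← ofReal_norm, symT, symT, ← mul_sub, norm_mul, norm_neg, Complex.norm_I, one_mul,
    ← Complex.ofReal_sub, Complex.norm_real, Real.norm_eq_abs]

/-- `tanh` is close to the sign function. The frequencies `ζ` and `ζ + θ` have the same sign unless
`|ζ| ≤ |θ|`, where the trivial bound `2` is used; elsewhere the difference is integrable in `ζ`. -/
lemma enorm_symT_sub_sq_le (θ ζ : ℝ) : ‖symT (ζ + θ) - symT ζ‖ₑ ^ 2 ≤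
    4 * (Set.Icc (-|θ|) |θ|).indicator 1 ζ + 2 * (jE (-2) (ζ + θ) + jE (-2) ζ) := by
  have h2 : ‖symT (ζ + θ) - symT ζ‖ₑ ≤ 2 := by
    refine enorm_sub_le.trans ((add_le_add (enorm_symT_le _) (enorm_symT_le _)).trans_eq ?_)
    norm_num
  by_cases h : |ζ| ≤ |θ|
  · rw [Set.indicator_of_mem (show ζ ∈ Set.Icc (-|θ|) |θ| from abs_le.1 h)]
    refine le_add_right ?_
    calc _ ≤ (2 : ℝ≥0∞) ^ 2 := by gcongr
      _ = _ := by norm_num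
  · have hs : 0 ≤ (2 * Real.pi * (ζ + θ)) * (2 * Real.pi * ζ) := by
      have h1 : 0 ≤ (ζ + θ) * ζ := by
        have h3 : |θ * ζ| ≤ ζ ^ 2 := by
          rw [abs_mul, ← sq_abs ζ, sq]
          exact mul_le_mul_of_nonneg_right (not_le.1 h).le (abs_nonneg _)
        nlinarith [neg_abs_le (θ * ζ)]
      calc (0 : ℝ) ≤ (2 * Real.pi) ^ 2 * ((ζ + θ) * ζ) := mul_nonneg (sq_nonneg _) h1
        _ = _ := by ring
    refine le_add_left ?_
    have h3 : ‖symT (ζ + θ) - symT ζ‖ₑ ≤ jE (-2) (ζ + θ) + jE (-2) ζ := by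
      rw [enorm_symT_sub, jE, jE, ← ENNReal.ofReal_add (symJ_pos _ _).le (symJ_pos _ _).le]
      exact ENNReal.ofReal_le_ofReal (abs_tanh_sub_le hs)
    rw [sq]
    gcongr

lemma lintegral_enorm_symT_sub_le (θ : ℝ) :
    jE (-1) θ * ∫⁻ ζ, ‖symT (ζ + θ) - symT ζ‖ₑ ^ 2 ≤ 8 + 4 * c2 := by
  have hj1 : jE (-1) θ ≤ 1 := by rw [← jE_zero θ]; exact jE_mono (by norm_num) θ
  have m1 : Measurable fun ζ => jE (-2) (ζ + θ) := (measurable_jE _).comp (by fun_prop)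
  have m2 := measurable_jE (-2)
  have hI : ∫⁻ ζ, ‖symT (ζ + θ) - symT ζ‖ₑ ^ 2 ≤ 4 * ENNReal.ofReal (2 * |θ|) + 4 * c2 := by
    refine (lintegral_mono (enorm_symT_sub_sq_le θ)).trans (le_of_eq ?_)
    have mi : Measurable fun ζ => (4 : ℝ≥0∞) * (Set.Icc (-|θ|) |θ|).indicator (1 : ℝ → ℝ≥0∞) ζ :=
      (measurable_one.indicator measurableSet_Icc).const_mul 4
    rw [lintegral_add_left mi, lintegral_const_mul _ (measurable_one.indicator measurableSet_Icc),
      lintegral_indicator_one measurableSet_Icc, Real.volume_Icc, lintegral_const_mul _ (by fun_prop),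
      lintegral_add_left m1, lintegral_add_right_eq_self (fun ζ => jE (-2) ζ), ← c2,
      show |θ| - -|θ| = 2 * |θ| by ring]
    ring
  calc _ ≤ jE (-1) θ * (4 * ENNReal.ofReal (2 * |θ|) + 4 * c2) := by gcongr
    _ = 4 * (jE (-1) θ * ENNReal.ofReal (2 * |θ|)) + jE (-1) θ * (4 * c2) := by ring
    _ ≤ 4 * 2 + 1 * (4 * c2) := by gcongr; exact jE_neg_one_mul_abs_le θ
    _ = _ := by rw [one_mul]; norm_num

/-- For fixed `θ = ξ - ζ` the squared difference of symbols has integral `O(1 + |θ|)`, again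
balanced by `⟨θ⟩⁻¹`. The commutator thus closes with only half a derivative on `B`. -/
lemma tri_symT_le {A₁ A₂ : ℝ → ℝ≥0∞} (hA₁ : Measurable A₁) (hA₂ : Measurable A₂)
    (hB : Measurable B) :
    tri (fun ξ ζ => ‖symT ξ - symT ζ‖ₑ) A₁ A₂ B ≤
      (8 + 4 * c2) ^ (1 / 2 : ℝ) * (N2 A₁ * N2 A₂ * N2 fun θ => jE (1 / 2) θ * B θ) := by
  have hjB : Measurable fun θ => jE (1 / 2) θ * B θ := (measurable_jE _).mul hB
  have cT := contDiff_symT.continuous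
  have mT : Measurable fun p : ℝ × ℝ => ‖symT p.1 - symT p.2‖ₑ :=
    ((cT.comp continuous_fst).sub (cT.comp continuous_snd)).enorm.measurable
  refine (tri_mono (K' := fun ξ ζ => ‖symT ξ - symT ζ‖ₑ * jE (-(1 / 2)) (ξ - ζ)) (f' := A₁)
    (g' := A₂) (h' := fun θ => jE (1 / 2) θ * B θ) fun ξ ζ => le_of_eq ?_).trans
    (tri_le_diff (mT.mul (measurable_jE_comp _ (by fun_prop))) hA₁ hA₂ hjB fun θ => ?_)
  · calc _ = ‖symT ξ - symT ζ‖ₑ * (A₁ ξ * A₂ ζ *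
          (jE (-(1 / 2)) (ξ - ζ) * jE (1 / 2) (ξ - ζ) * B (ξ - ζ))) := by
          rw [jE_neg_mul, one_mul]
      _ = _ := by ring
  · refine le_trans (le_of_eq ?_) (lintegral_enorm_symT_sub_le θ)
    have m : Measurable fun ζ => ‖symT (ζ + θ) - symT ζ‖ₑ ^ 2 :=
      (((cT.comp (continuous_add_const θ)).sub cT).enorm.measurable).pow_const 2
    rw [← lintegral_const_mul _ m]
    congr 1; ext ζ
    rw [mul_pow, add_sub_cancel_left, jE_pow_two, mul_comm]; congr 2; norm_num

/-! ### The quartic estimate -/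

/-- The constant `(2 ∫ ⟨κ⟩^(-3/2))^(1/2)`. -/
def cM : ℝ≥0∞ := (2 * c32) ^ (1 / 2 : ℝ)

lemma cM_ne_top : cM ≠ ∞ := ENNReal.rpow_ne_top_of_nonneg (by norm_num)
    (ENNReal.mul_ne_top (by norm_num) c32_lt_top.ne)

lemma N2_jE_convE_le {B₁ B₂ : ℝ → ℝ≥0∞} (h₁ : Measurable B₁) (h₂ : Measurable B₂) :
    N2 (convE (fun θ => jE (1 / 4) θ * B₁ θ) B₂) ≤
      cM * ((N2 fun θ => jE (1 / 2) θ * B₁ θ) * N2 fun θ => jE (1 / 2) θ * B₂ θ) := by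
  have hj1 : Measurable fun θ => jE (1 / 2) θ * B₁ θ := (measurable_jE _).mul h₁
  have hj2 : Measurable fun θ => jE (1 / 2) θ * B₂ θ := (measurable_jE _).mul h₂
  have mK : Measurable fun p : ℝ × ℝ => jE (-(1 / 4)) p.2 * jE (-(1 / 2)) (p.1 - p.2) :=
    (measurable_jE_comp _ (by fun_prop)).mul (measurable_jE_comp _ (by fun_prop))
  refine le_trans (le_of_eq ?_) (N2_conv_le
    (K := fun ξ ζ => jE (-(1 / 4)) ζ * jE (-(1 / 2)) (ξ - ζ)) mK hj1 hj2 (M := 2 * c32) fun ξ => ?_)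
  · congr 1; ext ξ
    refine lintegral_congr fun ζ => ?_
    have e : jE (1 / 4) ζ = jE (-(1 / 4)) ζ * jE (1 / 2) ζ := by rw [jE_add]; norm_num
    calc jE (1 / 4) ζ * B₁ ζ * B₂ (ξ - ζ) = jE (-(1 / 4)) ζ * jE (1 / 2) ζ * B₁ ζ *
          (jE (-(1 / 2)) (ξ - ζ) * jE (1 / 2) (ξ - ζ) * B₂ (ξ - ζ)) := by rw [jE_neg_mul, one_mul, e]
      _ = _ := by ring
  · refine le_trans (le_of_eq ?_) (lintegral_jE_mul_le ξ)
    congr 1; ext ζ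
    rw [mul_pow, jE_pow_two, jE_pow_two]; norm_num

/-- A product of two `H^{1/2}` functions lies in `H^{1/4}`, and `1/4 + 1/2` is more than the half
derivative needed to pair it with a product of `F` in `L²` and `B₃` in `H^{1/2}`. -/
lemma quartic_le {F B₁ B₂ B₃ : ℝ → ℝ≥0∞} (hF : Measurable F) (h₁ : Measurable B₁)
    (h₂ : Measurable B₂) (h₃ : Measurable B₃) :
    ∫⁻ ξ, convE F B₃ ξ * convE B₁ B₂ ξ ≤ cM * (ENNReal.ofReal (2 ^ (1 / 4 : ℝ)) * (2 * cM)) *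
      (N2 F * ((N2 fun θ => jE (1 / 2) θ * B₁ θ) * (N2 fun θ => jE (1 / 2) θ * B₂ θ) *
        N2 fun θ => jE (1 / 2) θ * B₃ θ)) := by
  have hj3 : Measurable fun θ => jE (1 / 2) θ * B₃ θ := (measurable_jE _).mul h₃
  have mj := measurable_jE (1 / 4)
  have hj41 : Measurable fun θ => jE (1 / 4) θ * B₁ θ := mj.mul h₁
  have hj42 : Measurable fun θ => jE (1 / 4) θ * B₂ θ := mj.mul h₂
  have mc := measurable_convE h₁ h₂
  have mjc : Measurable fun ξ => jE (1 / 4) ξ * convE B₁ B₂ ξ := mj.mul mc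
  have mK : Measurable fun p : ℝ × ℝ => jE (-(1 / 4)) p.1 * jE (-(1 / 2)) (p.1 - p.2) :=
    (measurable_jE_comp _ (by fun_prop)).mul (measurable_jE_comp _ (by fun_prop))
  have hD : N2 (fun ξ => jE (1 / 4) ξ * convE B₁ B₂ ξ) ≤
      ENNReal.ofReal (2 ^ (1 / 4 : ℝ)) * (2 * cM) *
        ((N2 fun θ => jE (1 / 2) θ * B₁ θ) * N2 fun θ => jE (1 / 2) θ * B₂ θ) := by
    have m1 := measurable_convE hj41 h₂
    have m2 := measurable_convE hj42 h₁
    have key : ∀ ξ, jE (1 / 4) ξ * convE B₁ B₂ ξ ≤ ENNReal.ofReal (2 ^ (1 / 4 : ℝ)) *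
        (convE (fun θ => jE (1 / 4) θ * B₁ θ) B₂ ξ + convE (fun θ => jE (1 / 4) θ * B₂ θ) B₁ ξ) := by
      intro ξ
      rw [convE_comm (fun θ => jE (1 / 4) θ * B₂ θ) B₁]
      unfold convE
      rw [← lintegral_add_left (by fun_prop), ← lintegral_const_mul _ (by fun_prop),
        ← lintegral_const_mul _ (by fun_prop)]
      refine lintegral_mono fun ζ => ?_
      calc jE (1 / 4) ξ * (B₁ ζ * B₂ (ξ - ζ))
          ≤ ENNReal.ofReal (2 ^ (1 / 4 : ℝ)) * (jE (1 / 4) ζ + jE (1 / 4) (ξ - ζ)) *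
            (B₁ ζ * B₂ (ξ - ζ)) := by gcongr; exact jE_le_add (by norm_num) ξ ζ
        _ = _ := by ring
    have hmink : ∀ {f g : ℝ → ℝ≥0∞}, Measurable f → Measurable g →
        N2 (fun x => f x + g x) ≤ N2 f + N2 g := fun {f g} hf hg => by
      have := ENNReal.lintegral_Lp_add_le (μ := volume) (p := 2) hf.aemeasurable hg.aemeasurable
        (by norm_num)
      simpa [N2] using this
    refine (N2_mono key).trans ?_
    rw [N2_const_mul (f := fun ξ => convE (fun θ => jE (1 / 4) θ * B₁ θ) B₂ ξ +
      convE (fun θ => jE (1 / 4) θ * B₂ θ) B₁ ξ) _ (m1.add m2)]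
    calc _ ≤ ENNReal.ofReal (2 ^ (1 / 4 : ℝ)) *
          (N2 (convE (fun θ => jE (1 / 4) θ * B₁ θ) B₂) +
            N2 (convE (fun θ => jE (1 / 4) θ * B₂ θ) B₁)) := by gcongr; exact hmink m1 m2
      _ ≤ ENNReal.ofReal (2 ^ (1 / 4 : ℝ)) *
          (cM * ((N2 fun θ => jE (1 / 2) θ * B₁ θ) * N2 fun θ => jE (1 / 2) θ * B₂ θ) +
            cM * ((N2 fun θ => jE (1 / 2) θ * B₂ θ) * N2 fun θ => jE (1 / 2) θ * B₁ θ)) := by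
          gcongr
          · exact N2_jE_convE_le h₁ h₂
          · exact N2_jE_convE_le h₂ h₁
      _ = _ := by ring
  calc ∫⁻ ξ, convE F B₃ ξ * convE B₁ B₂ ξ = tri (fun _ _ => 1) (convE B₁ B₂) F B₃ := by
        rw [← lintegral_mul_convE hF h₃]; simp_rw [mul_comm]
    _ ≤ tri (fun ξ ζ => jE (-(1 / 4)) ξ * jE (-(1 / 2)) (ξ - ζ))
        (fun ξ => jE (1 / 4) ξ * convE B₁ B₂ ξ) F (fun θ => jE (1 / 2) θ * B₃ θ) := by
        refine tri_mono fun ξ ζ => le_of_eq ?_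
        calc 1 * (convE B₁ B₂ ξ * F ζ * B₃ (ξ - ζ)) =
            (jE (-(1 / 4)) ξ * jE (1 / 4) ξ) * (jE (-(1 / 2)) (ξ - ζ) * jE (1 / 2) (ξ - ζ)) *
              (convE B₁ B₂ ξ * F ζ * B₃ (ξ - ζ)) := by
              rw [jE_neg_mul, jE_neg_mul, one_mul, one_mul, one_mul]
          _ = _ := by ring
    _ ≤ cM * (N2 (fun ξ => jE (1 / 4) ξ * convE B₁ B₂ ξ) * N2 F *
        N2 fun θ => jE (1 / 2) θ * B₃ θ) := by
        refine tri_le_snd mK mjc hF hj3 fun ζ => ?_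
        refine le_trans (le_of_eq ?_) (lintegral_jE_mul_le ζ)
        congr 1; ext ξ
        rw [mul_pow, jE_pow_two, jE_pow_two, ← jE_neg_arg _ (ξ - ζ), neg_sub]
        norm_num
    _ ≤ cM * (ENNReal.ofReal (2 ^ (1 / 4 : ℝ)) * (2 * cM) *
        ((N2 fun θ => jE (1 / 2) θ * B₁ θ) * N2 fun θ => jE (1 / 2) θ * B₂ θ) * N2 F *
        N2 fun θ => jE (1 / 2) θ * B₃ θ) := by gcongr
    _ = _ := by ring

/-! ### The truncated Hamiltonian -/

/-- The real part of the inner product. -/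
def reIn (F G : LC) : ℝ := (inner ℂ F G).re

lemma reIn_comm (F G : LC) : reIn F G = reIn G F := by
  rw [reIn, reIn, ← inner_conj_symm, Complex.conj_re]

lemma reIn_add_right (F G H : LC) : reIn F (G + H) = reIn F G + reIn F H := by
  simp [reIn, inner_add_right]

lemma reIn_add_left (F G H : LC) : reIn (F + G) H = reIn F H + reIn G H := by
  simp [reIn, inner_add_left]

lemma reIn_sub_right (F G H : LC) : reIn F (G - H) = reIn F G - reIn F H := by
  simp [reIn, inner_sub_right]

lemma reIn_smul_right (F G : LC) (r : ℝ) : reIn F (r • G) = r * reIn F G := by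
  rw [reIn, inner_smul_right_eq_smul, Complex.real_smul, Complex.re_ofReal_mul]; rfl

lemma inner_mulOp_anti {m : ℝ → ℂ} (hm : Adm m) (h : ∀ ξ, (starRingEnd ℂ) (m ξ) = -m ξ)
    (F G : LC) : inner ℂ (mulOp m F) G = -inner ℂ F (mulOp m G) := by
  rw [L2.inner_def, L2.inner_def, ← integral_neg]
  refine integral_congr_ae ?_
  filter_upwards [mulOp_ae hm F, mulOp_ae hm G] with ξ h1 h2
  rw [h1, h2, RCLike.inner_apply, RCLike.inner_apply, map_mul, h ξ]; ring

lemma convOp_comm {m : ℝ → ℂ} (hm : Adm m) (F G : LC) : convOp m F G = convOp m G F := by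
  refine Lp.ext ?_
  filter_upwards [convOp_ae hm F G, convOp_ae hm G F] with ξ h1 h2
  rw [h1, h2, conv_comm]

/-- The Fourier transform of a real valued function. -/
def Herm (B : LC) : Prop := ∀ᵐ ξ, B (-ξ) = (starRingEnd ℂ) (B ξ)

lemma herm_hat (f : L2) : Herm (hat f) := hat_neg f

lemma Herm.sub {B B' : LC} (h : Herm B) (h' : Herm B') : Herm (B - B') := by
  have hn : Measure.QuasiMeasurePreserving (fun ξ : ℝ => -ξ) volume volume :=
    (Measure.measurePreserving_neg volume).quasiMeasurePreserving
  have e := Lp.coeFn_sub B B'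
  filter_upwards [h, h', e, hn.ae e] with ξ h1 h2 h3 h4
  rw [h3, h4, Pi.sub_apply, Pi.sub_apply, h1, h2, map_sub]

lemma Herm.mulOp {m : ℝ → ℂ} (hm : Adm m) (hc : ∀ ξ, m (-ξ) = (starRingEnd ℂ) (m ξ)) {B : LC}
    (h : Herm B) : Herm (mulOp m B) := by
  have hn : Measure.QuasiMeasurePreserving (fun ξ : ℝ => -ξ) volume volume :=
    (Measure.measurePreserving_neg volume).quasiMeasurePreserving
  have e := mulOp_ae hm B
  filter_upwards [h, e, hn.ae e] with ξ h1 h2 h3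
  rw [h2, h3, h1, hc, map_mul]

lemma Adm.integrable_mul {m : ℝ → ℂ} (hm : Adm m) (A : LC) : Integrable fun ξ => m ξ * A ξ :=
  hm.memLp.integrable_mul (Lp.memLp A)

/-- One integrable factor suffices for Fubini, since the convolution of two `L²` functions is
bounded. In `inner_convOp_symm` the truncation supplies that factor. -/
lemma integrable_triple {A : ℝ → ℂ} (hA : Integrable A) (hAm : StronglyMeasurable A) (B F : LC) :
    Integrable (fun p : ℝ × ℝ => A p.1 * (B p.2 * F (p.1 - p.2))) (volume.prod volume) := by
  have hB := Lp.stronglyMeasurable B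
  have hF := Lp.stronglyMeasurable F
  have hm : StronglyMeasurable fun p : ℝ × ℝ => A p.1 * (B p.2 * F (p.1 - p.2)) :=
    (hAm.comp_measurable measurable_fst).mul ((hB.comp_measurable measurable_snd).mul
      (hF.comp_measurable (measurable_fst.sub measurable_snd)))
  rw [integrable_prod_iff hm.aestronglyMeasurable]
  refine ⟨Eventually.of_forall fun ξ =>
    (integrable_conv' (Lp.memLp B) (Lp.memLp F) ξ).const_mul (A ξ), ?_⟩
  refine (hA.norm.mul_const (‖B‖ * ‖F‖)).mono' hm.norm.integral_prod_right'.aestronglyMeasurable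
    (Eventually.of_forall fun ξ => ?_)
  have h1 : ‖∫ ζ, ‖A ξ * (B ζ * F (ξ - ζ))‖‖ = ‖A ξ‖ * ∫ ζ, ‖B ζ * F (ξ - ζ)‖ := by
    rw [Real.norm_of_nonneg (integral_nonneg fun _ => norm_nonneg _), ← integral_const_mul]
    simp only [norm_mul]
  rw [h1]
  gcongr
  rw [← ENNReal.ofReal_le_ofReal_iff (by positivity),
    ofReal_integral_norm_eq_lintegral_enorm (integrable_conv' (Lp.memLp B) (Lp.memLp F) ξ)]
  have mB : Measurable fun ζ => ‖B ζ‖ₑ := hB.measurable.enorm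
  have mF : Measurable fun ζ => ‖F (ξ - ζ)‖ₑ := (hF.measurable.enorm).comp (by fun_prop)
  have h2 := lintegral_mul_le_N2 mB mF
  have h3 : N2 (fun ζ => ‖F (ξ - ζ)‖ₑ) = N2 (fun ζ => ‖F ζ‖ₑ) := by
    unfold N2; rw [lintegral_sub_left_eq_self (fun ζ => ‖F ζ‖ₑ ^ 2) ξ]
  rw [h3, ← eLpNorm_two, ← eLpNorm_two, ← Lp.enorm_def, ← Lp.enorm_def] at h2
  rw [ENNReal.ofReal_mul (norm_nonneg _), ofReal_norm, ofReal_norm]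
  simpa only [enorm_mul] using h2

/-- Convolution with the Fourier transform of a real function is symmetric. -/
lemma inner_convOp_symm {m : ℝ → ℂ} (hm : Adm m) (hr : ∀ ξ, (starRingEnd ℂ) (m ξ) = m ξ)
    {B : LC} (hB : Herm B) (A F : LC) :
    inner ℂ A (convOp m B (mulOp m F)) = inner ℂ (convOp m (mulOp m A) B) F := by
  set A' := mulOp m A with hA'
  set F' := mulOp m F with hF'
  have hA'i : Integrable fun ξ => (starRingEnd ℂ) (A' ξ) := by
    have := (integrable_congr (mulOp_ae hm A)).2 (hm.integrable_mul A)
    exact Complex.conjCLE.toContinuousLinearMap.integrable_comp this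
  have hA'm : StronglyMeasurable fun ξ => (starRingEnd ℂ) (A' ξ) := (Lp.stronglyMeasurable A').star
  have e1 : inner ℂ A (convOp m B F') =
      ∫ ξ, ∫ ζ, (starRingEnd ℂ) (A' ξ) * (F' ζ * B (ξ - ζ)) := by
    rw [L2.inner_def]
    refine integral_congr_ae ?_
    filter_upwards [convOp_ae hm B F', mulOp_ae hm A] with ξ h1 h2
    rw [h1, RCLike.inner_apply, h2, map_mul, hr, conv_comm, conv, ← integral_const_mul]
    simp_rw [← integral_mul_const]
    congr 1; ext ζ; ring
  have e2 : inner ℂ (convOp m A' B) F =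
      ∫ ζ, ∫ ξ, (starRingEnd ℂ) (A' ξ) * (F' ζ * B (ξ - ζ)) := by
    rw [L2.inner_def]
    refine integral_congr_ae ?_
    filter_upwards [convOp_ae hm A' B, mulOp_ae hm F] with ζ h1 h2
    have h3 : (starRingEnd ℂ) (conv A' B ζ) = ∫ ξ, (starRingEnd ℂ) (A' ξ) * B (ξ - ζ) := by
      rw [conv, ← integral_conj]
      refine integral_congr_ae ?_
      have hq : Measure.QuasiMeasurePreserving (fun ξ : ℝ => ζ - ξ) volume volume :=
        (Measure.measurePreserving_sub_left volume ζ).quasiMeasurePreserving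
      filter_upwards [hq.ae hB] with ξ h4
      rw [map_mul, ← h4, neg_sub]
    rw [h1, RCLike.inner_apply, map_mul, hr, h3, h2]
    rw [← mul_assoc, mul_comm (F ζ), ← integral_const_mul]
    congr 1; ext ξ; ring
  rw [e1, e2]
  exact integral_integral_swap (f := fun ξ ζ => (starRingEnd ℂ) (A' ξ) * (F' ζ * B (ξ - ζ)))
    (integrable_triple hA'i hA'm F' B)

/-- The projection to the frequencies `|ξ| ≤ N`. -/
def cutN (N : ℝ) : ℝ → ℂ := cut N (symJ 0)

lemma adm_cutN (N : ℝ) : Adm (cutN N) := adm_cut_symJ N 0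

lemma cutN_eq (N ξ : ℝ) : cutN N ξ = if |ξ| ≤ N then 1 else 0 := by
  unfold cutN cut
  split_ifs with h
  · rw [Set.indicator_of_mem (show ξ ∈ Set.Icc (-N) N from abs_le.1 h), symJ_zero, Complex.ofReal_one]
  · rw [Set.indicator_of_notMem (show ξ ∉ Set.Icc (-N) N from fun h' => h (abs_le.2 h'))]

lemma cutN_sq (N ξ : ℝ) : cutN N ξ * cutN N ξ = cutN N ξ := by
  rw [cutN_eq]; split_ifs <;> simp

lemma conj_cutN (N ξ : ℝ) : (starRingEnd ℂ) (cutN N ξ) = cutN N ξ := conj_cut _ _ _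

lemma cutN_neg (N ξ : ℝ) : cutN N (-ξ) = (starRingEnd ℂ) (cutN N ξ) := by
  rw [conj_cutN, cutN_eq, cutN_eq, abs_neg]

/-- The cubic part of the truncated Hamiltonian. -/
def cubic (N : ℝ) (f g : L2) : ℝ :=
  reIn (mulOp (cutN N) (hat f))
    (convOp (cutN N) (mulOp (cutN N) (hat g)) (mulOp (cutN N) (hat g)))

/-- The error in the conservation of the truncated Hamiltonian. -/
def defect (N : ℝ) (f g : L2) : ℝ :=
  let P := mulOp (cutN N)
  let c := convOp (cutN N)
  let T := mulOp fun ξ => cutN N ξ * symT ξ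
  let D := mulOp fun ξ => cutN N ξ * symD ξ
  let a := hat f
  let b := hat g
  reIn (P a) (T (c (P a) (b - P b)) - c (T (P a)) (b - P b)) + 2 * reIn (P a) (T (c (a - P a) b)) +
    (reIn (P b) (D (c b (b - P b))) + reIn (P b) (D (c (P b) (b - P b)))) +
    (reIn (c a b) (T (c b (b - P b) + c (P b) (b - P b))) -
      reIn (c (P a) (b - P b) + c (a - P a) b) (T (c b b)))

/-- The derivative of the truncated Hamiltonian. -/
def dHam (N : ℝ) (f g : L2) : ℝ :=
  let P := mulOp (cutN N)
  let c := convOp (cutN N)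
  2 * reIn (P (hat f)) (dEta (cutN N) f g) +
    2 * reIn (mulOp (cut N (symX 0)) (hat g)) (dV (cut N (symX 0)) f g) +
    (reIn (P (hat f)) (c (dV (cutN N) f g) (P (hat g)) + c (P (hat g)) (dV (cutN N) f g)) +
      reIn (dEta (cutN N) f g) (c (P (hat g)) (P (hat g))))

/-- The formal conservation law, with projections. The quadratic terms vanish by `linear_cancel`. If
the projections were absent, the cubic and quartic terms would cancel by skewness of `T` and `D` and
symmetry of convolution with the transform of a real function. What survives are differences between
projected and unprojected products, each with a factor `a - P a` or `b - P b`. -/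
lemma dHam_eq_defect (N : ℝ) (f g : L2) : dHam N f g = defect N f g := by
  have hP := adm_cutN N
  have hT := hP.mul_continuous contDiff_symT.continuous
  have hD := hP.mul_continuous contDiff_symD.continuous
  have hX := adm_cut_symX N 0
  have hXT := hX.mul_continuous contDiff_symT.continuous
  have cT : ∀ F G : LC, convOp (fun ξ => cutN N ξ * symT ξ) F G =
      mulOp (fun ξ => cutN N ξ * symT ξ) (convOp (cutN N) F G) := fun F G =>
    (mulOp_convOp hT hP hT (fun ξ => by rw [mul_right_comm, cutN_sq]) F G).symm
  have TP : ∀ F : LC, mulOp (fun ξ => cutN N ξ * symT ξ) (mulOp (cutN N) F) =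
      mulOp (fun ξ => cutN N ξ * symT ξ) F := fun F =>
    mulOp_mulOp hT hP hT (fun ξ => by rw [mul_right_comm, cutN_sq]) F
  have PT : ∀ F : LC, mulOp (cutN N) (mulOp (fun ξ => cutN N ξ * symT ξ) F) =
      mulOp (fun ξ => cutN N ξ * symT ξ) F := fun F =>
    mulOp_mulOp hP hT hT (fun ξ => by rw [← mul_assoc, cutN_sq]) F
  have DP : ∀ F : LC, mulOp (fun ξ => cutN N ξ * symD ξ) (mulOp (cutN N) F) =
      mulOp (fun ξ => cutN N ξ * symD ξ) F := fun F =>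
    mulOp_mulOp hD hP hD (fun ξ => by rw [mul_right_comm, cutN_sq]) F
  have PP : ∀ F : LC, mulOp (cutN N) (mulOp (cutN N) F) = mulOp (cutN N) F := fun F =>
    mulOp_mulOp hP hP hP (cutN_sq N) F
  have Ta : ∀ F G : LC, reIn (mulOp (fun ξ => cutN N ξ * symT ξ) F) G =
      -reIn F (mulOp (fun ξ => cutN N ξ * symT ξ) G) := fun F G => by
    rw [reIn, inner_mulOp_anti hT (fun ξ => by
      rw [map_mul, conj_cutN, conj_symT, mul_neg]), Complex.neg_re]; rfl
  have Da : ∀ F G : LC, reIn (mulOp (fun ξ => cutN N ξ * symD ξ) F) G =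
      -reIn F (mulOp (fun ξ => cutN N ξ * symD ξ) G) := fun F G => by
    rw [reIn, inner_mulOp_anti hD (fun ξ => by
      rw [map_mul, conj_cutN, conj_symD, mul_neg]), Complex.neg_re]; rfl
  have hs : ∀ (B A F : LC), Herm B → reIn A (convOp (cutN N) B (mulOp (cutN N) F)) =
      reIn (convOp (cutN N) (mulOp (cutN N) A) B) F := fun B A F hB => by
    rw [reIn, inner_convOp_symm hP (conj_cutN N) hB]; rfl
  have cc := convOp_comm hP
  have hb := herm_hat g
  have hPb : Herm (mulOp (cutN N) (hat g)) := hb.mulOp hP (cutN_neg N)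
  have hlin := linear_cancel 0 N (hat f) (hat g)
  have hx : reIn (mulOp (cut N (symX 0)) (hat g))
      (convOp (fun ξ => cut N (symX 0) ξ * symT ξ) (hat g) (hat g)) =
      reIn (mulOp (cutN N) (hat g))
        (mulOp (fun ξ => cutN N ξ * symD ξ) (convOp (cutN N) (hat g) (hat g))) := by
    have : inner ℂ (mulOp (cut N (symX 0)) (hat g))
      (convOp (fun ξ => cut N (symX 0) ξ * symT ξ) (hat g) (hat g)) =
      inner ℂ (mulOp (cutN N) (hat g))
        (mulOp (fun ξ => cutN N ξ * symD ξ) (convOp (cutN N) (hat g) (hat g))) := by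
      rw [L2.inner_def, L2.inner_def]
      refine integral_congr_ae ?_
      filter_upwards [mulOp_ae hX (hat g), convOp_ae hXT (hat g) (hat g), mulOp_ae hP (hat g),
        mulOp_ae hD (convOp (cutN N) (hat g) (hat g)), convOp_ae hP (hat g) (hat g)]
        with ξ h1 h2 h3 h4 h5
      rw [h1, h2, h3, h4, h5, RCLike.inner_apply, RCLike.inner_apply, map_mul, map_mul, conj_cut,
        conj_cutN]
      have h6 := cut_sq_symT N 0 ξ
      have h7 := cutN_sq N ξ
      change _ = cutN N ξ * (cutN N ξ * symD ξ) at h6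
      linear_combination (conv (hat g) (hat g) ξ * (starRingEnd ℂ) (hat g ξ)) * h6 -
        (conv (hat g) (hat g) ξ * (starRingEnd ℂ) (hat g ξ) * symD ξ * cutN N ξ) * h7
    rw [reIn, this]; rfl
  unfold dHam defect
  simp only [dEta, dV, cT]
  set P := mulOp (cutN N)
  set c := convOp (cutN N)
  set T := mulOp fun ξ => cutN N ξ * symT ξ
  set D := mulOp fun ξ => cutN N ξ * symD ξ
  set a := hat f
  set b := hat g
  have hlin' : reIn (P a) (D b) +
      reIn (mulOp (cut N (symX 0)) b) (mulOp (fun ξ => cut N (symX 0) ξ * symT ξ) a) = 0 := hlin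
  -- the cubic terms
  have k1 : reIn (P a) (c (T a + (1 / 2 : ℝ) • T (c b b)) (P b) + c (P b) (T a + (1 / 2 : ℝ) • T (c b b))) =
      -(2 * reIn (P a) (T (c (P a) (P b)))) + reIn (c (P a) (P b)) (T (c b b)) := by
    have e1 : T a + (1 / 2 : ℝ) • T (c b b) = P (T a + (1 / 2 : ℝ) • T (c b b)) := by
      rw [map_add, map_smul, PT, PT]
    rw [cc _ (P b), reIn_add_right]
    nth_rewrite 1 2 [e1]
    rw [hs _ _ _ hPb, PP, reIn_add_right, reIn_smul_right, ← TP a,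
      reIn_comm _ (T (P a)), Ta]
    ring
  -- Skewness of `T` and symmetry of convolution with `b - P b` rewrite twice this term as a
  -- commutator. Its symbol difference supplies the logarithm missing for `b - P b` in `H^{1/2}`.
  have k2 : reIn (P a) (T (c (P a) (b - P b)) - c (T (P a)) (b - P b)) =
      2 * reIn (P a) (T (c (P a) (b - P b))) := by
    have e1 : reIn (P a) (c (T (P a)) (b - P b)) = reIn (c (P a) (b - P b)) (T (P a)) := by
      rw [cc, ← PT (P a), hs _ _ _ (hb.sub hPb), PP, PT]
    rw [reIn_sub_right, e1, reIn_comm _ (T (P a)), Ta]; ring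
  have k3 : reIn (D b) (c (P b) (P b)) = -reIn (P b) (D (c (P b) (P b))) := by
    rw [← DP, Da]
  have k4 : reIn (T (c a b)) (c (P b) (P b)) = -reIn (c a b) (T (c (P b) (P b))) := Ta _ _
  rw [k1, k2]
  simp only [reIn_add_right, reIn_add_left, reIn_smul_right, map_sub, map_add,
    sub_apply, reIn_sub_right]
  rw [hx, k3, k4]
  have k5 : ∀ F G H : LC, reIn (F - G) H = reIn F H - reIn G H := fun F G H => by
    rw [reIn_comm, reIn_sub_right, reIn_comm H, reIn_comm H]
  simp only [k5, cc (P b) b]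
  linarith

/-! ### Bounds for the cubic part and for the defect -/

lemma enorm_reIn_le (F G : LC) : ‖reIn F G‖ₑ ≤ ∫⁻ ξ, ‖F ξ‖ₑ * ‖G ξ‖ₑ := by
  refine le_trans ?_ (enorm_inner_le F G)
  rw [← ofReal_norm, ← ofReal_norm]
  exact ENNReal.ofReal_le_ofReal (Complex.abs_re_le_norm _)

lemma enorm_cutN_le (N ξ : ℝ) : ‖cutN N ξ‖ₑ ≤ 1 := by
  rw [cutN_eq]; split_ifs <;> simp

lemma enorm_proj (N : ℝ) (F : LC) :
    ∀ᵐ ξ, ‖mulOp (cutN N) F ξ‖ₑ = loE N (fun ξ => ‖F ξ‖ₑ) ξ := by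
  filter_upwards [mulOp_ae (adm_cutN N) F] with ξ h
  rw [h, cutN_eq, loE]
  split_ifs with h1
  · rw [Set.indicator_of_mem (show ξ ∈ Set.Icc (-N) N from abs_le.1 h1), one_mul]
  · rw [Set.indicator_of_notMem (show ξ ∉ Set.Icc (-N) N from fun h' => h1 (abs_le.2 h'))]; simp

lemma enorm_sub_proj (N : ℝ) (F : LC) :
    ∀ᵐ ξ, ‖(F - mulOp (cutN N) F : LC) ξ‖ₑ = hiE N (fun ξ => ‖F ξ‖ₑ) ξ := by
  filter_upwards [mulOp_ae (adm_cutN N) F, Lp.coeFn_sub F (mulOp (cutN N) F)] with ξ h h2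
  rw [h2, Pi.sub_apply, h, cutN_eq, hiE]
  split_ifs with h1
  · rw [Set.indicator_of_notMem (show ξ ∉ (Set.Icc (-N) N)ᶜ from fun h' => h' (abs_le.1 h1))]; simp
  · rw [Set.indicator_of_mem (show ξ ∈ (Set.Icc (-N) N)ᶜ from fun h' => h1 (abs_le.2 h'))]; simp

lemma convE_mono_ae {A A' B B' : ℝ → ℝ≥0∞} (hA : ∀ᵐ ξ, A ξ ≤ A' ξ) (hB : ∀ᵐ ξ, B ξ ≤ B' ξ) (ξ : ℝ) :
    convE A B ξ ≤ convE A' B' ξ := by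
  refine lintegral_mono_ae ?_
  have hq : Measure.QuasiMeasurePreserving (fun ζ : ℝ => ξ - ζ) volume volume :=
    (Measure.measurePreserving_sub_left volume ξ).quasiMeasurePreserving
  filter_upwards [hA, hq.ae hB] with ζ h1 h2
  gcongr

lemma enorm_convOp_le (N : ℝ) {G H : LC} {G' H' : ℝ → ℝ≥0∞} (hG : ∀ᵐ ξ, ‖G ξ‖ₑ ≤ G' ξ)
    (hH : ∀ᵐ ξ, ‖H ξ‖ₑ ≤ H' ξ) : ∀ᵐ ξ, ‖convOp (cutN N) G H ξ‖ₑ ≤ convE G' H' ξ := by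
  filter_upwards [convOp_ae (adm_cutN N) G H] with ξ h1
  rw [h1, enorm_mul]
  calc _ ≤ 1 * convE (fun ζ => ‖G ζ‖ₑ) (fun ζ => ‖H ζ‖ₑ) ξ := by
        gcongr
        · exact enorm_cutN_le N ξ
        · exact enorm_conv_le _ _ _
    _ ≤ _ := by rw [one_mul]; exact convE_mono_ae hG hH ξ

lemma enorm_reIn_mulOp_le (N : ℝ) {q : ℝ → ℂ} (hq : Continuous q) {W : ℝ → ℝ≥0∞}
    (hW : ∀ ξ, ‖q ξ‖ₑ ≤ W ξ) {F G : LC} {F' G' : ℝ → ℝ≥0∞} (hF : ∀ᵐ ξ, ‖F ξ‖ₑ ≤ F' ξ)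
    (hG : ∀ᵐ ξ, ‖G ξ‖ₑ ≤ G' ξ) :
    ‖reIn F (mulOp (fun ξ => cutN N ξ * q ξ) G)‖ₑ ≤ ∫⁻ ξ, W ξ * (F' ξ * G' ξ) := by
  refine (enorm_reIn_le _ _).trans (lintegral_mono_ae ?_)
  filter_upwards [mulOp_ae ((adm_cutN N).mul_continuous hq) G, hF, hG] with ξ h1 h2 h3
  rw [h1, enorm_mul, enorm_mul]
  calc _ ≤ F' ξ * (1 * W ξ * G' ξ) := by
        gcongr
        · exact enorm_cutN_le N ξ
        · exact hW ξ
    _ = _ := by ring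

lemma ae_enorm_hat_le (f : L2) : ∀ᵐ ξ, ‖hat f ξ‖ₑ ≤ aHat f ξ := Eventually.of_forall fun _ => le_rfl

lemma ae_enorm_proj_le (N : ℝ) (f : L2) : ∀ᵐ ξ, ‖mulOp (cutN N) (hat f) ξ‖ₑ ≤ loE N (aHat f) ξ := by
  filter_upwards [enorm_proj N (hat f)] with ξ h using h.le

lemma ae_enorm_proj_le' (N : ℝ) (f : L2) : ∀ᵐ ξ, ‖mulOp (cutN N) (hat f) ξ‖ₑ ≤ aHat f ξ := by
  filter_upwards [ae_enorm_proj_le N f] with ξ h using h.trans (loE_le ξ)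

lemma ae_enorm_sub_proj_le (N : ℝ) (f : L2) :
    ∀ᵐ ξ, ‖(hat f - mulOp (cutN N) (hat f) : LC) ξ‖ₑ ≤ hiE N (aHat f) ξ := by
  filter_upwards [enorm_sub_proj N (hat f)] with ξ h using h.le

/-- Under the convolution integral the commutator of `T` acts as the kernel `symT ξ - symT ζ`.
Taking moduli only after this subtraction preserves the gain. -/
lemma enorm_commutator_le (N : ℝ) (f g : L2) :
    ‖reIn (mulOp (cutN N) (hat f))
      (mulOp (fun ξ => cutN N ξ * symT ξ) (convOp (cutN N) (mulOp (cutN N) (hat f))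
        (hat g - mulOp (cutN N) (hat g))) -
      convOp (cutN N) (mulOp (fun ξ => cutN N ξ * symT ξ) (mulOp (cutN N) (hat f)))
        (hat g - mulOp (cutN N) (hat g)))‖ₑ ≤
    tri (fun ξ ζ => ‖symT ξ - symT ζ‖ₑ) (aHat f) (aHat f) (hiE N (aHat g)) := by
  have hP := adm_cutN N
  have hT := hP.mul_continuous contDiff_symT.continuous
  set A := mulOp (cutN N) (hat f) with hA
  set b' := hat g - mulOp (cutN N) (hat g)
  set T := mulOp fun ξ => cutN N ξ * symT ξ with hTdef
  have hTA : ∀ᵐ ζ, T A ζ = symT ζ * A ζ := by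
    filter_upwards [mulOp_ae hT A, mulOp_ae hP (hat f)] with ζ h1 h2
    rw [h1, h2]
    linear_combination (symT ζ * hat f ζ) * cutN_sq N ζ
  refine (enorm_reIn_le _ _).trans (lintegral_mono_ae ?_)
  filter_upwards [ae_enorm_proj_le' N f, mulOp_ae hT (convOp (cutN N) A b'), convOp_ae hP A b',
    convOp_ae hP (T A) b', Lp.coeFn_sub (T (convOp (cutN N) A b')) (convOp (cutN N) (T A) b')]
    with ξ h1 h2 h3 h4 h5
  have e : (T (convOp (cutN N) A b') - convOp (cutN N) (T A) b' : LC) ξ =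
      cutN N ξ * ∫ ζ, (symT ξ - symT ζ) * (A ζ * b' (ξ - ζ)) := by
    have e1 : ∫ ζ, (symT ξ - symT ζ) * (A ζ * b' (ξ - ζ)) = symT ξ * conv A b' ξ - conv (T A) b' ξ := by
      rw [conv, conv, ← integral_const_mul, ← integral_sub
        ((integrable_conv' (Lp.memLp A) (Lp.memLp b') ξ).const_mul _)
        (integrable_conv' (Lp.memLp (T A)) (Lp.memLp b') ξ)]
      refine integral_congr_ae ?_
      filter_upwards [hTA] with ζ h6
      rw [h6]; ring
    rw [h5, Pi.sub_apply, h2, h3, h4, e1]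
    linear_combination (symT ξ * conv A b' ξ) * cutN_sq N ξ
  rw [e, enorm_mul]
  have e2 : ‖∫ ζ, (symT ξ - symT ζ) * (A ζ * b' (ξ - ζ))‖ₑ ≤
      ∫⁻ ζ, ‖symT ξ - symT ζ‖ₑ * (aHat f ζ * hiE N (aHat g) (ξ - ζ)) := by
    refine (enorm_integral_le_lintegral_enorm _).trans (lintegral_mono_ae ?_)
    have hq : Measure.QuasiMeasurePreserving (fun ζ : ℝ => ξ - ζ) volume volume :=
      (Measure.measurePreserving_sub_left volume ξ).quasiMeasurePreserving
    filter_upwards [ae_enorm_proj_le' N f, hq.ae (ae_enorm_sub_proj_le N g)] with ζ h6 h7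
    rw [enorm_mul, enorm_mul]
    gcongr
  calc _ ≤ aHat f ξ * (1 * ∫⁻ ζ, ‖symT ξ - symT ζ‖ₑ * (aHat f ζ * hiE N (aHat g) (ξ - ζ))) := by
        gcongr
        exact enorm_cutN_le N ξ
    _ = ∫⁻ ζ, aHat f ξ * (‖symT ξ - symT ζ‖ₑ * (aHat f ζ * hiE N (aHat g) (ξ - ζ))) := by
        rw [one_mul, lintegral_const_mul' _ _ (by simp [aHat])]
    _ = _ := by congr 1; ext ζ; ring

/-- `∫ η v²` needs `v²` only in `L²`, for which half a derivative on one factor and a quarter on the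
other are enough. -/
lemma exists_cubic_le : ∃ C : ℝ, 0 < C ∧ ∀ (N : ℝ) (f g : L2), MemH 0 f → MemH (0 + 1 / 2) g →
    |cubic N f g| ≤ C * normX 0 f g ^ 3 := by
  refine ⟨4 * cM.toReal + 1, by positivity, fun N f g hf hg => ?_⟩
  have hA := measurable_aHat f
  have hB := measurable_aHat g
  set X := ENNReal.ofReal (normX 0 f g) with hX
  have n1 : N2 (aHat f) ≤ X := by
    rw [N2_aHat, ← normH_zero]; exact ENNReal.ofReal_le_ofReal (normH_le_normX 0 f g)
  have n2 : N2 (fun ξ => jE (1 / 2) ξ * aHat g ξ) ≤ 2 * X := by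
    have := N2_jE_aHat hg
    rw [zero_add] at this
    rw [this, hX, show (2 : ℝ≥0∞) = ENNReal.ofReal 2 by simp, ← ENNReal.ofReal_mul (by norm_num)]
    refine ENNReal.ofReal_le_ofReal ?_
    have := normH_half_le_normX hg f
    rwa [zero_add] at this
  have n3 : N2 (fun ξ => jE (1 / 4) ξ * aHat g ξ) ≤ 2 * X :=
    (N2_mono fun ξ => by gcongr; exact jE_mono (by norm_num) ξ).trans n2
  have h : ‖cubic N f g‖ₑ ≤ 4 * cM * X ^ 3 := by
    calc ‖cubic N f g‖ₑ ≤ ∫⁻ ξ, aHat f ξ * convE (aHat g) (aHat g) ξ := by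
          refine (enorm_reIn_le _ _).trans (lintegral_mono_ae ?_)
          filter_upwards [ae_enorm_proj_le' N f,
            enorm_convOp_le N (ae_enorm_proj_le' N g) (ae_enorm_proj_le' N g)] with ξ h1 h2
          gcongr
      _ ≤ cM * (N2 (aHat f) * (N2 fun ξ => jE (1 / 2) ξ * aHat g ξ) *
          N2 fun ξ => jE (1 / 4) ξ * aHat g ξ) := by
          rw [lintegral_mul_convE hB hB]
          exact tri_one_le_mix le_rfl hA hB hB
      _ ≤ cM * (X * (2 * X) * (2 * X)) := by gcongr
      _ = _ := by ring
  have hfin : 4 * cM * X ^ 3 ≠ ∞ := ENNReal.mul_ne_top (ENNReal.mul_ne_top (by norm_num) cM_ne_top)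
    (ENNReal.pow_ne_top ENNReal.ofReal_ne_top)
  have h2 := ENNReal.toReal_mono hfin h
  rw [toReal_enorm, Real.norm_eq_abs, ENNReal.toReal_mul, ENNReal.toReal_mul, ENNReal.toReal_pow,
    ENNReal.toReal_ofReal (normX_nonneg _ _ _), ENNReal.toReal_ofNat] at h2
  have := pow_nonneg (normX_nonneg 0 f g) 3
  nlinarith

/-- The bound for the defect in terms of the high frequencies. -/
lemma enorm_defect_le (N : ℝ) (f g : L2) {X r : ℝ≥0∞} (hx : N2 (aHat f) ≤ X)
    (hy : N2 (fun ξ => jE (1 / 2) ξ * aHat g ξ) ≤ X) (hp : N2 (hiE N (aHat f)) ≤ r)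
    (hq : N2 (fun ξ => jE (1 / 2) ξ * hiE N (aHat g) ξ) ≤ r) :
    ‖defect N f g‖ₑ ≤ ((8 + 4 * c2) ^ (1 / 2 : ℝ) + 4 * 2 ^ (1 / 2 : ℝ) +
      4 * (cM * (ENNReal.ofReal (2 ^ (1 / 4 : ℝ)) * (2 * cM)))) * ((X ^ 2 + X ^ 3) * r) := by
  have hA := measurable_aHat f
  have hB := measurable_aHat g
  have hhA : Measurable (hiE N (aHat f)) := measurable_hiE hA
  have hhB : Measurable (hiE N (aHat g)) := measurable_hiE hB
  have cT := contDiff_symT.continuous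
  have cD := contDiff_symD.continuous
  set k₁ : ℝ≥0∞ := (8 + 4 * c2) ^ (1 / 2 : ℝ)
  set k₂ : ℝ≥0∞ := 2 ^ (1 / 2 : ℝ)
  set k₄ : ℝ≥0∞ := cM * (ENNReal.ofReal (2 ^ (1 / 4 : ℝ)) * (2 * cM))
  have P := ae_enorm_proj_le' N
  have L := ae_enorm_proj_le N
  have H := ae_enorm_sub_proj_le N
  have Id := ae_enorm_hat_le
  have t1 := (enorm_commutator_le N f g).trans (tri_symT_le hA hA hhB)
  have t2 := (enorm_reIn_mulOp_le N cT enorm_symT_le (L f)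
    (enorm_convOp_le N (H f) (Id g)))
  simp only [one_mul] at t2
  rw [lintegral_mul_convE hhA hB] at t2
  replace t2 := t2.trans (tri_lo_hi_le hA hB)
  have tD : ∀ G : LC, (∀ᵐ ξ, ‖G ξ‖ₑ ≤ aHat g ξ) →
      ‖reIn (mulOp (cutN N) (hat g)) (mulOp (fun ξ => cutN N ξ * symD ξ)
        (convOp (cutN N) G (hat g - mulOp (cutN N) (hat g))))‖ₑ ≤ k₂ * (X * X * r) := by
    intro G hG
    refine (enorm_reIn_mulOp_le N cD enorm_symD_le (L g) (enorm_convOp_le N hG (H g))).trans ?_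
    have e : ∫⁻ ξ, jE 1 ξ * (loE N (aHat g) ξ * convE (aHat g) (hiE N (aHat g)) ξ) =
        tri (fun ξ _ => jE 1 ξ) (loE N (aHat g)) (aHat g) (hiE N (aHat g)) := by
      unfold tri convE
      congr 1; ext ξ
      rw [← lintegral_const_mul _ (by fun_prop), ← lintegral_const_mul _ (by fun_prop)]
      congr 1; ext ζ; ring
    rw [e]
    exact (tri_jE_lo_hi_le hB hB).trans (by gcongr)
  have t3 := tD _ (Id g)
  have t4 := tD _ (P g)
  have tQ : ∀ (F G H K : LC) (F' G' H' K' : ℝ → ℝ≥0∞), (∀ᵐ ξ, ‖F ξ‖ₑ ≤ F' ξ) →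
      (∀ᵐ ξ, ‖G ξ‖ₑ ≤ G' ξ) → (∀ᵐ ξ, ‖H ξ‖ₑ ≤ H' ξ) → (∀ᵐ ξ, ‖K ξ‖ₑ ≤ K' ξ) →
      Measurable F' → Measurable G' → Measurable H' → Measurable K' →
      ‖reIn (convOp (cutN N) F G) (mulOp (fun ξ => cutN N ξ * symT ξ) (convOp (cutN N) H K))‖ₑ ≤
        k₄ * (N2 F' * ((N2 fun θ => jE (1 / 2) θ * H' θ) * (N2 fun θ => jE (1 / 2) θ * K' θ) *
        N2 fun θ => jE (1 / 2) θ * G' θ)) := by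
    intro F G H K F' G' H' K' hF hG hH hK mF mG mH mK
    refine (enorm_reIn_mulOp_le N cT enorm_symT_le (enorm_convOp_le N hF hG)
      (enorm_convOp_le N hH hK)).trans ?_
    simp only [one_mul]
    exact quartic_le mF mH mK mG
  have t5 := tQ _ _ _ _ _ _ _ _ (Id f) (Id g) (Id g) (H g) hA hB hB hhB
  have t6 := tQ _ _ _ _ _ _ _ _ (Id f) (Id g) (P g) (H g) hA hB hB hhB
  have t7 := tQ _ _ _ _ _ _ _ _ (P f) (H g) (Id g) (Id g) hA hhB hB hB
  have t8 := tQ _ _ _ _ _ _ _ _ (H f) (Id g) (Id g) (Id g) hhA hB hB hB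
  unfold defect
  simp only
  rw [map_add, reIn_add_right (convOp (cutN N) (hat f) (hat g)), reIn_add_left]
  refine (enorm_add_le _ _).trans ?_
  refine (add_le_add ((enorm_add_le _ _).trans (add_le_add ((enorm_add_le _ _).trans
    (add_le_add t1 (le_of_eq (enorm_mul _ _)))) ((enorm_add_le _ _).trans (add_le_add t3 t4))))
    (enorm_sub_le.trans (add_le_add ((enorm_add_le _ _).trans (add_le_add t5 t6))
      ((enorm_add_le _ _).trans (add_le_add t7 t8))))).trans ?_
  have e2 : ‖(2 : ℝ)‖ₑ = 2 := by rw [← ofReal_norm]; simp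
  rw [e2]
  calc _ ≤ k₁ * (X * X * r) + 2 * (k₂ * (X * r * X)) + (k₂ * (X * X * r) + k₂ * (X * X * r)) +
        (k₄ * (X * (X * r * X)) + k₄ * (X * (X * r * X)) +
          (k₄ * (X * (X * X * r)) + k₄ * (r * (X * X * X)))) := by gcongr; exact t2.trans (by gcongr)
    _ = (k₁ + 4 * k₂) * (X ^ 2 * r) + 4 * k₄ * (X ^ 3 * r) := by ring
    _ ≤ (k₁ + 4 * k₂) * ((X ^ 2 + X ^ 3) * r) + 4 * k₄ * ((X ^ 2 + X ^ 3) * r) := by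
        gcongr
        · exact le_self_add
        · exact le_add_self
    _ = _ := by ring

lemma lintegral_hiE_sq {p : ℝ → ℝ} (hp : ∀ κ, 0 ≤ p κ) {N : ℝ} (hA : Adm (cut N p)) {f : L2}
    (hf : MemLp (multHat p f) 2 volume) :
    ∫⁻ ξ, hiE N (fun ξ => ‖multHat p f ξ‖ₑ) ξ ^ 2 =
      ENNReal.ofReal (multNorm p f ^ 2 - ‖mulOp (cut N p) (hat f)‖ ^ 2) := by
  have e : ∫⁻ ξ, hiE N (fun ξ => ‖multHat p f ξ‖ₑ) ξ ^ 2 =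
      ∫⁻ ξ in (Set.Icc (-N) N)ᶜ, ‖multHat p f ξ‖ₑ ^ 2 := by
    rw [← lintegral_indicator measurableSet_Icc.compl]
    congr 1; ext ξ
    by_cases h : ξ ∈ (Set.Icc (-N) N)ᶜ
    · rw [hiE, Set.indicator_of_mem h, Set.indicator_of_mem h]
    · rw [hiE, Set.indicator_of_notMem h, Set.indicator_of_notMem h]; simp
  have h := lintegral_add_compl (μ := volume) (fun ξ => ‖multHat p f ξ‖ₑ ^ 2)
    (measurableSet_Icc (a := -N) (b := N))
  rw [← ofReal_norm_mulOp_cut hp hA, ← ofReal_multNorm_sq hf] at h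
  rw [e, ENNReal.ofReal_sub _ (by positivity), ← h, ENNReal.add_sub_cancel_left ENNReal.ofReal_ne_top]

lemma N2_le_ofReal_sqrt {f : ℝ → ℝ≥0∞} {x y : ℝ} (h : ∫⁻ ξ, f ξ ^ 2 = ENNReal.ofReal x)
    (hxy : x ≤ y) : N2 f ≤ ENNReal.ofReal (√y) := by
  rw [N2, h, Real.sqrt_eq_rpow]
  rcases le_total x 0 with hx | hx
  · rw [ENNReal.ofReal_of_nonpos hx, ENNReal.zero_rpow_of_pos (by norm_num)]; exact zero_le
  · rw [ENNReal.ofReal_rpow_of_nonneg hx (by norm_num)]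
    exact ENNReal.ofReal_le_ofReal (Real.rpow_le_rpow hx hxy (by norm_num))

/-- Pythagoras for the sharp cutoff: the joint tail `normX² - energy` is the sum of the tails of the
components, and that of `v` is nonnegative. -/
lemma N2_hiE_eta_le {f g : L2} (hf : MemH 0 f) (hg : MemH (0 + 1 / 2) g) (N : ℝ) :
    N2 (hiE N (aHat f)) ≤ ENNReal.ofReal √(normX 0 f g ^ 2 - energy 0 N f g) := by
  have hp : ∀ κ, 0 ≤ symJ 0 κ := fun κ => (symJ_pos 0 κ).le
  have h := lintegral_hiE_sq hp (adm_cut_symJ N 0) hf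
  have e : (fun ξ => ‖multHat (symJ 0) f ξ‖ₑ) = aHat f := by
    ext ξ; rw [enorm_multHat hp, symJ_zero, ENNReal.ofReal_one, one_mul]; rfl
  rw [e] at h
  refine N2_le_ofReal_sqrt h ?_
  have := norm_mulOp_cut_le (fun κ => (symX_pos 0 κ).le) (adm_cut_symX N 0) hg.symX
  rw [normX_sq, energy]; linarith

lemma N2_hiE_v_le {f g : L2} (hf : MemH 0 f) (hg : MemH (0 + 1 / 2) g) (N : ℝ) :
    N2 (fun ξ => jE (1 / 2) ξ * hiE N (aHat g) ξ) ≤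
      2 * ENNReal.ofReal √(normX 0 f g ^ 2 - energy 0 N f g) := by
  have hp : ∀ κ, 0 ≤ symX 0 κ := fun κ => (symX_pos 0 κ).le
  have h := lintegral_hiE_sq hp (adm_cut_symX N 0) hg.symX
  have hm : Measurable fun ξ => ‖multHat (symX 0) g ξ‖ₑ := by
    simp_rw [enorm_multHat hp]
    exact (((measurable_symX 0).comp (measurable_const_mul _)).ennreal_ofReal).mul (measurable_aHat g)
  have hle : N2 (hiE N fun ξ => ‖multHat (symX 0) g ξ‖ₑ) ≤
      ENNReal.ofReal √(normX 0 f g ^ 2 - energy 0 N f g) := by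
    refine N2_le_ofReal_sqrt h ?_
    have := norm_mulOp_cut_le (fun κ => (symJ_pos 0 κ).le) (adm_cut_symJ N 0) hf
    rw [normX_sq, energy]; linarith
  refine le_trans ?_ (mul_le_mul_right hle 2)
  rw [← N2_const_mul _ (measurable_hiE hm)]
  refine N2_mono fun ξ => ?_
  by_cases hξ : ξ ∈ (Set.Icc (-N) N)ᶜ
  · rw [hiE, hiE, Set.indicator_of_mem hξ, Set.indicator_of_mem hξ, enorm_multHat hp, ← mul_assoc]
    refine mul_le_mul_left ?_ _
    have two : (2 : ℝ≥0∞) = ENNReal.ofReal 2 := by simp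
    rw [two, ← ENNReal.ofReal_mul (by norm_num)]
    refine ENNReal.ofReal_le_ofReal ?_
    rw [symX, symJ_zero, one_mul]; exact symJ_half_le _
  · rw [hiE, hiE, Set.indicator_of_notMem hξ, Set.indicator_of_notMem hξ]; simp

lemma exists_defect_le : ∃ C : ℝ, 0 < C ∧ ∀ (N : ℝ) (f g : L2), MemH 0 f → MemH (0 + 1 / 2) g →
    |defect N f g| ≤ C * ((normX 0 f g ^ 2 + normX 0 f g ^ 3) *
      √(normX 0 f g ^ 2 - energy 0 N f g)) := by
  set D : ℝ≥0∞ := (8 + 4 * c2) ^ (1 / 2 : ℝ) + 4 * 2 ^ (1 / 2 : ℝ) +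
      4 * (cM * (ENNReal.ofReal (2 ^ (1 / 4 : ℝ)) * (2 * cM))) with hD
  have h4 : (4 : ℝ≥0∞) ≠ ∞ := by norm_num
  have h2 : (2 : ℝ≥0∞) ≠ ∞ := by norm_num
  have h8 : (8 : ℝ≥0∞) ≠ ∞ := by norm_num
  have hDt : D ≠ ∞ := by
    refine ENNReal.add_ne_top.2 ⟨ENNReal.add_ne_top.2 ⟨?_, ?_⟩, ?_⟩
    · exact ENNReal.rpow_ne_top_of_nonneg (by norm_num)
        (ENNReal.add_ne_top.2 ⟨h8, ENNReal.mul_ne_top h4 c2_lt_top.ne⟩)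
    · exact ENNReal.mul_ne_top h4 (ENNReal.rpow_ne_top_of_nonneg (by norm_num) h2)
    · exact ENNReal.mul_ne_top h4 (ENNReal.mul_ne_top cM_ne_top
        (ENNReal.mul_ne_top ENNReal.ofReal_ne_top (ENNReal.mul_ne_top h2 cM_ne_top)))
  -- Norms and tails enter doubled, and `(2x)³ · 2r` is the worst case.
  refine ⟨16 * D.toReal + 1, by positivity, fun N f g hf hg => ?_⟩
  set x := normX 0 f g with hx
  set r := √(x ^ 2 - energy 0 N f g) with hr
  have hx0 : 0 ≤ x := normX_nonneg _ _ _
  have hr0 : 0 ≤ r := Real.sqrt_nonneg _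
  have two : (2 : ℝ≥0∞) = ENNReal.ofReal 2 := by simp
  have n1 : N2 (aHat f) ≤ ENNReal.ofReal (2 * x) := by
    rw [N2_aHat, ← normH_zero]
    refine ENNReal.ofReal_le_ofReal ?_
    linarith [normH_le_normX 0 f g]
  have n2 : N2 (fun ξ => jE (1 / 2) ξ * aHat g ξ) ≤ ENNReal.ofReal (2 * x) := by
    have := N2_jE_aHat hg
    rw [zero_add] at this
    rw [this]
    refine ENNReal.ofReal_le_ofReal ?_
    have := normH_half_le_normX hg f
    rwa [zero_add] at this
  have n3 : N2 (hiE N (aHat f)) ≤ ENNReal.ofReal (2 * r) :=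
    (N2_hiE_eta_le hf hg N).trans (ENNReal.ofReal_le_ofReal (by linarith))
  have n4 : N2 (fun ξ => jE (1 / 2) ξ * hiE N (aHat g) ξ) ≤ ENNReal.ofReal (2 * r) := by
    rw [ENNReal.ofReal_mul (by norm_num), ← two]; exact N2_hiE_v_le hf hg N
  have h := enorm_defect_le N f g n1 n2 n3 n4
  rw [← hD, ← ENNReal.ofReal_pow (by positivity), ← ENNReal.ofReal_pow (by positivity),
    ← ENNReal.ofReal_add (by positivity) (by positivity), ← ENNReal.ofReal_mul (by positivity)] at h
  have h5 := ENNReal.toReal_mono (ENNReal.mul_ne_top hDt ENNReal.ofReal_ne_top) h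
  rw [toReal_enorm, Real.norm_eq_abs, ENNReal.toReal_mul, ENNReal.toReal_ofReal (by positivity)] at h5
  have hD0 : 0 ≤ D.toReal := ENNReal.toReal_nonneg
  refine h5.trans ?_
  have p1 : 0 ≤ x ^ 2 * r := by positivity
  have p2 : 0 ≤ x ^ 3 * r := by positivity
  have e : D.toReal * (((2 * x) ^ 2 + (2 * x) ^ 3) * (2 * r)) =
      D.toReal * (8 * (x ^ 2 * r) + 16 * (x ^ 3 * r)) := by ring
  rw [e]
  nlinarith [mul_nonneg hD0 p1, mul_nonneg hD0 p2]

/-! ### Conservation of the Hamiltonian -/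

variable {I : Set ℝ} {η v : ℝ → L2}

lemma HasDerivWithinAt.reIn {F G : ℝ → LC} {F' G' : LC} {I : Set ℝ} {t : ℝ}
    (hF : HasDerivWithinAt F F' I t) (hG : HasDerivWithinAt G G' I t) :
    HasDerivWithinAt (fun τ => reIn (F τ) (G τ)) (reIn (F t) G' + reIn F' (G t)) I t := by
  have h1 := hF.inner ℂ hG
  have h2 := Complex.reCLM.hasFDerivAt.comp_hasDerivWithinAt t h1
  exact h2.congr_deriv (by simp [WhithamBoussinesq.reIn])

lemma IsSolution.hasDeriv_energy_zero (hI : I.OrdConnected) (hu : IsSolution 0 I η v) (N : ℝ)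
    {t : ℝ} (ht : t ∈ I) :
    HasDerivWithinAt (fun τ => energy 0 N (η τ) (v τ))
      (2 * reIn (mulOp (cutN N) (hat (η t))) (dEta (cutN N) (η t) (v t)) +
        2 * reIn (mulOp (cut N (symX 0)) (hat (v t))) (dV (cut N (symX 0)) (η t) (v t))) I t :=
  (hasDerivWithinAt_norm_sq (hu.hasDeriv le_rfl hI (adm_cutN N) ht).1).add
    (hasDerivWithinAt_norm_sq (hu.hasDeriv le_rfl hI (adm_cut_symX N 0) ht).2)

lemma IsSolution.hasDeriv_ham (hI : I.OrdConnected) (hu : IsSolution 0 I η v) (N : ℝ)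
    {t : ℝ} (ht : t ∈ I) :
    HasDerivWithinAt (fun τ => energy 0 N (η τ) (v τ) + cubic N (η τ) (v τ))
      (defect N (η t) (v t)) I t := by
  obtain ⟨hA, hB⟩ := hu.hasDeriv le_rfl hI (adm_cutN N) ht
  have hc := ((convOp (cutN N)).hasFDerivAt.comp_hasDerivWithinAt t hB).clm_apply hB
  rw [← dHam_eq_defect]
  exact (hu.hasDeriv_energy_zero hI N ht).add (HasDerivWithinAt.reIn hA hc)

/-- The difference is bounded by the time integral of `|defect|`. Its bound tends to zero pointwise,
being a tail of a finite norm, and is dominated by `C (X² + X³) X`, which is continuous in time. -/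
lemma IsSolution.tendsto_ham_sub (hI : I.OrdConnected) (hu : IsSolution 0 I η v) {t₁ t₂ : ℝ}
    (h₁ : t₁ ∈ I) (h₂ : t₂ ∈ I) (hle : t₁ ≤ t₂) :
    Tendsto (fun N => energy 0 N (η t₂) (v t₂) + cubic N (η t₂) (v t₂) -
      (energy 0 N (η t₁) (v t₁) + cubic N (η t₁) (v t₁))) atTop (𝓝 0) := by
  obtain ⟨C, hC, hdef⟩ := exists_defect_le
  have hsub : Set.Icc t₁ t₂ ⊆ I := hI.out h₁ h₂
  set X : ℝ → ℝ := fun τ => normX 0 (η τ) (v τ) with hX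
  have hX0 : ∀ τ, 0 ≤ X τ := fun τ => normX_nonneg _ _ _
  have hXc : ContinuousOn X (Set.Icc t₁ t₂) := hu.continuousOn_normX.mono hsub
  set g : ℝ → ℝ → ℝ := fun N τ =>
    C * ((X τ ^ 2 + X τ ^ 3) * √(X τ ^ 2 - energy 0 N (η τ) (v τ))) with hg
  have hEc : ∀ N, ContinuousOn (fun τ => energy 0 N (η τ) (v τ)) (Set.Icc t₁ t₂) := fun N τ hτ =>
    ((hu.hasDeriv_energy_zero hI N (hsub hτ)).continuousWithinAt).mono hsub
  have hgc : ∀ N, ContinuousOn (g N) (Set.Icc t₁ t₂) := fun N => by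
    have := hEc N
    have h2 : ContinuousOn (fun τ => √(X τ ^ 2 - energy 0 N (η τ) (v τ))) (Set.Icc t₁ t₂) :=
      Real.continuous_sqrt.comp_continuousOn ((hXc.pow 2).sub this)
    exact continuousOn_const.mul (((hXc.pow 2).add (hXc.pow 3)).mul h2)
  set f : ℝ → ℝ → ℝ := fun N τ => energy 0 N (η τ) (v τ) + cubic N (η τ) (v τ) with hf
  have hfc : ∀ N, ContinuousOn (f N) (Set.Icc t₁ t₂) := fun N τ hτ =>
    (hu.hasDeriv_ham hI N (hsub hτ)).continuousWithinAt.mono hsub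
  have hfd : ∀ N, ∀ τ ∈ Set.Ioo t₁ t₂, HasDerivWithinAt (f N) (defect N (η τ) (v τ)) (Set.Ioi τ) τ :=
    fun N τ hτ => ((hu.hasDeriv_ham hI N (hsub (Set.Ioo_subset_Icc_self hτ))).hasDerivAt
      (mem_of_superset (Icc_mem_nhds hτ.1 hτ.2) hsub)).hasDerivWithinAt
  have hdle : ∀ N, ∀ τ ∈ Set.Ioo t₁ t₂, |defect N (η τ) (v τ)| ≤ g N τ := fun N τ hτ =>
    hdef N _ _ (hu.mem_eta τ (hsub (Set.Ioo_subset_Icc_self hτ)))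
      (hu.mem_v τ (hsub (Set.Ioo_subset_Icc_self hτ)))
  have hbound : ∀ N, |f N t₂ - f N t₁| ≤ ∫ τ in t₁..t₂, g N τ := fun N => by
    have i := (hgc N).integrableOn_Icc (μ := volume)
    have u1 := intervalIntegral.sub_le_integral_of_hasDeriv_right_of_le hle (hfc N) (hfd N) i
      fun τ hτ => (le_abs_self _).trans (hdle N τ hτ)
    have u2 := intervalIntegral.sub_le_integral_of_hasDeriv_right_of_le hle (hfc N).neg
      (fun τ hτ => (hfd N τ hτ).neg) i fun τ hτ => (neg_le_abs _).trans (hdle N τ hτ)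
    simp only [Pi.neg_apply] at u2
    rw [abs_le]; constructor <;> linarith
  have hlim : Tendsto (fun N => ∫ τ in t₁..t₂, g N τ) atTop (𝓝 (∫ _ in t₁..t₂, (0 : ℝ))) := by
    refine intervalIntegral.tendsto_integral_filter_of_dominated_convergence
      (fun τ => C * ((X τ ^ 2 + X τ ^ 3) * X τ)) (Eventually.of_forall fun N => ?_)
      (Eventually.of_forall fun N => Eventually.of_forall fun τ hτ => ?_) ?_
      (Eventually.of_forall fun τ hτ => ?_)
    · rw [Set.uIoc_of_le hle]
      exact ((hgc N).mono Set.Ioc_subset_Icc_self).aestronglyMeasurable measurableSet_Ioc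
    · have h3 := hX0 τ
      rw [hg, Real.norm_of_nonneg (by positivity)]
      have : √(X τ ^ 2 - energy 0 N (η τ) (v τ)) ≤ X τ := by
        rw [Real.sqrt_le_left h3]
        have : 0 ≤ energy 0 N (η τ) (v τ) := by unfold energy; positivity
        linarith
      simp only
      gcongr
    · refine ContinuousOn.intervalIntegrable_of_Icc hle ?_
      exact continuousOn_const.mul (((hXc.pow 2).add (hXc.pow 3)).mul hXc)
    · rw [Set.uIoc_of_le hle] at hτ
      have hτI := hsub (Set.Ioc_subset_Icc_self hτ)
      have h3 := tendsto_energy (hu.mem_eta τ hτI) (hu.mem_v τ hτI)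
      have h4 : Tendsto (fun N => √(X τ ^ 2 - energy 0 N (η τ) (v τ))) atTop (𝓝 0) := by
        have h5 : Tendsto (fun N => √(X τ ^ 2 - energy 0 N (η τ) (v τ))) atTop
            (𝓝 √(X τ ^ 2 - X τ ^ 2)) := (Real.continuous_sqrt.tendsto _).comp (h3.const_sub _)
        rwa [sub_self, Real.sqrt_zero] at h5
      have h6 := (h4.const_mul (X τ ^ 2 + X τ ^ 3)).const_mul C
      simpa using h6
  rw [intervalIntegral.integral_zero] at hlim
  exact squeeze_zero_norm (fun N => (Real.norm_eq_abs _).trans_le (hbound N)) hlim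

/-- The consequence of the conservation of the Hamiltonian for the size of the solution. -/
lemma exists_normX_sq_le : ∃ C : ℝ, 0 < C ∧ ∀ (I : Set ℝ) (η v : ℝ → L2), I.OrdConnected → 0 ∈ I →
    IsSolution 0 I η v → ∀ t ∈ I, normX 0 (η t) (v t) ^ 2 ≤
      normX 0 (η 0) (v 0) ^ 2 + C * (normX 0 (η 0) (v 0) ^ 3 + normX 0 (η t) (v t) ^ 3) := by
  obtain ⟨C, hC, hcub⟩ := exists_cubic_le
  refine ⟨C, hC, fun I η v hI h0 hu t ht => ?_⟩
  have hlim : Tendsto (fun N => energy 0 N (η t) (v t) + cubic N (η t) (v t) -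
      (energy 0 N (η 0) (v 0) + cubic N (η 0) (v 0))) atTop (𝓝 0) := by
    rcases le_total 0 t with h | h
    · exact hu.tendsto_ham_sub hI h0 ht h
    · simpa using (hu.tendsto_ham_sub hI ht h0 h).neg
  have e1 := tendsto_energy (hu.mem_eta t ht) (hu.mem_v t ht)
  have e0 := tendsto_energy (hu.mem_eta 0 h0) (hu.mem_v 0 h0)
  have hr := (e0.add hlim).add_const
    (C * (normX 0 (η 0) (v 0) ^ 3 + normX 0 (η t) (v t) ^ 3))
  rw [add_zero] at hr
  refine le_of_tendsto_of_tendsto' e1 hr fun N => ?_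
  have c1 := abs_le.1 (hcub N _ _ (hu.mem_eta t ht) (hu.mem_v t ht))
  have c0 := abs_le.1 (hcub N _ _ (hu.mem_eta 0 h0) (hu.mem_v 0 h0))
  linarith [c1.1, c0.2]

/-- The intermediate value theorem closes the bootstrap: only the exact value `ε` has to be
excluded. -/
lemma lt_of_forall_ne (hI : I.OrdConnected) (h0 : 0 ∈ I) {F : ℝ → ℝ} (hF : ContinuousOn F I) {ε : ℝ}
    (h : F 0 < ε) (hne : ∀ t ∈ I, F t ≠ ε) {t : ℝ} (ht : t ∈ I) : F t < ε := by
  by_contra hc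
  obtain ⟨τ, hτ, he⟩ := hI.isPreconnected.intermediate_value h0 ht hF ⟨h.le, not_lt.1 hc⟩
  exact hne τ hτ he

lemma normX_zero_le_normL2H {f g : L2} (hg : MemH (1 / 2) g) : normX 0 f g ≤ normL2H f g := by
  have h := multNorm_le_of_le (m := symJ (1 / 2)) (m' := symX 0) zero_le_one (fun κ => by
    rw [abs_symX, abs_symJ, one_mul]
    simpa using symX_le 0 κ) hg
  rw [one_mul] at h
  rw [normX_def, normL2H]
  have := multNorm_nonneg (symX 0) g
  unfold normH at *
  gcongr

lemma normL2H_sq (f g : L2) : normL2H f g ^ 2 = normH 0 f ^ 2 + normH (1 / 2) g ^ 2 :=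
  Real.sq_sqrt (by positivity)

/-- In `exists_global_bound` this constant is multiplied by `2/5`, and the result must stay below
`1`. The factor `4` obtained by squaring `symJ_half_le` would be too large. -/
lemma normL2H_sq_le {f g : L2} (hg : MemH (0 + 1 / 2) g) :
    normL2H f g ^ 2 ≤ 3 / 2 * normX 0 f g ^ 2 := by
  -- `6/5` is admissible because its square exceeds the `√2` of `symJ_one_le`, and it suffices
  -- because `36/25 ≤ 3/2`.
  have h := multNorm_le_of_le (m := symX 0) (m' := symJ (1 / 2)) (show (0 : ℝ) ≤ 6 / 5 by norm_num)
    (fun κ => by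
      rw [abs_symX, abs_symJ, symX, symJ_zero, one_mul]
      have := symK_inv_pos κ
      refine abs_le_of_sq_le_sq' ?_ (by positivity) |>.2
      rw [symJ_half_sq, mul_pow]
      refine (symJ_one_le κ).trans ?_
      gcongr
      rw [Real.sqrt_le_left (by norm_num)]; norm_num) hg.symX
  have h0 := multNorm_nonneg (symJ (1 / 2)) g
  have h1 : normH (1 / 2) g ^ 2 ≤ (6 / 5 * multNorm (symX 0) g) ^ 2 := by
    unfold normH; gcongr
  rw [normL2H_sq, normX_sq, ← normH]
  nlinarith [sq_nonneg (normH 0 f), sq_nonneg (multNorm (symX 0) g)]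

lemma IsSolution.continuousOn_normL2H (hu : IsSolution 0 I η v) :
    ContinuousOn (fun t => normL2H (η t) (v t)) I := by
  have h1 : ContinuousOn (fun t => normH 0 (η t)) I := by
    simp_rw [normH_zero]; exact (hu.continuousOn_eta le_rfl).norm
  have h2 := hu.continuousOn_normH_v (r := 1 / 2) (by norm_num)
  exact Real.continuous_sqrt.comp_continuousOn ((h1.pow 2).add (h2.pow 2))

/-- The global bound in the energy space. -/
lemma exists_global_bound : ∃ ε₀ : ℝ, 0 < ε₀ ∧ ∀ ε : ℝ, 0 < ε → ε ≤ ε₀ →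
    ∀ (I : Set ℝ) (η v : ℝ → L2), I.OrdConnected → 0 ∈ I → IsSolution 0 I η v →
      (normL2H (η 0) (v 0) ≤ ε / 2 → ∀ t ∈ I, normL2H (η t) (v t) ≤ ε) ∧
      (normX 0 (η 0) (v 0) ≤ ε / 2 → ∀ t ∈ I, normX 0 (η t) (v t) ≤ ε) := by
  obtain ⟨C, hC, h⟩ := exists_normX_sq_le
  -- With `C ε ≤ 1/10` the cubic terms contribute at most `(1/10)(9/8) ε²`. Together with `ε²/4`
  -- from the data this stays below `(2/5) ε²`.
  refine ⟨1 / (10 * C), by positivity, fun ε hε hε₀ I η v hI h0 hu => ?_⟩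
  have hCε : C * ε ≤ 1 / 10 := by
    rw [le_div_iff₀ (by positivity)] at hε₀; linarith
  have key : ∀ t ∈ I, normX 0 (η 0) (v 0) ≤ ε / 2 → normX 0 (η t) (v t) ≤ ε →
      normX 0 (η t) (v t) ^ 2 ≤ 2 / 5 * ε ^ 2 := fun t ht hx0 hxt => by
    have p0 := normX_nonneg 0 (η 0) (v 0)
    have pt := normX_nonneg 0 (η t) (v t)
    have q0 : normX 0 (η 0) (v 0) ^ 2 ≤ (ε / 2) ^ 2 := by gcongr
    have q1 : normX 0 (η 0) (v 0) ^ 3 ≤ (ε / 2) ^ 3 := by gcongr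
    have q2 : normX 0 (η t) (v t) ^ 3 ≤ ε ^ 3 := by gcongr
    have q3 : C * (normX 0 (η 0) (v 0) ^ 3 + normX 0 (η t) (v t) ^ 3) ≤
        C * ((ε / 2) ^ 3 + ε ^ 3) := by gcongr
    have q4 : C * ((ε / 2) ^ 3 + ε ^ 3) ≤ 1 / 10 * (9 / 8 * ε ^ 2) := by
      calc _ = C * ε * (9 / 8 * ε ^ 2) := by ring
        _ ≤ _ := by gcongr
    have := h I η v hI h0 hu t ht
    nlinarith
  have hε2 : 0 < ε ^ 2 := by positivity
  refine ⟨fun hy t ht => ?_, fun hx t ht => ?_⟩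
  · have hmem : ∀ τ ∈ I, normX 0 (η τ) (v τ) ≤ normL2H (η τ) (v τ) := fun τ hτ =>
      normX_zero_le_normL2H (by simpa using hu.mem_v τ hτ)
    -- If the standard norm reached `ε`, the `X⁰` norm would be at most `ε` and `key` would apply.
    -- Returning to the standard norm gives `ε² ≤ (3/2)(2/5) ε²`, a contradiction.
    refine (lt_of_forall_ne hI h0 hu.continuousOn_normL2H (by linarith) (fun τ hτ he => ?_) ht).le
    have h1 := key τ hτ ((hmem 0 h0).trans hy) ((hmem τ hτ).trans he.le)
    have h2 := normL2H_sq_le (f := η τ) (hu.mem_v τ hτ)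
    rw [he] at h2
    linarith
  · refine (lt_of_forall_ne hI h0 hu.continuousOn_normX (by linarith) (fun τ hτ he => ?_) ht).le
    have h1 := key τ hτ hx he.le
    rw [he] at h1
    linarith

/-! ### Estimates of solutions in `X^s` -/

/-- Persistence of regularity for `1 / 2 ≤ s`. -/
lemma exists_normX_le_of_half_le {s : ℝ} (hs : 1 / 2 ≤ s) : ∃ C : ℝ, 0 < C ∧
    ∀ (I : Set ℝ) (η v : ℝ → L2), I.OrdConnected → 0 ∈ I → IsSolution s I η v →
      ∀ t ∈ I, 0 ≤ t → normX s (η t) (v t) ≤ normX s (η 0) (v 0) +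
        C * ∫ τ in (0 : ℝ)..t, normH (s + 1 / 4) (v τ) * normX s (η τ) (v τ) := by
  obtain ⟨C, hC, h⟩ := exists_flux_le_of_half_le hs
  refine ⟨2 * C, by positivity, fun I η v hI h0 hu t ht ht0 => ?_⟩
  have hle := hu.normX_le (by linarith) hI h0
    (k := fun τ => C * normH (s + 1 / 4) (v τ))
    (continuousOn_const.mul (hu.continuousOn_normH_v (by linarith)))
    (fun τ _ => mul_nonneg hC.le (normH_nonneg _ _))
    (fun τ hτ => h _ _ (hu.mem_eta τ hτ) (hu.mem_v τ hτ)) ht ht0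
  rw [← intervalIntegral.integral_const_mul]
  simpa only [mul_assoc] using hle

/-- Persistence of regularity for `s < 1 / 2`. -/
lemma exists_normX_le_of_lt_half {s : ℝ} (h0s : 0 < s) (hs : s < 1 / 2) : ∃ C : ℝ, 0 < C ∧
    ∀ (I : Set ℝ) (η v : ℝ → L2), I.OrdConnected → 0 ∈ I → IsSolution s I η v →
      ∀ t ∈ I, 0 ≤ t → normX s (η t) (v t) ≤ normX s (η 0) (v 0) +
        C * ∫ τ in (0 : ℝ)..t,
          (normH (1 / 2) (v τ) + normLinfty (v τ)) * normX s (η τ) (v τ) := by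
  obtain ⟨C, hC, h⟩ := exists_flux_le_of_lt_half h0s hs
  refine ⟨2 * C, by positivity, fun I η v hI h0 hu t ht ht0 => ?_⟩
  have hle := hu.normX_le h0s.le hI h0
    (k := fun τ => C * (normH (1 / 2) (v τ) + normLinfty (v τ)))
    (continuousOn_const.mul ((hu.continuousOn_normH_v (by linarith)).add
      (hu.continuousOn_normLinfty h0s)))
    (fun τ _ => mul_nonneg hC.le (add_nonneg (normH_nonneg _ _) (normLinfty_nonneg _)))
    (fun τ hτ => h _ _ (hu.mem_eta τ hτ) (hu.mem_v τ hτ)) ht ht0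
  rw [← intervalIntegral.integral_const_mul]
  simpa only [mul_assoc] using hle

/-- The exponential a priori estimate for `1 / 2 ≤ s`. -/
lemma exists_normX_le_exp {s : ℝ} (hs : 1 / 2 ≤ s) : ∃ C : ℝ, 0 < C ∧
    ∀ (I : Set ℝ) (η v : ℝ → L2), I.OrdConnected → 0 ∈ I → IsSolution s I η v →
      ∀ t ∈ I, 0 ≤ t → normX s (η t) (v t) ≤ normX s (η 0) (v 0) *
        Real.exp (C * ∫ τ in (0 : ℝ)..t, normH (s + 1 / 4) (v τ)) := by
  obtain ⟨C, hC, h⟩ := exists_normX_le_of_half_le hs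
  refine ⟨C, hC, fun I η v hI h0 hu t ht ht0 => ?_⟩
  have hsub := hI.out h0 ht
  rw [← intervalIntegral.integral_const_mul]
  refine gronwall_exp ht0 (normX_nonneg _ _ _) (hu.continuousOn_normX.mono hsub)
    ((continuousOn_const.mul (hu.continuousOn_normH_v (by linarith))).mono hsub)
    (fun r _ => normX_nonneg _ _ _) (fun r _ => mul_nonneg hC.le (normH_nonneg _ _))
    fun r hr => ?_
  have hle := h I η v hI h0 hu r (hsub hr) hr.1
  rw [← intervalIntegral.integral_const_mul] at hle
  simpa only [mul_assoc] using hle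

/-- The doubly exponential a priori estimate for `s < 1 / 2`, for solutions bounded in the
energy space. -/
lemma exists_normX_le_exp_exp {s M : ℝ} (h0s : 0 < s) (hs : s < 1 / 2) (hM : 0 ≤ M) (b : ℝ) :
    ∃ C : ℝ, 0 < C ∧
    ∀ (I : Set ℝ) (η v : ℝ → L2), I.OrdConnected → 0 ∈ I → IsSolution s I η v →
      (∀ t ∈ I, normX 0 (η t) (v t) ≤ M) → normX s (η 0) (v 0) = b →
      ∀ t ∈ I, 0 ≤ t → normX s (η t) (v t) ≤ Real.exp (C * Real.exp (C * t)) := by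
  obtain ⟨C, hC, h⟩ := exists_normX_le_of_lt_half h0s hs
  obtain ⟨L, hL, hlog⟩ := exists_normLinfty_le_log h0s
  -- The `H^{1/2}` norm is at most `2 M`, and the logarithmic factor is at least `1`, so every term
  -- of the Gronwall coefficient can be multiplied by that factor.
  set c : ℝ := C * (2 * M + L + L * (2 * M)) with hc
  have hc0 : 0 ≤ c := by positivity
  -- One constant must dominate both the outer coefficient `log (e + b)` and the inner rate `2 c`.
  -- The absolute value makes it positive for every real `b`.
  refine ⟨|Real.log (Real.exp 1 + b)| + 2 * c + 1, by positivity,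
    fun I η v hI h0 hu hbd hb t ht ht0 => ?_⟩
  have hsub := hI.out h0 ht
  have hX := hu.continuousOn_normX.mono hsub
  have hV : ContinuousOn (fun τ => normH (1 / 2) (v τ) + normLinfty (v τ)) (Set.Icc 0 t) :=
    ((hu.continuousOn_normH_v (by linarith)).add (hu.continuousOn_normLinfty h0s)).mono hsub
  have hlog0 : ∀ τ, 1 ≤ Real.log (Real.exp 1 + normX s (η τ) (v τ)) := fun τ => by
    have := normX_nonneg s (η τ) (v τ)
    rw [Real.le_log_iff_exp_le (by positivity)]; linarith
  have hkey : ∀ τ ∈ I, C * (normH (1 / 2) (v τ) + normLinfty (v τ)) ≤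
      c * (1 + Real.log (Real.exp 1 + normX s (η τ) (v τ))) := fun τ hτ => by
    have h1 := hlog (η τ) (v τ) (hu.mem_v τ hτ)
    have h2 : normH (1 / 2) (v τ) ≤ 2 * M := by
      have h3 := normH_half_le_normX (s := 0) ((hu.mem_v τ hτ).mono (by linarith)) (η τ)
      rw [zero_add] at h3
      linarith [hbd τ hτ]
    have h4 := hlog0 τ
    set ℓ := 1 + Real.log (Real.exp 1 + normX s (η τ) (v τ))
    have h5 : 1 ≤ ℓ := by linarith
    rw [hc, mul_assoc]
    refine mul_le_mul_of_nonneg_left ?_ hC.le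
    calc normH (1 / 2) (v τ) + normLinfty (v τ)
        ≤ 2 * M + L * (1 + 2 * M * ℓ) := by
          refine add_le_add h2 (h1.trans ?_)
          gcongr
      _ ≤ 2 * M * ℓ + L * (ℓ + 2 * M * ℓ) := by
          have := le_mul_of_one_le_right (by positivity : 0 ≤ 2 * M) h5
          gcongr
      _ = _ := by ring
  have hmain := gronwall_log (X := fun τ => normX s (η τ) (v τ)) (c := c) ht0
    (normX_nonneg s (η 0) (v 0)) hc0 hX (fun r _ => normX_nonneg _ _ _) fun r hr => by
      refine (h I η v hI h0 hu r (hsub hr) hr.1).trans ?_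
      rw [← intervalIntegral.integral_const_mul]
      have hsub' : Set.Icc 0 r ⊆ Set.Icc 0 t := Set.Icc_subset_Icc_right hr.2
      have hX' := hX.mono hsub'
      refine add_le_add_right (intervalIntegral.integral_mono_on hr.1
        (ContinuousOn.intervalIntegrable_of_Icc hr.1
          (continuousOn_const.mul ((hV.mono hsub').mul hX')))
        (ContinuousOn.intervalIntegrable_of_Icc hr.1 ?_) fun τ hτ => ?_) _
      · refine (continuousOn_const.mul (continuousOn_const.add
          ((continuousOn_const.add hX').log fun τ _ => ?_))).mul hX'
        exact (add_pos_of_pos_of_nonneg (Real.exp_pos 1) (normX_nonneg _ _ _)).ne'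
      · rw [← mul_assoc]
        exact mul_le_mul_of_nonneg_right (hkey τ (hsub (hsub' hτ))) (normX_nonneg _ _ _)
  refine hmain.trans (Real.exp_le_exp.2 ?_)
  rw [hb]
  have := le_abs_self (Real.log (Real.exp 1 + b))
  have := abs_nonneg (Real.log (Real.exp 1 + b))
  gcongr <;> linarith

end WhithamBoussinesq

end

theorem mainTheorem8 :
    -- persistence of regularity, with a constant depending only on `s`
    (∀ s : ℝ, 0 < s → ∃ C : ℝ, 0 < C ∧
      ∀ (I : Set ℝ) (η v : ℝ → WhithamBoussinesq.L2), I.OrdConnected → 0 ∈ I →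
        WhithamBoussinesq.IsSolution s I η v → ∀ t ∈ I, 0 ≤ t →
        (s < 1 / 2 →
          WhithamBoussinesq.normX s (η t) (v t) ≤ WhithamBoussinesq.normX s (η 0) (v 0) +
            C * ∫ τ in (0 : ℝ)..t,
              (WhithamBoussinesq.normH (1 / 2) (v τ) + WhithamBoussinesq.normLinfty (v τ)) *
                WhithamBoussinesq.normX s (η τ) (v τ)) ∧
        (1 / 2 ≤ s →
          WhithamBoussinesq.normX s (η t) (v t) ≤ WhithamBoussinesq.normX s (η 0) (v 0) +
            C * ∫ τ in (0 : ℝ)..t,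
              WhithamBoussinesq.normH (s + 1 / 4) (v τ) *
                WhithamBoussinesq.normX s (η τ) (v τ))) ∧
    ∃ ε₀ : ℝ, 0 < ε₀ ∧
      -- the global bound in the energy space, for the standard norm and for the norm of `X^0`
      (∀ ε : ℝ, 0 < ε → ε ≤ ε₀ →
        ∀ (I : Set ℝ) (η v : ℝ → WhithamBoussinesq.L2), I.OrdConnected → 0 ∈ I →
          WhithamBoussinesq.IsSolution 0 I η v →
          (WhithamBoussinesq.normL2H (η 0) (v 0) ≤ ε / 2 →
            ∀ t ∈ I, WhithamBoussinesq.normL2H (η t) (v t) ≤ ε) ∧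
          (WhithamBoussinesq.normX 0 (η 0) (v 0) ≤ ε / 2 →
            ∀ t ∈ I, WhithamBoussinesq.normX 0 (η t) (v t) ≤ ε)) ∧
      -- a priori estimates in `X^s`, with a constant depending only on `s` and on the norms
      -- `a`, `b` of the initial data in `X^0` and in `X^s`
      (∀ s a b : ℝ, 0 < s → a ≤ ε₀ / 2 → ∃ C : ℝ, 0 < C ∧
        ∀ (I : Set ℝ) (η v : ℝ → WhithamBoussinesq.L2), I.OrdConnected → 0 ∈ I →
          WhithamBoussinesq.IsSolution s I η v →
          WhithamBoussinesq.normX 0 (η 0) (v 0) = a →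
          WhithamBoussinesq.normX s (η 0) (v 0) = b →
          ∀ t ∈ I, 0 ≤ t →
          (s < 1 / 2 →
            WhithamBoussinesq.normX s (η t) (v t) ≤ Real.exp (C * Real.exp (C * t))) ∧
          (1 / 2 ≤ s →
            WhithamBoussinesq.normX s (η t) (v t) ≤
              WhithamBoussinesq.normX s (η 0) (v 0) *
                Real.exp (C * ∫ τ in (0 : ℝ)..t, WhithamBoussinesq.normH (s + 1 / 4) (v τ)))) := by
  refine ⟨fun s hs => ?_, ?_⟩
  · rcases lt_or_ge s (1 / 2) with h | h
    · obtain ⟨C, hC, hle⟩ := WhithamBoussinesq.exists_normX_le_of_lt_half hs h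
      exact ⟨C, hC, fun I η v hI h0 hu t ht ht0 =>
        ⟨fun _ => hle I η v hI h0 hu t ht ht0, fun h' => absurd h' (not_le.2 h)⟩⟩
    · obtain ⟨C, hC, hle⟩ := WhithamBoussinesq.exists_normX_le_of_half_le h
      exact ⟨C, hC, fun I η v hI h0 hu t ht ht0 =>
        ⟨fun h' => absurd h' (not_lt.2 h), fun _ => hle I η v hI h0 hu t ht ht0⟩⟩
  · obtain ⟨ε₀, hε₀, hglobal⟩ := WhithamBoussinesq.exists_global_bound
    refine ⟨ε₀, hε₀, hglobal, fun s a b hs ha => ?_⟩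
    rcases lt_or_ge s (1 / 2) with h | h
    · obtain ⟨C, hC, hle⟩ := WhithamBoussinesq.exists_normX_le_exp_exp hs h hε₀.le b
      refine ⟨C, hC, fun I η v hI h0 hu hu0 hus t ht ht0 =>
        ⟨fun _ => hle I η v hI h0 hu ?_ hus t ht ht0, fun h' => absurd h' (not_le.2 h)⟩⟩
      -- The global bound with `ε = ε₀`, applied to the same solution viewed in `X⁰`, gives a bound
      -- that does not depend on the solution.
      exact (hglobal ε₀ hε₀ le_rfl I η v hI h0 (hu.mono hs.le)).2 (hu0.trans_le ha)
    · obtain ⟨C, hC, hle⟩ := WhithamBoussinesq.exists_normX_le_exp h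
      exact ⟨C, hC, fun I η v hI h0 hu _ _ t ht ht0 =>
        ⟨fun h' => absurd h' (not_lt.2 h), fun _ => hle I η v hI h0 hu t ht ht0⟩⟩
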